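/- Let $\Omega\subset\mathbb R^3$ be a bounded open set with Lipschitz boundary, and let $\Gamma_1,\dots,\Gamma_K\subset\partial\Omega$ (the inlets/outlets) be pairwise disjoint, relatively open subsets of $\partial\Omega$ such that each $\Gamma_k$ is flat, i.e. contained in a plane, with constant outer unit normal $n_k$. Put $\Gamma_0=\partial\Omega\setminus\bigcup_{k}\Gamma_k$. Boundary values are understood in the sense of traces, and $(\cdot,\cdot)$, $(\cdot,\cdot)_{\Gamma_k}$ denote the $L^2$ inner products on $\Omega$ and (with respect to surface measure) on $\Gamma_k$. Let $$V=\{v\in H^1(\Omega;\mathbb R^3):\ \nabla\cdot v=0\ \text{in }\Omega,\ v|_{\Gamma_0}=0\},$$ $$V_{H^2}=\{v\in H^2(\Omega;\mathbb R^3)\cap V:\ (\nabla v\cdot n_k)\cdot\tau|_{\Gamma_k}=0\ \text{for all }k\text{ and all }\tau\in\mathbb R^3\text{ with }\tau\cdot n_k=0\},$$ where $\nabla v\cdot n_k=\sum_i (n_k)_i\,\partial_i v$. Let $\nu>0$, $\gamma_k,\lambda_k>0$ for $k=1,\dots,K$, $T>0$, $v_0\in V_{H^2}$, $S_k\in H^1(0,T)$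 for $k=1,\dots,K$ and $f\in H^1(0,T;V)$. Consider the unsteady Stokes system $$v_t-\nu\Delta v+\nabla p=f,\qquad \nabla\cdot v=0\quad\text{in }\Omega\times(0,T),\qquad v|_{\Gamma_0}=0,\qquad v(0)=v_0,$$ $$p\,n_k-\nu\nabla v\cdot n_k-n_k\Big(\lambda_k+\gamma_k\frac{d}{dt}\Big)(v\cdot n_k)=S_k n_k\quad\text{on }\Gamma_k,\ k=1,\dots,K.$$ A weak solution is a function $v\in H^1(0,T;V)$ whose representative in $C([0,T];H^1(\Omega;\mathbb R^3))$ satisfies $v(0)=v_0$ and such that, for almost every $t\in(0,T)$ and all $w\in V$, $$(v_t,w)+\nu(\nabla v,\nabla w)+\sum_{k=1}^K\gamma_k(v_t\cdot n_k,w\cdot n_k)_{\Gamma_k}+\sum_{k=1}^K\lambda_k(v\cdot n_k,w\cdot n_k)_{\Gamma_k}=(f,w)-\sum_{k=1}^K(S_k,w\cdot n_k)_{\Gamma_k}.$$ Then there exists exactly one weak solution $v\in H^1(0,T;V)$ (unique up to equality for almost every $t\in(0,T)$). -/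

import Mathlib

open MeasureTheory Filter Topology Set
open scoped ContDiff ENNReal

noncomputable section

namespace OpenStokes

/-- Physical space `ℝ³` with its Euclidean norm. -/
abbrev E3 : Type := EuclideanSpace ℝ (Fin 3)

/-- Triples `(∂₁u, ∂₂u, ∂₃u)` of `F`-valued partial derivatives, with the Euclidean (Frobenius)
inner product. For `F = E3` these are the values of a velocity gradient. -/
abbrev Grad (F : Type*) : Type _ := PiLp 2 (fun _ : Fin 3 => F)

/-! ### The geometry -/

/-- `Ω` is locally, in suitable orthonormal coordinates, the open epigraph of a Lipschitz
function of two variables. -/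
def HasLipschitzBoundary (Ω : Set E3) : Prop :=
  ∀ x ∈ frontier Ω, ∃ (A : E3 ≃ₗᵢ[ℝ] E3) (L : NNReal) (h : EuclideanSpace ℝ (Fin 2) → ℝ) (r : ℝ),
    LipschitzWith L h ∧ 0 < r ∧
      ∀ y ∈ Metric.ball x r, (y ∈ Ω ↔ h !₂[A y 0, A y 1] < A y 2)

/-- A bounded open set `Ω` with Lipschitz boundary and with inlets/outlets `Γ k`: these are
pairwise disjoint, relatively open, flat pieces of the boundary, and `n k` is the (constant)
outer unit normal on `Γ k`. -/
structure IsInletOutletDomain (Ω : Set E3) {K : ℕ} (Γ : Fin K → Set E3) (n : Fin K → E3) :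
    Prop where
  isOpen : IsOpen Ω
  isBounded : Bornology.IsBounded Ω
  lipschitz : HasLipschitzBoundary Ω
  relOpen : ∀ k, ∃ U : Set E3, IsOpen U ∧ Γ k = U ∩ frontier Ω
  disjoint : ∀ j k, j ≠ k → Disjoint (Γ j) (Γ k)
  flat : ∀ k, ∃ c : ℝ, ∀ x ∈ Γ k, inner ℝ x (n k) = c
  unit : ∀ k, ‖n k‖ = 1
  outward : ∀ k, ∀ x ∈ Γ k, ∃ ε > 0, ∀ s ∈ Ioo (0 : ℝ) ε,
    x - s • n k ∈ Ω ∧ x + s • n k ∉ closure Ω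

/-- The wall `Γ₀`: the part of the boundary outside all inlets/outlets. -/
def wall (Ω : Set E3) {K : ℕ} (Γ : Fin K → Set E3) : Set E3 :=
  frontier Ω \ ⋃ k, Γ k

/-- Surface measure on the boundary of `Ω` (two-dimensional Hausdorff measure, normalised so
that it is the usual area). -/
def surfaceMeasure (Ω : Set E3) : Measure E3 :=
  (Measure.euclideanHausdorffMeasure 2 : Measure E3).restrict (frontier Ω)

/-! ### Sobolev spaces on `Ω` -/

section Sobolev

variable (Ω : Set E3) (F : Type*) [NormedAddCommGroup F] [InnerProductSpace ℝ F]

/-- `L²(Ω; F)`. -/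
abbrev L2 : Type _ := Lp F 2 (volume.restrict Ω)

variable {Ω F}

/-- `G` is the weak gradient of `u` in `Ω`. -/
def HasWeakGradient (u : L2 Ω F) (G : L2 Ω (Grad F)) : Prop :=
  ∀ φ : E3 → ℝ, ContDiff ℝ ∞ φ → HasCompactSupport φ → tsupport φ ⊆ Ω → ∀ i : Fin 3,
    ∫ x in Ω, fderiv ℝ φ x (EuclideanSpace.single i 1) • u x = - ∫ x in Ω, φ x • G x i

/-- The pairing of a fixed `ψ ∈ L²` with `L²(Ω; F)` as a continuous linear map. -/
lemma exists_pairing (F : Type*) [NormedAddCommGroup F] [InnerProductSpace ℝ F] {ψ : E3 → ℝ}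
    (hψ : Continuous ψ) (hc : HasCompactSupport ψ) :
    ∃ P : L2 Ω F →L[ℝ] F, ∀ u : L2 Ω F, ∫ x in Ω, ψ x • u x = P u := by
  have hm : MemLp ψ 2 (volume.restrict Ω) := hψ.memLp_of_hasCompactSupport hc
  by_cases hF : CompleteSpace F
  · refine ⟨(ContinuousLinearMap.lsmul ℝ ℝ).lpPairing (volume.restrict Ω) 2 2 (hm.toLp ψ),
      fun u => ?_⟩
    rw [ContinuousLinearMap.lpPairing_eq_integral]
    refine integral_congr_ae ?_
    filter_upwards [hm.coeFn_toLp] with x hx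
    simp [hx]
  · exact ⟨0, fun u => by simp [integral, hF]⟩

/-- The `i`-th partial derivative as a continuous linear map on gradient fields. -/
def gradComp (i : Fin 3) : L2 Ω (Grad F) →L[ℝ] L2 Ω F :=
  (PiLp.proj 2 (fun _ : Fin 3 => F) i : Grad F →L[ℝ] F).compLpL 2 (volume.restrict Ω)

lemma exists_pairing_hasWeakGradient {φ : E3 → ℝ} (hφ : ContDiff ℝ ∞ φ)
    (hc : HasCompactSupport φ) (i : Fin 3) :
    ∃ P : L2 Ω F × L2 Ω (Grad F) →L[ℝ] F, ∀ u G,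
      (∫ x in Ω, fderiv ℝ φ x (EuclideanSpace.single i 1) • u x = - ∫ x in Ω, φ x • G x i)
        ↔ P (u, G) = 0 := by
  have h1 : Continuous fun x => fderiv ℝ φ x (EuclideanSpace.single i 1) :=
    (hφ.continuous_fderiv (by simp)).clm_apply continuous_const
  have h2 : HasCompactSupport fun x => fderiv ℝ φ x (EuclideanSpace.single i 1) :=
    hc.fderiv_apply (𝕜 := ℝ) _
  obtain ⟨P, hP⟩ := exists_pairing (Ω := Ω) F h1 h2
  obtain ⟨Q, hQ⟩ := exists_pairing (Ω := Ω) F hφ.continuous hc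
  refine ⟨P.coprod (Q ∘L gradComp i), fun u G => ?_⟩
  have h3 : ∫ x in Ω, φ x • G x i = Q (gradComp i G) := by
    rw [← hQ]
    refine integral_congr_ae ?_
    filter_upwards [ContinuousLinearMap.coeFn_compLpL (p := 2)
      (PiLp.proj 2 (fun _ : Fin 3 => F) i : Grad F →L[ℝ] F) G] with x hx
    rw [gradComp, hx]
    rfl
  rw [hP, h3]
  simp [eq_neg_iff_add_eq_zero]

variable (Ω F)

/-- `H¹(Ω; F)`: pairs `(u, ∇u)` with `u ∈ L²` and weak gradient `∇u ∈ L²`. As a subspace of the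
Hilbert sum `L² ⊕ L²` it carries the norm `(‖u‖² + ‖∇u‖²)^(1/2)`. -/
def H1 : Submodule ℝ (WithLp 2 (L2 Ω F × L2 Ω (Grad F))) where
  carrier := {p | HasWeakGradient p.fst p.snd}
  zero_mem' := fun φ h1 h2 _ i => by
    obtain ⟨P, hP⟩ := exists_pairing_hasWeakGradient (Ω := Ω) (F := F) h1 h2 i
    exact (hP _ _).2 (map_zero P)
  add_mem' := fun {a b} ha hb φ h1 h2 h3 i => by
    obtain ⟨P, hP⟩ := exists_pairing_hasWeakGradient (Ω := Ω) (F := F) h1 h2 i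
    have ha' := (hP _ _).1 (ha φ h1 h2 h3 i)
    have hb' := (hP _ _).1 (hb φ h1 h2 h3 i)
    refine (hP _ _).2 ?_
    have : P ((a + b).fst, (a + b).snd) = P (a.fst, a.snd) + P (b.fst, b.snd) :=
      map_add P (a.fst, a.snd) (b.fst, b.snd)
    rw [this, ha', hb', add_zero]
  smul_mem' := fun c {a} ha φ h1 h2 h3 i => by
    obtain ⟨P, hP⟩ := exists_pairing_hasWeakGradient (Ω := Ω) (F := F) h1 h2 i
    have ha' := (hP _ _).1 (ha φ h1 h2 h3 i)
    refine (hP _ _).2 ?_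
    have : P ((c • a).fst, (c • a).snd) = c • P (a.fst, a.snd) :=
      map_smul P c (a.fst, a.snd)
    rw [this, ha', smul_zero]

lemma isClosed_H1 : IsClosed (H1 Ω F : Set (WithLp 2 (L2 Ω F × L2 Ω (Grad F)))) := by
  have : (H1 Ω F : Set (WithLp 2 (L2 Ω F × L2 Ω (Grad F)))) =
      ⋂ (φ : E3 → ℝ) (_ : ContDiff ℝ ∞ φ) (_ : HasCompactSupport φ) (_ : tsupport φ ⊆ Ω)
        (i : Fin 3), {p | ∫ x in Ω, fderiv ℝ φ x (EuclideanSpace.single i 1) • p.fst x =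
          - ∫ x in Ω, φ x • p.snd x i} := by
    ext p
    simp only [mem_iInter]
    rfl
  rw [this]
  refine isClosed_iInter fun φ => isClosed_iInter fun h1 => isClosed_iInter fun h2 =>
    isClosed_iInter fun _ => isClosed_iInter fun i => ?_
  obtain ⟨P, hP⟩ := exists_pairing_hasWeakGradient (Ω := Ω) (F := F) h1 h2 i
  simp only [hP]
  exact isClosed_eq (P.continuous.comp (WithLp.prod_continuous_ofLp 2 _ _)) continuous_const

instance [CompleteSpace F] : CompleteSpace (H1 Ω F) :=
  (isClosed_H1 Ω F).completeSpace_coe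

variable {Ω F}

/-- The function underlying an element of `H¹(Ω; F)`. -/
def fieldOf (u : H1 Ω F) : L2 Ω F := (u : WithLp 2 (L2 Ω F × L2 Ω (Grad F))).fst

/-- The weak gradient of an element of `H¹(Ω; F)`. -/
def gradOf (u : H1 Ω F) : L2 Ω (Grad F) := (u : WithLp 2 (L2 Ω F × L2 Ω (Grad F))).snd

/-- The classical gradient `(∂₁φ, ∂₂φ, ∂₃φ)`. -/
def classicalGrad (φ : E3 → F) (x : E3) : Grad F :=
  WithLp.toLp 2 fun i => fderiv ℝ φ x (EuclideanSpace.single i 1)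

/-- `g ∈ L²(∂Ω; F)` is the boundary trace of `u ∈ H¹(Ω; F)`: smooth functions on `ℝ³` converge
to `u` in `H¹(Ω)` while their restrictions to the boundary converge to `g` in `L²(∂Ω)`. -/
def IsTrace (u : H1 Ω F) (g : Lp F 2 (surfaceMeasure Ω)) : Prop :=
  ∃ φ : ℕ → E3 → F, (∀ j, ContDiff ℝ ∞ (φ j) ∧ HasCompactSupport (φ j)) ∧
    Tendsto (fun j => eLpNorm (fun x => φ j x - fieldOf u x) 2 (volume.restrict Ω)) atTop (𝓝 0) ∧
    Tendsto (fun j => eLpNorm (fun x => classicalGrad (φ j) x - gradOf u x) 2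
      (volume.restrict Ω)) atTop (𝓝 0) ∧
    Tendsto (fun j => eLpNorm (fun x => φ j x - g x) 2 (surfaceMeasure Ω)) atTop (𝓝 0)

open Classical in
/-- The trace operator `H¹(Ω; F) → L²(∂Ω; F)`. On a bounded Lipschitz domain every `u` has
exactly one trace, so that the default value is never used. -/
def trace (u : H1 Ω F) : Lp F 2 (surfaceMeasure Ω) :=
  if h : ∃ g, IsTrace u g then h.choose else 0

end Sobolev

/-! ### Spaces of velocity fields -/

section Velocity

variable (Ω : Set E3) {K : ℕ} (Γ : Fin K → Set E3) (n : Fin K → E3)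

/-- `V`: the divergence-free fields in `H¹(Ω; ℝ³)` whose trace vanishes on the wall. -/
def V : Set (H1 Ω E3) :=
  {v | (∀ᵐ x ∂volume.restrict Ω, ∑ i, gradOf v x i i = 0) ∧
    ∀ᵐ x ∂(surfaceMeasure Ω).restrict (wall Ω Γ), trace v x = 0}

/-- `V_{H²}`: the fields in `V ∩ H²(Ω; ℝ³)` (i.e. with `∇v ∈ H¹`) for which the normal derivative
`∇v · n_k = ∑ᵢ (n_k)ᵢ ∂ᵢ v` has no tangential part on any `Γ k`. -/
def VH2 : Set (H1 Ω E3) :=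
  {v | v ∈ V Ω Γ ∧ ∃ D : H1 Ω (Grad E3), fieldOf D = gradOf v ∧
    ∀ k, ∀ τ : E3, inner ℝ τ (n k) = 0 →
      ∀ᵐ x ∂(surfaceMeasure Ω).restrict (Γ k), inner ℝ (∑ i, n k i • trace D x i) τ = 0}

variable {Ω}

/-- `(u · n_k, w · n_k)_{Γ_k}`. -/
def fluxInner (k : Fin K) (u w : H1 Ω E3) : ℝ :=
  ∫ x in Γ k, inner ℝ (trace u x) (n k) * inner ℝ (trace w x) (n k) ∂surfaceMeasure Ω

/-- `∫_{Γ_k} w · n_k`. -/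
def flux (k : Fin K) (w : H1 Ω E3) : ℝ :=
  ∫ x in Γ k, inner ℝ (trace w x) (n k) ∂surfaceMeasure Ω

end Velocity

/-! ### Functions of time -/

section Time

variable {X : Type*} [NormedAddCommGroup X] [NormedSpace ℝ X]

/-- `L²(0,T; X)`. -/
abbrev L2Time (T : ℝ) (X : Type*) [NormedAddCommGroup X] : Type _ :=
  Lp X 2 (volume.restrict (Ioo (0 : ℝ) T))

/-- `u'` is the weak time derivative of `u` on `(0,T)`. -/
def HasWeakTimeDeriv {T : ℝ} (u u' : L2Time T X) : Prop :=
  ∀ φ : ℝ → ℝ, ContDiff ℝ ∞ φ → HasCompactSupport φ → tsupport φ ⊆ Ioo 0 T →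
    ∫ t in Ioo 0 T, deriv φ t • u t = - ∫ t in Ioo 0 T, φ t • u' t

/-- `u ∈ H¹(0,T; Y)` with weak derivative `u'`, for a subspace `Y` of `X`. -/
def IsH1TimeWith {T : ℝ} (Y : Set X) (u u' : L2Time T X) : Prop :=
  HasWeakTimeDeriv u u' ∧ ∀ᵐ t ∂volume.restrict (Ioo 0 T), u t ∈ Y ∧ u' t ∈ Y

/-- `u ∈ H¹(0,T; Y)` for a subspace `Y` of `X`. -/
def MemH1Time {T : ℝ} (Y : Set X) (u : L2Time T X) : Prop :=
  ∃ u' : L2Time T X, IsH1TimeWith Y u u'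

/-- `u(0) = u₀`, in the sense of the representative of `u` that is continuous on `[0,T]`. -/
def HasInitialValue {T : ℝ} (u : L2Time T X) (u₀ : X) : Prop :=
  ∃ c : ℝ → X, ContinuousOn c (Icc 0 T) ∧ (∀ᵐ t ∂volume.restrict (Ioo 0 T), u t = c t) ∧ c 0 = u₀

end Time

/-- `v ∈ H¹(0,T; V)` is a weak solution of the unsteady Stokes system with no-slip condition on
the wall, inertia-augmented open dissipative conditions on the `Γ k`, and initial value `v₀`. -/
def IsWeakSolution {Ω : Set E3} {K : ℕ} (Γ : Fin K → Set E3) (n : Fin K → E3) (ν : ℝ)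
    (γ lam : Fin K → ℝ) {T : ℝ} (S : Fin K → L2Time T ℝ) (f : L2Time T (H1 Ω E3))
    (v₀ : H1 Ω E3) (v : L2Time T (H1 Ω E3)) : Prop :=
  ∃ vt : L2Time T (H1 Ω E3), IsH1TimeWith (V Ω Γ) v vt ∧ HasInitialValue v v₀ ∧
    ∀ᵐ t ∂volume.restrict (Ioo 0 T), ∀ w ∈ V Ω Γ,
      inner ℝ (fieldOf (vt t)) (fieldOf w) + ν * inner ℝ (gradOf (v t)) (gradOf w)
          + ∑ k, γ k * fluxInner Γ n k (vt t) w + ∑ k, lam k * fluxInner Γ n k (v t) w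
        = inner ℝ (fieldOf (f t)) (fieldOf w) - ∑ k, S k t * flux Γ n k w

end OpenStokes

end

set_option linter.unusedSectionVars false

open MeasureTheory Filter Topology Set
open scoped ContDiff ENNReal

noncomputable section

namespace OpenStokes

/-! ### The Volterra operator on `L²(0,T; X)` -/

section Volterra

variable {X : Type*} [NormedAddCommGroup X] {T : ℝ}

/-! On X = V, a closed subspace of H¹, Riesz representation turns the weak formulation into M v' + A
v = F. Here M represents (u,w) + ∑ γ_k (u·n_k, w·n_k), A represents ν(∇u,∇w) + ∑ λ_k (u·n_k, w·n_k),
and F represents the right-hand side. M is symmetric and nonnegative but controls only the energy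
(L² norm and normal traces), not the H¹ norm. A + M is coercive, and the substitution u = exp(-t) v
replaces A by B = A + M, so that no Poincaré inequality is needed.

Let J be the Volterra operator and P the integral over (0,T). Up to the initial value, y = u' solves
N y = M y + B J y = g₀ + J g. Everything rests on J + J* = P*P (`inner_volterra_add`). Pairing N y =
0 with J y gives uniqueness. Pairing N*ψ with φ = J*ψ gives ½⟨M Pψ, Pψ⟩ + ⟨Bφ, φ⟩ = ⟨N*ψ, φ⟩, which
bounds both ‖J*ψ‖ and the M-seminorm of Pψ by ‖N*ψ‖. Hence ψ ↦ ⟨g₀ + J g, ψ⟩ = ⟨g₀, Pψ⟩ + ⟨g, J*ψ⟩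
factors through a bounded functional on the range of N*, and Hahn–Banach and Riesz produce y with
values in X (`exists_pointwise_add_volterra_eq`).

This needs ⟨g₀, ·⟩ to be bounded by the M-seminorm, a compatibility condition at t = 0. It is where
v₀ ∈ V_{H²} enters: by Green's formula (∇v₀,∇w) = -(Δv₀,w) + ∑ ∫_{Γ_k} (∇v₀·n_k)·w, and since
∇v₀·n_k has no tangential part, the boundary terms see only w·n_k
(`IsInletOutletDomain.exists_inner_gradOf_eq`).

The rest is analysis on Lipschitz domains. Density of smooth functions and the trace inequality make
the trace a bounded operator, so V is closed. Green's formula is needed only for w vanishing on the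
wall, so no normal field on the Lipschitz part has to be constructed: near the flat pieces Ω is a
half space and the formula is explicit, while elsewhere it suffices that the error is bounded by an
integral of boundary values over the wall (`IsInletOutletDomain.exists_abs_greenDefect_le`). -/

instance isFiniteMeasure_time : IsFiniteMeasure (volume.restrict (Ioo (0 : ℝ) T)) :=
  ⟨by simp⟩

lemma integrable_time (z : L2Time T X) : Integrable z (volume.restrict (Ioo (0 : ℝ) T)) :=
  (Lp.memLp z).integrable (by norm_num)

lemma integral_norm_time_le (z : L2Time T X) :
    ∫ t in Ioo 0 T, ‖z t‖ ≤ ((volume (Ioo (0 : ℝ) T)) ^ (1 / 2 : ℝ)).toReal * ‖z‖ := by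
  have h := eLpNorm_le_eLpNorm_mul_rpow_measure_univ (p := 1) (q := 2)
    (μ := volume.restrict (Ioo (0 : ℝ) T)) (by norm_num) (Lp.memLp z).aestronglyMeasurable
  rw [integral_norm_eq_lintegral_enorm (Lp.memLp z).aestronglyMeasurable, Lp.norm_def,
    ← ENNReal.toReal_mul]
  refine ENNReal.toReal_mono (ENNReal.mul_ne_top (by simp) (Lp.eLpNorm_ne_top z)) ?_
  rw [← eLpNorm_one_eq_lintegral_enorm]
  refine h.trans (le_of_eq ?_)
  rw [mul_comm]
  norm_num

variable [InnerProductSpace ℝ X]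

/-- The primitive of `z ∈ L²(0,T; X)` that vanishes at `0`. -/
def primitive (z : L2Time T X) (t : ℝ) : X :=
  ∫ s in Iio t, z s ∂volume.restrict (Ioo (0 : ℝ) T)

/-- Integrals over `Iio t` suit the Fubini argument of `inner_volterra_add`; interval integrals
supply continuity in t and the value at time 0. -/
lemma primitive_eq_intervalIntegral (z : L2Time T X) (t : ℝ) :
    primitive z t = ∫ s in (0 : ℝ)..t, z s ∂volume.restrict (Ioo (0 : ℝ) T) := by
  have hi := integrable_time z
  rw [← intervalIntegral.integral_Iic_sub_Iic hi.integrableOn hi.integrableOn, primitive,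
    integral_Iic_eq_integral_Iio]
  have : (volume.restrict (Ioo (0 : ℝ) T)).restrict (Iic 0) = 0 := by
    rw [Measure.restrict_restrict measurableSet_Iic, Measure.restrict_eq_zero]
    convert measure_empty (μ := (volume : Measure ℝ))
    ext x
    simp only [mem_inter_iff, mem_Iic, mem_Ioo, mem_empty_iff_false, iff_false]
    intro h
    linarith [h.2.1, h.1]
  simp [this]

lemma continuous_primitive (z : L2Time T X) : Continuous (primitive z) := by
  have : primitive z = fun t => ∫ s in (0 : ℝ)..t, z s ∂volume.restrict (Ioo (0 : ℝ) T) :=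
    funext (primitive_eq_intervalIntegral z)
  rw [this]
  exact intervalIntegral.continuous_primitive
    (fun a b => (integrable_time z).intervalIntegrable) 0

@[simp]
lemma primitive_zero_time (z : L2Time T X) : primitive z 0 = 0 := by
  simp [primitive_eq_intervalIntegral]

lemma norm_primitive_le (z : L2Time T X) (t : ℝ) :
    ‖primitive z t‖ ≤ ((volume (Ioo (0 : ℝ) T)) ^ (1 / 2 : ℝ)).toReal * ‖z‖ :=
  ((norm_integral_le_integral_norm _).trans
    (setIntegral_le_integral (integrable_time z).norm (by filter_upwards with x; positivity))).trans
      (integral_norm_time_le z)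

lemma memLp_primitive (z : L2Time T X) :
    MemLp (primitive z) 2 (volume.restrict (Ioo (0 : ℝ) T)) :=
  MemLp.of_bound (continuous_primitive z).aestronglyMeasurable _
    (by filter_upwards with t using norm_primitive_le z t)

lemma primitive_add (z w : L2Time T X) : primitive (z + w) = primitive z + primitive w := by
  funext t
  rw [Pi.add_apply, primitive, primitive, primitive,
    ← integral_add (integrable_time z).integrableOn (integrable_time w).integrableOn]
  exact integral_congr_ae (ae_restrict_of_ae (Lp.coeFn_add z w))

lemma primitive_smul (c : ℝ) (z : L2Time T X) : primitive (c • z) = c • primitive z := by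
  funext t
  rw [Pi.smul_apply, primitive, primitive, ← integral_smul]
  exact integral_congr_ae (ae_restrict_of_ae (Lp.coeFn_smul c z))

/-- The Volterra operator `z ↦ ∫₀ᵗ z` on `L²(0,T; X)`. -/
def volterra : L2Time T X →L[ℝ] L2Time T X :=
  LinearMap.mkContinuous
    { toFun := fun z => (memLp_primitive z).toLp _
      map_add' := fun z w => by
        rw [← MemLp.toLp_add]
        exact MemLp.toLp_congr _ _ (by rw [primitive_add])
      map_smul' := fun c z => by
        rw [RingHom.id_apply, ← MemLp.toLp_const_smul]
        exact MemLp.toLp_congr _ _ (by rw [primitive_smul]) }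
    (((volume.restrict (Ioo (0 : ℝ) T)).real univ) ^ (ENNReal.toReal 2)⁻¹ *
      ((volume (Ioo (0 : ℝ) T)) ^ (1 / 2 : ℝ)).toReal)
    (fun z => by
      rw [mul_assoc]
      refine Lp.norm_le_of_ae_bound (by positivity) ?_
      filter_upwards [(memLp_primitive z).coeFn_toLp] with t ht
      exact ht ▸ norm_primitive_le z t)

lemma coeFn_volterra (z : L2Time T X) :
    volterra z =ᵐ[volume.restrict (Ioo (0 : ℝ) T)] primitive z :=
  (memLp_primitive z).coeFn_toLp

/-- The integral `∫₀ᵀ z` as a continuous linear map. -/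
def totalIntegral : L2Time T X →L[ℝ] X :=
  LinearMap.mkContinuous
    { toFun := fun z => ∫ t in Ioo 0 T, z t
      map_add' := fun z w => by
        rw [← integral_add (integrable_time z) (integrable_time w)]
        exact integral_congr_ae (Lp.coeFn_add z w)
      map_smul' := fun c z => by
        rw [RingHom.id_apply, ← integral_smul]
        exact integral_congr_ae (Lp.coeFn_smul c z) }
    ((volume (Ioo (0 : ℝ) T)) ^ (1 / 2 : ℝ)).toReal
    (fun z => (norm_integral_le_integral_norm _).trans (integral_norm_time_le z))

lemma totalIntegral_apply (z : L2Time T X) : totalIntegral z = ∫ t in Ioo 0 T, z t := rfl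

/-- Fubini: the two pairings are the integrals of ⟨ψ(s), χ(t)⟩ over the triangles s < t and t < s,
which fill the square up to its null diagonal. In operator form J + J* = P*P, the source of
positivity in both energy estimates. -/
lemma inner_volterra_add [CompleteSpace X] (ψ χ : L2Time T X) :
    inner ℝ (volterra ψ) χ + inner ℝ ψ (volterra χ)
      = inner ℝ (totalIntegral ψ) (totalIntegral χ) := by
  set μ : Measure ℝ := volume.restrict (Ioo (0 : ℝ) T) with hμ
  have hψ := integrable_time ψ
  have hχ := integrable_time χ
  have hint : Integrable (fun p : ℝ × ℝ => (inner ℝ (ψ p.2) (χ p.1) : ℝ)) (μ.prod μ) := by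
    have := hχ.op_fst_snd (op := fun a b => (inner ℝ b a : ℝ)) (by fun_prop)
      ⟨1, fun a b => by
        rw [one_mul, mul_comm]; exact norm_inner_le_norm b a⟩ hψ
    exact this
  have h1 : inner ℝ (volterra ψ) χ
      = ∫ p : ℝ × ℝ in {p | p.2 < p.1}, (inner ℝ (ψ p.2) (χ p.1) : ℝ) ∂(μ.prod μ) := by
    have hm : MeasurableSet {p : ℝ × ℝ | p.2 < p.1} :=
      measurableSet_lt measurable_snd measurable_fst
    rw [L2.inner_def, ← integral_indicator hm, integral_prod _ (hint.indicator hm)]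
    refine integral_congr_ae ?_
    filter_upwards [coeFn_volterra ψ] with t ht
    rw [ht, primitive, real_inner_comm, ← integral_inner hψ.integrableOn,
      ← integral_indicator measurableSet_Iio]
    refine integral_congr_ae (ae_of_all _ fun s => ?_)
    by_cases h : s < t <;> simp [indicator, h, real_inner_comm]
  have h2 : inner ℝ ψ (volterra χ)
      = ∫ p : ℝ × ℝ in {p | p.1 < p.2}, (inner ℝ (ψ p.2) (χ p.1) : ℝ) ∂(μ.prod μ) := by
    have hm : MeasurableSet {p : ℝ × ℝ | p.1 < p.2} :=
      measurableSet_lt measurable_fst measurable_snd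
    rw [L2.inner_def, ← integral_indicator hm, integral_prod_symm _ (hint.indicator hm)]
    refine integral_congr_ae ?_
    filter_upwards [coeFn_volterra χ] with t ht
    rw [ht, primitive, ← integral_inner hχ.integrableOn, ← integral_indicator measurableSet_Iio]
    refine integral_congr_ae (ae_of_all _ fun s => ?_)
    by_cases h : s < t <;> simp [indicator, h]
  have h3 : inner ℝ (totalIntegral ψ) (totalIntegral χ)
      = ∫ p : ℝ × ℝ, (inner ℝ (ψ p.2) (χ p.1) : ℝ) ∂(μ.prod μ) := by
    rw [integral_prod _ hint, totalIntegral_apply, totalIntegral_apply, ← integral_inner hχ]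
    refine integral_congr_ae (ae_of_all _ fun t => ?_)
    simp only
    rw [real_inner_comm, ← integral_inner hψ]
    exact integral_congr_ae (ae_of_all _ fun s => real_inner_comm _ _)
  have hd : (μ.prod μ) {p : ℝ × ℝ | p.1 = p.2} = 0 := by
    rw [Measure.measure_prod_null (measurableSet_eq_fun measurable_fst measurable_snd)]
    refine ae_of_all _ fun t => ?_
    have : Prod.mk t ⁻¹' {p : ℝ × ℝ | p.1 = p.2} = {t} := by ext s; simp [eq_comm]
    simp only [this]
    exact measure_singleton t
  have hm : MeasurableSet {p : ℝ × ℝ | p.1 < p.2} :=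
    measurableSet_lt measurable_fst measurable_snd
  rw [h1, h2, h3, ← setIntegral_union _ hm hint.integrableOn hint.integrableOn]
  · refine (setIntegral_congr_set ?_).trans setIntegral_univ
    refine (ae_eq_univ (μ := μ.prod μ)).2 (measure_mono_null (fun p hp => ?_) hd)
    simp only [mem_compl_iff, mem_union, mem_ofPred_eq, not_or, not_lt] at hp
    exact le_antisymm hp.1 hp.2
  · rw [Set.disjoint_left]
    intro p hp hq
    have h4 : p.2 < p.1 := hp
    exact lt_asymm h4 hq

variable {Y : Type*} [NormedAddCommGroup Y] [InnerProductSpace ℝ Y]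

/-- The action of a bounded operator on the values of a function of time. -/
abbrev pointwise (L : X →L[ℝ] Y) : L2Time T X →L[ℝ] L2Time T Y :=
  L.compLpL 2 (volume.restrict (Ioo (0 : ℝ) T))

lemma coeFn_pointwise (L : X →L[ℝ] Y) (z : L2Time T X) :
    ∀ᵐ t ∂volume.restrict (Ioo (0 : ℝ) T), pointwise L z t = L (z t) :=
  ContinuousLinearMap.coeFn_compLpL (p := 2) L z

lemma totalIntegral_pointwise [CompleteSpace X] [CompleteSpace Y] (L : X →L[ℝ] Y)
    (z : L2Time T X) : totalIntegral (pointwise L z) = L (totalIntegral z) := by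
  rw [totalIntegral_apply, totalIntegral_apply, ← L.integral_comp_comm (integrable_time z)]
  exact integral_congr_ae (coeFn_pointwise L z)

lemma primitive_pointwise [CompleteSpace X] [CompleteSpace Y] (L : X →L[ℝ] Y)
    (z : L2Time T X) (t : ℝ) : primitive (pointwise L z) t = L (primitive z t) := by
  rw [primitive, primitive, ← L.integral_comp_comm (integrable_time z).integrableOn]
  exact integral_congr_ae (ae_restrict_of_ae (coeFn_pointwise L z))

lemma volterra_pointwise [CompleteSpace X] [CompleteSpace Y] (L : X →L[ℝ] Y)
    (z : L2Time T X) : volterra (pointwise L z) = pointwise L (volterra z) := by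
  refine Lp.ext ?_
  filter_upwards [coeFn_volterra (pointwise L z), coeFn_volterra z,
    coeFn_pointwise L (volterra z)] with t h1 h2 h3
  rw [h1, h3, h2, primitive_pointwise]

lemma inner_pointwise_left (L : X →L[ℝ] Y) (z : L2Time T X) (w : L2Time T Y) :
    inner ℝ (pointwise L z) w = ∫ t in Ioo 0 T, inner ℝ (L (z t)) (w t) := by
  rw [L2.inner_def]
  refine integral_congr_ae ?_
  filter_upwards [coeFn_pointwise L z] with t ht
  rw [ht]

lemma inner_const_left [CompleteSpace X] (c : X) (z : L2Time T X) :
    inner ℝ (Lp.constL 2 (volume.restrict (Ioo (0 : ℝ) T)) ℝ c) z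
      = inner ℝ c (totalIntegral z) := by
  rw [L2.inner_def, totalIntegral_apply, ← integral_inner (integrable_time z)]
  refine integral_congr_ae ?_
  filter_upwards [Lp.coeFn_const 2 (volume.restrict (Ioo (0 : ℝ) T)) c] with t ht
  rw [Lp.constL_apply, ht]
  rfl

end Volterra

/-! ### Abstract evolution equations -/

section Abstract

variable {X : Type*} [NormedAddCommGroup X] [InnerProductSpace ℝ X] [CompleteSpace X] {T : ℝ}

/-- If `⟪g, ·⟫` is dominated by `‖K ·‖`, then `g` is in the range of the adjoint of `K`. -/
lemma exists_adjoint_apply_eq_of_inner_le {H : Type*} [NormedAddCommGroup H]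
    [InnerProductSpace ℝ H] [CompleteSpace H] (N : H →L[ℝ] H) (g : H) (C : ℝ)
    (h : ∀ ψ, inner ℝ g ψ ≤ C * ‖ContinuousLinearMap.adjoint N ψ‖) : ∃ z, N z = g := by
  set K := ContinuousLinearMap.adjoint N
  have habs : ∀ ψ, |inner ℝ g ψ| ≤ C * ‖K ψ‖ := fun ψ => by
    rw [abs_le]
    have := h (-ψ)
    rw [inner_neg_right, map_neg, norm_neg] at this
    exact ⟨by linarith, h ψ⟩
  -- The bound forces ⟨g, ·⟩ to vanish on the kernel of N*, so it descends to a functional on the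
  -- range of N*; its Riesz vector, after Hahn–Banach extension, is the solution.
  have hker : LinearMap.ker K.toLinearMap ≤ LinearMap.ker (innerSL ℝ g).toLinearMap := by
    intro ψ hψ
    have h0 : K ψ = 0 := hψ
    have := habs ψ
    rw [h0, norm_zero, mul_zero] at this
    exact abs_eq_zero.1 (le_antisymm this (abs_nonneg _))
  let e := K.toLinearMap.quotKerEquivRange
  let l : LinearMap.range K.toLinearMap →ₗ[ℝ] ℝ :=
    ((LinearMap.ker K.toLinearMap).liftQ (innerSL ℝ g).toLinearMap hker) ∘ₗ e.symm.toLinearMap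
  have hl : ∀ ψ, l ⟨K ψ, ψ, rfl⟩ = inner ℝ g ψ := fun ψ => by
    have : e.symm ⟨K ψ, ψ, rfl⟩ = Submodule.Quotient.mk ψ := by
      rw [LinearEquiv.symm_apply_eq]
      rfl
    simp only [l, LinearMap.comp_apply, LinearEquiv.coe_coe]
    rw [this]
    rfl
  let L : StrongDual ℝ (LinearMap.range K.toLinearMap) := l.mkContinuous C (by
    rintro ⟨_, ψ, rfl⟩
    exact (congrArg norm (hl ψ)).trans_le (habs ψ))
  obtain ⟨F, hF, -⟩ := exists_extension_norm_eq _ L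
  refine ⟨(InnerProductSpace.toDual ℝ H).symm F, ext_inner_right ℝ fun ψ => ?_⟩
  rw [← ContinuousLinearMap.adjoint_inner_right, InnerProductSpace.toDual_symm_apply]
  exact (hF ⟨K ψ, ψ, rfl⟩).trans (hl ψ)

variable {M B : X →L[ℝ] X}

lemma inner_pointwise_symm (hM : ∀ x y, inner ℝ (M x) y = inner ℝ x (M y)) (z w : L2Time T X) :
    inner ℝ (pointwise M z) w = inner ℝ z (pointwise M w) := by
  rw [real_inner_comm (pointwise M w) z, inner_pointwise_left, inner_pointwise_left]
  refine integral_congr_ae (ae_of_all _ fun t => ?_)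
  simp only
  rw [hM, real_inner_comm]

lemma le_inner_pointwise {c : ℝ} (hB : ∀ x, c * ‖x‖ ^ 2 ≤ inner ℝ (B x) x) (z : L2Time T X) :
    c * ‖z‖ ^ 2 ≤ inner ℝ (pointwise B z) z := by
  rw [← real_inner_self_eq_norm_sq, inner_pointwise_left, L2.inner_def, ← integral_const_mul]
  refine integral_mono_ae ((L2.integrable_inner z z).const_mul c) ?_ (ae_of_all _ fun t => ?_)
  · refine (L2.integrable_inner (𝕜 := ℝ) (pointwise B z) z).congr ?_
    filter_upwards [coeFn_pointwise B z] with t ht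
    rw [ht]
  · simp only [real_inner_self_eq_norm_sq]
    exact hB (z t)

/-- M is symmetric and commutes with J, so the two terms of `inner_volterra_add` coincide. This is
the integrated form of d/dt ⟨Mu, u⟩ = 2⟨Mu', u⟩ for the primitive u of ψ. -/
lemma two_mul_inner_pointwise_volterra (hM : ∀ x y, inner ℝ (M x) y = inner ℝ x (M y))
    (ψ : L2Time T X) :
    2 * inner ℝ (pointwise M ψ) (volterra ψ)
      = inner ℝ (M (totalIntegral ψ)) (totalIntegral ψ) := by
  have h := inner_volterra_add (pointwise M ψ) ψ
  rw [totalIntegral_pointwise, volterra_pointwise, inner_pointwise_symm hM (volterra ψ) ψ,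
    real_inner_comm] at h
  linarith

/-- Well-posedness of `M u' + B u = g₀ + ∫₀ᵗ g`, `u(0) = 0`, in the strong form `u' ∈ L²(0,T; X)`:
existence. -/
theorem exists_pointwise_add_volterra_eq (hM : ∀ x y, inner ℝ (M x) y = inner ℝ x (M y))
    (hM0 : ∀ x, 0 ≤ inner ℝ (M x) x) {c : ℝ} (hc : 0 < c)
    (hB : ∀ x, c * ‖x‖ ^ 2 ≤ inner ℝ (B x) x) {g₀ : X} {C : ℝ} (hC : 0 ≤ C)
    (hg₀ : ∀ x, inner ℝ g₀ x ≤ C * √(inner ℝ (M x) x)) (g : L2Time T X) :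
    ∃ y : L2Time T X, pointwise M y + pointwise B (volterra y)
      = Lp.constL 2 (volume.restrict (Ioo (0 : ℝ) T)) ℝ g₀ + volterra g := by
  let N : L2Time T X →L[ℝ] L2Time T X := pointwise M + pointwise B ∘L volterra
  -- With k = ‖N*ψ‖, the estimates below give √q ≤ √(2/c) k and ‖φ‖ ≤ k/c; the two summands of the
  -- constant come from ⟨g₀, ∫ψ⟩ and ⟨g, φ⟩.
  refine exists_adjoint_apply_eq_of_inner_le N _ (C * √(2 / c) + ‖g‖ / c) fun ψ => ?_
  set φ := ContinuousLinearMap.adjoint (volterra (X := X) (T := T)) ψ with hφ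
  set k := ‖ContinuousLinearMap.adjoint N ψ‖
  set q := inner ℝ (M (totalIntegral ψ)) (totalIntegral ψ) with hq
  have hq0 : 0 ≤ q := hM0 _
  -- The choice φ = J*ψ makes both parts of N nonnegative: M contributes half the M-energy of ∫ψ,
  -- and since B commutes with J the other part becomes ⟨Bφ, φ⟩.
  have h1 : inner ℝ (ContinuousLinearMap.adjoint N ψ) φ
      = q / 2 + inner ℝ (pointwise B φ) φ := by
    rw [ContinuousLinearMap.adjoint_inner_left]
    have e1 : N φ = pointwise M φ + volterra (pointwise B φ) := by
      rw [volterra_pointwise]; rfl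
    have e2 : inner ℝ ψ (pointwise M φ) = q / 2 := by
      rw [← inner_pointwise_symm hM, hφ, ContinuousLinearMap.adjoint_inner_right,
        volterra_pointwise, inner_pointwise_symm hM, real_inner_comm, hq,
        ← two_mul_inner_pointwise_volterra hM]
      ring
    have e3 : inner ℝ ψ (volterra (pointwise B φ)) = inner ℝ (pointwise B φ) φ := by
      rw [real_inner_comm, hφ, ← ContinuousLinearMap.adjoint_inner_right]
    rw [e1, inner_add_right, e2, e3]
  have h2 := le_inner_pointwise hB φ
  have h3 := real_inner_le_norm (ContinuousLinearMap.adjoint N ψ) φ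
  have h4 : q / 2 + c * ‖φ‖ ^ 2 ≤ k * ‖φ‖ := by linarith
  have hk : 0 ≤ k := norm_nonneg _
  have hp : ‖φ‖ ≤ k / c := by
    rw [le_div_iff₀ hc]
    rcases (norm_nonneg φ).eq_or_lt with h | h
    · rw [← h]; simpa using hk
    · nlinarith
  have hq2 : √q ≤ √(2 / c) * k := by
    rw [← Real.sqrt_sq hk, ← Real.sqrt_mul (by positivity)]
    refine Real.sqrt_le_sqrt ?_
    have : q ≤ 2 * (k * (k / c)) := by
      have := mul_le_mul_of_nonneg_left hp hk
      nlinarith [mul_nonneg hc.le (sq_nonneg ‖φ‖)]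
    calc q ≤ 2 * (k * (k / c)) := this
      _ = 2 / c * k ^ 2 := by ring
  rw [inner_add_left, inner_const_left, ← ContinuousLinearMap.adjoint_inner_right, ← hφ]
  calc inner ℝ g₀ (totalIntegral ψ) + inner ℝ g φ
      ≤ C * √q + ‖g‖ * ‖φ‖ := add_le_add (hg₀ _) (real_inner_le_norm _ _)
    _ ≤ C * (√(2 / c) * k) + ‖g‖ * (k / c) := by gcongr
    _ = _ := by ring

/-- Well-posedness of `M u' + B u = g`, `u(0) = 0`: uniqueness. -/
theorem volterra_eq_of_pointwise_add_volterra_eq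
    (hM : ∀ x y, inner ℝ (M x) y = inner ℝ x (M y))
    (hM0 : ∀ x, 0 ≤ inner ℝ (M x) x) {c : ℝ} (hc : 0 < c)
    (hB : ∀ x, c * ‖x‖ ^ 2 ≤ inner ℝ (B x) x) {y₁ y₂ : L2Time T X}
    (h : pointwise M y₁ + pointwise B (volterra y₁)
      = pointwise M y₂ + pointwise B (volterra y₂)) : volterra y₁ = volterra y₂ := by
  set y := y₁ - y₂ with hy
  have h0 : pointwise M y + pointwise B (volterra y) = 0 := by
    rw [hy, map_sub, map_sub, map_sub]
    rw [← sub_eq_zero] at h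
    rw [← h]
    abel
  -- The equation for the difference is paired with its primitive. M may be degenerate, so only the
  -- coercive term in `volterra y` is used.
  have h1 := two_mul_inner_pointwise_volterra hM y
  have h2 := le_inner_pointwise hB (volterra y)
  have h3 := hM0 (totalIntegral y)
  have h4 : inner ℝ (pointwise M y) (volterra y)
      + inner ℝ (pointwise B (volterra y)) (volterra y) = 0 := by
    rw [← inner_add_left, h0, inner_zero_left]
  have h5 : c * ‖volterra y‖ ^ 2 ≤ 0 := by linarith
  have h6 : ‖volterra y‖ = 0 := by
    have := nonpos_of_mul_nonpos_right h5 hc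
    nlinarith [norm_nonneg (volterra y)]
  rw [norm_eq_zero, hy, map_sub, sub_eq_zero] at h6
  exact h6

end Abstract

/-! ### Weak time derivatives -/

section WeakTime

variable {X : Type*} [NormedAddCommGroup X] [InnerProductSpace ℝ X] [CompleteSpace X] {T : ℝ}

/-- The constant functions of time. -/
abbrev constTime (T : ℝ) (c : X) : L2Time T X := Lp.constL 2 (volume.restrict (Ioo (0 : ℝ) T)) ℝ c

lemma coeFn_constTime (c : X) : ∀ᵐ t ∂volume.restrict (Ioo 0 T), constTime T c t = c :=
  Lp.coeFn_const 2 (volume.restrict (Ioo (0 : ℝ) T)) c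

lemma integrable_smul_time {φ : ℝ → ℝ} (hφ : Continuous φ) (hc : HasCompactSupport φ)
    (z : L2Time T X) : Integrable (fun t => φ t • z t) (volume.restrict (Ioo 0 T)) := by
  obtain ⟨C, hC⟩ := hc.exists_bound_of_continuous hφ
  exact (integrable_time z).bdd_smul C hφ.aestronglyMeasurable (ae_of_all _ hC)

lemma memLp_smul_const {φ : ℝ → ℝ} (hφ : Continuous φ) (hc : HasCompactSupport φ) (x : X) :
    MemLp (fun t => φ t • x) 2 (volume.restrict (Ioo 0 T)) :=
  (hφ.smul continuous_const).memLp_of_hasCompactSupport hc.smul_right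

lemma inner_smul_const_left {φ : ℝ → ℝ} (hφ : Continuous φ) (hc : HasCompactSupport φ) (x : X)
    (z : L2Time T X) :
    inner ℝ ((memLp_smul_const hφ hc x).toLp _) z = inner ℝ x (∫ t in Ioo 0 T, φ t • z t) := by
  rw [← integral_inner (integrable_smul_time hφ hc z), L2.inner_def]
  refine integral_congr_ae ?_
  filter_upwards [(memLp_smul_const (T := T) hφ hc x).coeFn_toLp] with t ht
  rw [ht, inner_smul_left, inner_smul_right]
  rfl

lemma integral_deriv_Iio {φ : ℝ → ℝ} (hφ : ContDiff ℝ ∞ φ)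
    (hs : tsupport φ ⊆ Ioo 0 T) {t : ℝ} (ht : t ∈ Ioo 0 T) :
    ∫ s in Iio t, deriv φ s ∂volume.restrict (Ioo (0 : ℝ) T) = φ t := by
  have h0 : φ 0 = 0 := image_eq_zero_of_notMem_tsupport fun h => lt_irrefl _ (hs h).1
  have h1 : ∫ s in (0 : ℝ)..t, deriv φ s = φ t - φ 0 :=
    intervalIntegral.integral_deriv_eq_sub (fun x _ => (hφ.differentiable (by simp)).differentiableAt)
      ((hφ.continuous_deriv (by simp)).intervalIntegrable _ _)
  rw [h0, sub_zero, intervalIntegral.integral_of_le ht.1.le, integral_Ioc_eq_integral_Ioo] at h1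
  rw [← h1, Measure.restrict_restrict measurableSet_Iio]
  congr 2
  ext s
  simp only [mem_inter_iff, mem_Iio, mem_Ioo]
  constructor
  · rintro ⟨h2, h3, -⟩; exact ⟨h3, h2⟩
  · rintro ⟨h2, h3⟩; exact ⟨h3, h2, h3.trans ht.2⟩

lemma integral_deriv_time {φ : ℝ → ℝ} (hT : 0 < T) (hφ : ContDiff ℝ ∞ φ)
    (hs : tsupport φ ⊆ Ioo 0 T) : ∫ s in Ioo 0 T, deriv φ s = 0 := by
  have h0 : φ 0 = 0 := image_eq_zero_of_notMem_tsupport fun h => lt_irrefl _ (hs h).1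
  have h2 : φ T = 0 := image_eq_zero_of_notMem_tsupport fun h => lt_irrefl _ (hs h).2
  have h1 : ∫ s in (0 : ℝ)..T, deriv φ s = φ T - φ 0 :=
    intervalIntegral.integral_deriv_eq_sub (fun x _ => (hφ.differentiable (by simp)).differentiableAt)
      ((hφ.continuous_deriv (by simp)).intervalIntegrable _ _)
  rwa [h0, h2, sub_zero, intervalIntegral.integral_of_le hT.le, integral_Ioc_eq_integral_Ioo] at h1

/-- `inner_volterra_add` is itself an integration by parts. For a test function φ and a vector x, θ
= φ' x has primitive φ x and total integral 0, so ⟨φ x, z⟩ + ⟨φ' x, J z⟩ = 0. -/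
lemma hasWeakTimeDeriv_volterra (hT : 0 < T) (z : L2Time T X) :
    HasWeakTimeDeriv (volterra z) z := by
  intro φ hφ hc hs
  have hφ' := hφ.continuous_deriv (by simp)
  have hc' := hc.deriv
  refine ext_inner_left ℝ fun x => ?_
  set θ := (memLp_smul_const (T := T) hφ' hc' x).toLp _ with hθ
  have hθt := (memLp_smul_const (T := T) hφ' hc' x).coeFn_toLp
  have hJ : volterra θ = (memLp_smul_const (T := T) hφ.continuous hc x).toLp _ := by
    refine Lp.ext ?_
    filter_upwards [coeFn_volterra θ, (memLp_smul_const (T := T) hφ.continuous hc x).coeFn_toLp,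
      ae_restrict_mem measurableSet_Ioo] with t h1 h2 h3
    rw [h1, h2, primitive, ← integral_deriv_Iio hφ hs h3, ← integral_smul_const]
    exact integral_congr_ae (ae_restrict_of_ae hθt)
  have hP : totalIntegral θ = 0 := by
    rw [totalIntegral_apply, integral_congr_ae hθt, integral_smul_const,
      integral_deriv_time hT hφ hs, zero_smul]
  have h := inner_volterra_add θ z
  rw [hP, inner_zero_left, hJ, inner_smul_const_left hφ.continuous hc, hθ,
    inner_smul_const_left hφ' hc'] at h
  rw [inner_neg_right]
  linarith

lemma hasWeakTimeDeriv_constTime (hT : 0 < T) (c : X) :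
    HasWeakTimeDeriv (constTime T c) 0 := by
  intro φ hφ hc hs
  have h1 : ∫ t in Ioo 0 T, deriv φ t • constTime T c t = ∫ t in Ioo 0 T, deriv φ t • c := by
    refine integral_congr_ae ?_
    filter_upwards [coeFn_constTime (T := T) c] with t ht
    rw [ht]
  have h2 : ∫ t in Ioo 0 T, φ t • (0 : L2Time T X) t = ∫ t in Ioo 0 T, (0 : X) := by
    refine integral_congr_ae ?_
    filter_upwards [Lp.coeFn_zero X 2 (volume.restrict (Ioo 0 T))] with t ht
    rw [ht]
    simp
  rw [h1, h2, integral_smul_const, integral_deriv_time hT hφ hs]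
  simp

lemma HasWeakTimeDeriv.add {u u' w w' : L2Time T X} (h : HasWeakTimeDeriv u u')
    (h' : HasWeakTimeDeriv w w') : HasWeakTimeDeriv (u + w) (u' + w') := by
  intro φ hφ hc hs
  have key : ∀ {θ : ℝ → ℝ}, Continuous θ → HasCompactSupport θ → ∀ z y : L2Time T X,
      ∫ t in Ioo 0 T, θ t • (z + y) t
        = (∫ t in Ioo 0 T, θ t • z t) + ∫ t in Ioo 0 T, θ t • y t := by
    intro θ h1 h2 z y
    rw [← integral_add (integrable_smul_time h1 h2 z) (integrable_smul_time h1 h2 y)]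
    refine integral_congr_ae ?_
    filter_upwards [Lp.coeFn_add z y] with t ht
    rw [ht, Pi.add_apply, smul_add]
  rw [key (hφ.continuous_deriv (by simp)) hc.deriv, key hφ.continuous hc, h φ hφ hc hs,
    h' φ hφ hc hs, neg_add]

end WeakTime

/-! ### The du Bois-Reymond lemma, initial values and exponential weights. -/

section DuBoisReymond

variable {X : Type*} [NormedAddCommGroup X] [InnerProductSpace ℝ X] [CompleteSpace X] {T : ℝ}

/-- A smooth function with compact support in `(0,T)` and vanishing integral is the derivative of
a function of the same kind. -/
lemma exists_deriv_eq_of_integral_eq_zero {g : ℝ → ℝ} (hg : ContDiff ℝ ∞ g)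
    (hc : HasCompactSupport g) (hs : tsupport g ⊆ Ioo 0 T) (h0 : ∫ t in Ioo 0 T, g t = 0) :
    ∃ φ : ℝ → ℝ, ContDiff ℝ ∞ φ ∧ HasCompactSupport φ ∧ tsupport φ ⊆ Ioo 0 T ∧ deriv φ = g := by
  by_cases hne : (tsupport g).Nonempty
  swap
  · have hg0 : g = 0 := by
      rw [← tsupport_eq_empty_iff]
      exact not_nonempty_iff_eq_empty.1 hne
    refine ⟨0, contDiff_const, HasCompactSupport.zero, ?_, ?_⟩
    · rw [tsupport_eq_empty_iff.2 rfl]; exact empty_subset _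
    · rw [hg0]; funext x; simp
  obtain ⟨a, ha⟩ := hc.exists_isLeast hne
  obtain ⟨b, hb⟩ := hc.exists_isGreatest hne
  have haT := hs ha.1
  have hbT := hs hb.1
  have hga : ∀ t, t < a → g t = 0 := fun t ht =>
    image_eq_zero_of_notMem_tsupport fun h => absurd (ha.2 h) (not_le.2 ht)
  have hgb : ∀ t, b < t → g t = 0 := fun t ht =>
    image_eq_zero_of_notMem_tsupport fun h => absurd (hb.2 h) (not_le.2 ht)
  have hii : ∀ x y, IntervalIntegrable g volume x y := fun x y =>
    hg.continuous.intervalIntegrable x y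
  let φ : ℝ → ℝ := fun t => ∫ s in (0 : ℝ)..t, g s
  have hder : ∀ t, HasDerivAt φ (g t) t := fun t =>
    intervalIntegral.integral_hasDerivAt_right (hii _ _)
      (hg.continuous.stronglyMeasurableAtFilter _ _) hg.continuous.continuousAt
  have hd : deriv φ = g := funext fun t => (hder t).deriv
  have hsub : Function.support φ ⊆ Icc a b := by
    intro t ht
    by_contra hn
    apply ht
    rw [mem_Icc, not_and_or, not_le, not_le] at hn
    rcases hn with h | h
    · refine intervalIntegral.integral_zero_ae (ae_of_all _ fun s hs' => hga s ?_)
      exact lt_of_le_of_lt hs'.2 (max_lt haT.1 h)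
    -- To the right of the support the primitive has already reached the full integral, which is
    -- zero.
    · have h1 : ∫ s in (0 : ℝ)..T, g s = 0 := by
        rw [intervalIntegral.integral_of_le (haT.1.trans haT.2).le,
          integral_Ioc_eq_integral_Ioo, h0]
      have h2 : ∫ s in t..T, g s = 0 := by
        refine intervalIntegral.integral_zero_ae (ae_of_all _ fun s hs' => hgb s ?_)
        exact lt_of_lt_of_le (lt_min h hbT.2) hs'.1.le
      have h3 := intervalIntegral.integral_add_adjacent_intervals (hii 0 t) (hii t T)
      rw [h1, h2, add_zero] at h3
      exact h3
  have hts : tsupport φ ⊆ Icc a b := closure_minimal hsub isClosed_Icc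
  refine ⟨φ, ?_, isCompact_Icc.of_isClosed_subset (isClosed_tsupport φ) hts,
    fun t ht => ⟨haT.1.trans_le (hts ht).1, (hts ht).2.trans_lt hbT.2⟩, hd⟩
  rw [contDiff_infty_iff_deriv, hd]
  exact ⟨fun t => (hder t).differentiableAt, hg⟩

/-- A function of time with vanishing weak derivative is constant. -/
lemma HasWeakTimeDeriv.exists_eq_const (hT : 0 < T) {u : L2Time T X}
    (hu : ∀ φ : ℝ → ℝ, ContDiff ℝ ∞ φ → HasCompactSupport φ → tsupport φ ⊆ Ioo 0 T →
      ∫ t in Ioo 0 T, deriv φ t • u t = 0) : ∃ c, u = constTime T c := by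
  -- A fixed bump of integral one; the constant sought is the average of u against it.
  let b : ContDiffBump (T / 2) := ⟨T / 8, T / 4, by positivity, by linarith⟩
  let ρ : ℝ → ℝ := b.normed volume
  have hρs : tsupport ρ ⊆ Ioo 0 T := by
    rw [b.tsupport_normed_eq]
    intro t ht
    rw [Metric.mem_closedBall, Real.dist_eq, abs_le] at ht
    have : b.rOut = T / 4 := rfl
    constructor <;> linarith [ht.1, ht.2]
  have hρc : HasCompactSupport ρ := b.hasCompactSupport_normed
  have hρd : ContDiff ℝ ∞ ρ := b.contDiff_normed
  have hρi : ∫ t in Ioo 0 T, ρ t = 1 := by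
    rw [setIntegral_eq_integral_of_forall_compl_eq_zero, b.integral_normed]
    intro t ht
    exact image_eq_zero_of_notMem_tsupport fun h => ht (hρs h)
  set c := ∫ t in Ioo 0 T, ρ t • u t with hcdef
  refine ⟨c, Lp.ext ?_⟩
  have hint : IntegrableOn (fun t => u t - c) (Ioo 0 T) volume :=
    (integrable_time u).sub (integrable_const c)
  have hzero : ∀ᵐ t, t ∈ Ioo 0 T → u t - c = 0 := by
    refine isOpen_Ioo.ae_eq_zero_of_integral_contDiff_smul_eq_zero hint.locallyIntegrableOn ?_
    intro g hg hgc hgs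
    set m := ∫ t in Ioo 0 T, g t with hm
    have hgi : Integrable g (volume.restrict (Ioo 0 T)) :=
      (hg.continuous.integrable_of_hasCompactSupport hgc).integrableOn
    have hρi' : Integrable ρ (volume.restrict (Ioo 0 T)) :=
      (hρd.continuous.integrable_of_hasCompactSupport hρc).integrableOn
    -- Subtracting a multiple of ρ removes the mean of g, so θ is the derivative of a test function
    -- and ∫ θ u = 0. This says ∫ g u = m c = ∫ g c.
    let θ : ℝ → ℝ := fun t => g t - m * ρ t
    have hθd : ContDiff ℝ ∞ θ := hg.sub (contDiff_const.mul hρd)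
    have hsub : Function.support θ ⊆ tsupport g ∪ tsupport ρ := by
      intro t ht
      by_contra hn
      rw [mem_union, not_or] at hn
      apply ht
      simp only [θ, image_eq_zero_of_notMem_tsupport hn.1, image_eq_zero_of_notMem_tsupport hn.2,
        mul_zero, sub_zero]
    have hsub' : tsupport θ ⊆ tsupport g ∪ tsupport ρ :=
      closure_minimal hsub ((isClosed_tsupport g).union (isClosed_tsupport ρ))
    have hθ0 : ∫ t in Ioo 0 T, θ t = 0 := by
      rw [integral_sub hgi (hρi'.const_mul m), integral_const_mul, hρi, ← hm]
      ring
    obtain ⟨φ, h1, h2, h3, h4⟩ := exists_deriv_eq_of_integral_eq_zero hθd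
      ((hgc.union hρc).of_isClosed_subset (isClosed_tsupport θ) hsub')
      (hsub'.trans (union_subset hgs hρs)) hθ0
    have h5 := hu φ h1 h2 h3
    rw [h4] at h5
    have hgu := integrable_smul_time hg.continuous hgc u
    have hρu := integrable_smul_time hρd.continuous hρc u
    have h6 : ∫ t in Ioo 0 T, θ t • u t = (∫ t in Ioo 0 T, g t • u t) - m • c := by
      rw [hcdef, ← integral_smul, ← integral_sub hgu (hρu.fun_smul m)]
      refine integral_congr_ae (ae_of_all _ fun t => ?_)
      simp only [θ, sub_smul, mul_smul]
    have h7 : ∫ t, g t • (u t - c) = ∫ t in Ioo 0 T, g t • (u t - c) := by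
      rw [setIntegral_eq_integral_of_forall_compl_eq_zero]
      intro t ht
      rw [image_eq_zero_of_notMem_tsupport fun h => ht (hgs h), zero_smul]
    rw [h7]
    simp only [smul_sub]
    rw [integral_sub hgu (hgi.smul_const c), integral_smul_const, ← hm, ← h6, h5]
  rw [← ae_restrict_iff' measurableSet_Ioo] at hzero
  filter_upwards [hzero, coeFn_constTime (T := T) c] with t h1 h2
  rw [h2, sub_eq_zero.1 h1]

/-- The difference u - J u' has vanishing weak derivative, hence is constant. -/
lemma HasWeakTimeDeriv.exists_eq_const_add_volterra (hT : 0 < T) {u u' : L2Time T X}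
    (h : HasWeakTimeDeriv u u') : ∃ c, u = constTime T c + volterra u' := by
  obtain ⟨c, hc⟩ := HasWeakTimeDeriv.exists_eq_const hT (u := u - volterra u') (by
    intro φ hφ hc hs
    have h1 := h φ hφ hc hs
    have h2 := hasWeakTimeDeriv_volterra hT u' φ hφ hc hs
    have hφ' := hφ.continuous_deriv (by simp)
    have h3 : ∫ t in Ioo 0 T, deriv φ t • (u - volterra u') t
        = (∫ t in Ioo 0 T, deriv φ t • u t) - ∫ t in Ioo 0 T, deriv φ t • volterra u' t := by
      rw [← integral_sub (integrable_smul_time hφ' hc.deriv u)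
        (integrable_smul_time hφ' hc.deriv (volterra u'))]
      refine integral_congr_ae ?_
      filter_upwards [Lp.coeFn_sub u (volterra u')] with t ht
      rw [ht, Pi.sub_apply, smul_sub]
    rw [h3, h1, h2, sub_self])
  exact ⟨c, sub_eq_iff_eq_add.1 hc⟩

lemma hasInitialValue_const_add_volterra (c : X) (z : L2Time T X) :
    HasInitialValue (constTime T c + volterra z) c := by
  refine ⟨fun t => c + primitive z t,
    (continuous_const.add (continuous_primitive z)).continuousOn, ?_, by simp⟩
  filter_upwards [Lp.coeFn_add (constTime T c) (volterra z), coeFn_constTime (T := T) c,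
    coeFn_volterra z] with t h1 h2 h3
  rw [h1, Pi.add_apply, h2, h3]

/-- Two initial values of the same function agree. -/
lemma HasInitialValue.unique (hT : 0 < T) {u : L2Time T X} {a b : X} (ha : HasInitialValue u a)
    (hb : HasInitialValue u b) : a = b := by
  obtain ⟨c, hc, huc, rfl⟩ := ha
  obtain ⟨d, hd, hud, rfl⟩ := hb
  refine Measure.eqOn_Icc_of_ae_eq volume hT.ne ?_ hc hd (left_mem_Icc.2 hT.le)
  rw [restrict_Ioo_eq_restrict_Icc.symm]
  filter_upwards [huc, hud] with t h1 h2
  rw [← h1, h2]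

/-- A function of time has weak derivative `u'` and initial value `u₀` if and only if it is
`u₀ + ∫₀ᵗ u'`. -/
theorem hasWeakTimeDeriv_and_hasInitialValue_iff (hT : 0 < T) {u u' : L2Time T X} {u₀ : X} :
    HasWeakTimeDeriv u u' ∧ HasInitialValue u u₀ ↔ u = constTime T u₀ + volterra u' := by
  constructor
  · rintro ⟨h1, h2⟩
    obtain ⟨c, rfl⟩ := h1.exists_eq_const_add_volterra hT
    rw [(hasInitialValue_const_add_volterra c u').unique hT h2]
  · rintro rfl
    refine ⟨?_, hasInitialValue_const_add_volterra u₀ u'⟩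
    simpa using (hasWeakTimeDeriv_constTime hT u₀).add (hasWeakTimeDeriv_volterra hT u')

lemma memLp_exp_smul (c : ℝ) (z : L2Time T X) :
    MemLp (fun t => Real.exp (c * t) • z t) 2 (volume.restrict (Ioo 0 T)) := by
  have hcont : Continuous fun t => Real.exp (c * t) := by fun_prop
  obtain ⟨C, hC⟩ := (isCompact_Icc (a := (0 : ℝ)) (b := T)).exists_bound_of_continuousOn
    hcont.continuousOn
  refine MemLp.of_le_mul (c := C) (Lp.memLp z)
    (hcont.aestronglyMeasurable.smul (Lp.aestronglyMeasurable z)) ?_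
  filter_upwards [ae_restrict_mem measurableSet_Ioo] with t ht
  rw [norm_smul]
  exact mul_le_mul_of_nonneg_right (hC t (Ioo_subset_Icc_self ht)) (norm_nonneg _)

/-- Multiplication of a function of time by `exp (c t)`. -/
def expMul (c : ℝ) (z : L2Time T X) : L2Time T X := (memLp_exp_smul c z).toLp _

lemma coeFn_expMul (c : ℝ) (z : L2Time T X) :
    ∀ᵐ t ∂volume.restrict (Ioo 0 T), expMul c z t = Real.exp (c * t) • z t :=
  (memLp_exp_smul c z).coeFn_toLp

/-- This product rule justifies the substitution u = exp(-t) v, which adds M to A. The weight is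
moved onto the test function. -/
lemma HasWeakTimeDeriv.expMul (c : ℝ) {u u' : L2Time T X} (h : HasWeakTimeDeriv u u') :
    HasWeakTimeDeriv (expMul c u) (expMul c (u' + c • u)) := by
  intro φ hφ hc hs
  let θ : ℝ → ℝ := fun t => φ t * Real.exp (c * t)
  have hexp : ContDiff ℝ ∞ fun t : ℝ => Real.exp (c * t) :=
    Real.contDiff_exp.comp (contDiff_const.mul contDiff_id)
  have hθ : ContDiff ℝ ∞ θ := hφ.mul hexp
  have hθc : HasCompactSupport θ := hc.mul_right
  have hθs : tsupport θ ⊆ Ioo 0 T := (tsupport_mul_subset_left).trans hs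
  have hθ' : ∀ t, deriv θ t = deriv φ t * Real.exp (c * t) + c * θ t := fun t => by
    have h1 : HasDerivAt φ (deriv φ t) t :=
      ((hφ.differentiable (by simp)).differentiableAt).hasDerivAt
    have h2 : HasDerivAt (fun t : ℝ => Real.exp (c * t)) (Real.exp (c * t) * (c * 1)) t :=
      ((hasDerivAt_id t).const_mul c).exp
    rw [(h1.fun_mul h2).deriv]
    simp only [θ]
    ring
  have key := h θ hθ hθc hθs
  have i1 := integrable_smul_time hθ.continuous hθc u
  have i2 := integrable_smul_time hθ.continuous hθc u'
  have i3 := integrable_smul_time (hθ.continuous_deriv (by simp)) hθc.deriv u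
  have e1 : ∫ t in Ioo 0 T, deriv φ t • OpenStokes.expMul c u t
      = (∫ t in Ioo 0 T, deriv θ t • u t) - c • ∫ t in Ioo 0 T, θ t • u t := by
    rw [← integral_smul, ← integral_sub i3 (i1.fun_smul c)]
    refine integral_congr_ae ?_
    filter_upwards [coeFn_expMul c u] with t ht
    rw [ht, hθ', smul_smul, smul_smul, ← sub_smul]
    ring_nf
  have e2 : ∫ t in Ioo 0 T, φ t • OpenStokes.expMul c (u' + c • u) t
      = (∫ t in Ioo 0 T, θ t • u' t) + c • ∫ t in Ioo 0 T, θ t • u t := by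
    rw [← integral_smul, ← integral_add i2 (i1.fun_smul c)]
    refine integral_congr_ae ?_
    filter_upwards [coeFn_expMul c (u' + c • u), Lp.coeFn_add u' (c • u),
      Lp.coeFn_smul c u] with t h1 h2 h3
    rw [h1, h2, Pi.add_apply, h3, Pi.smul_apply, smul_add, smul_add, smul_smul,
      smul_smul, smul_smul, smul_smul]
    congr 2
    simp only [θ]
    ring
  rw [e1, e2, key]
  abel

lemma HasInitialValue.expMul (c : ℝ) {u : L2Time T X} {u₀ : X} (h : HasInitialValue u u₀) :
    HasInitialValue (expMul c u) u₀ := by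
  obtain ⟨d, hd, hu, rfl⟩ := h
  refine ⟨fun t => Real.exp (c * t) • d t, ?_, ?_, by simp⟩
  · exact ContinuousOn.smul (by fun_prop) hd
  · filter_upwards [hu, coeFn_expMul c u] with t h1 h2
    rw [h2, h1]

lemma expMul_injective (c : ℝ) : Function.Injective (expMul (T := T) (X := X) c) := by
  intro u w h
  refine Lp.ext ?_
  filter_upwards [coeFn_expMul c u, coeFn_expMul c w] with t h1 h2
  rw [h, h2] at h1
  exact (smul_right_injective X (Real.exp_pos (c * t)).ne' h1).symm

end DuBoisReymond

/-! ### Lipschitz graphs -/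

section Charts

/-- The plane in which the boundary charts live. -/
abbrev E2 : Type := EuclideanSpace ℝ (Fin 2)

variable (A : E3 ≃ₗᵢ[ℝ] E3)

/-- The parametrisation of the graph of `h` in the coordinates given by `A`. -/
def graphMap (h : E2 → ℝ) (y : E2) : E3 := A.symm !₂[y 0, y 1, h y]

/-- The projection along the third coordinate axis. -/
def baseProj (y : E3) : E2 := !₂[A y 0, A y 1]

/-- The unit vector in the direction of the third coordinate. -/
def vertical : E3 := A.symm (EuclideanSpace.single 2 1)

@[simp] lemma norm_vertical : ‖vertical A‖ = 1 := by simp [vertical]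

@[simp] lemma apply_two_vertical : A (vertical A) 2 = 1 := by simp [vertical]

@[simp] lemma baseProj_graphMap (h : E2 → ℝ) (y : E2) : baseProj A (graphMap A h y) = y := by
  ext i; fin_cases i <;> simp [baseProj, graphMap]

@[simp] lemma apply_two_graphMap (h : E2 → ℝ) (y : E2) : A (graphMap A h y) 2 = h y := by
  simp [graphMap]

lemma apply_two_add_smul_vertical (y : E3) (s : ℝ) :
    A (y + s • vertical A) 2 = A y 2 + s := by
  simp [vertical]

@[simp] lemma baseProj_add_smul_vertical (y : E3) (s : ℝ) :
    baseProj A (y + s • vertical A) = baseProj A y := by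
  ext i; fin_cases i <;> simp [baseProj, vertical]

lemma graphMap_baseProj_add (h : E2 → ℝ) (y : E3) :
    graphMap A h (baseProj A y) + (A y 2 - h (baseProj A y)) • vertical A = y := by
  apply A.injective
  ext i; fin_cases i <;> simp [graphMap, baseProj, vertical]

lemma dist_baseProj_le (y z : E3) : dist (baseProj A y) (baseProj A z) ≤ dist y z := by
  rw [← A.dist_map y z, EuclideanSpace.dist_eq, EuclideanSpace.dist_eq]
  refine Real.sqrt_le_sqrt ?_
  rw [Fin.sum_univ_two, Fin.sum_univ_three]
  simp only [baseProj]
  simp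

lemma lipschitzWith_baseProj : LipschitzWith 1 (baseProj A) :=
  LipschitzWith.of_dist_le_mul fun y z => by simpa using dist_baseProj_le A y z

lemma abs_apply_two_sub_le (y z : E3) : |A y 2 - A z 2| ≤ dist y z := by
  rw [← A.dist_map y z, ← Real.dist_eq]
  refine (dist_le_pi_dist (A y).ofLp (A z).ofLp 2).trans ?_
  simpa using (PiLp.lipschitzWith_ofLp 2 (fun _ : Fin 3 => ℝ)).dist_le_mul (A y) (A z)

variable {A} {L : NNReal} {h : E2 → ℝ}

lemma lipschitzWith_graphMap (hh : LipschitzWith L h) : LipschitzWith (1 + L) (graphMap A h) := by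
  refine LipschitzWith.of_dist_le_mul fun y z => ?_
  rw [graphMap, graphMap, A.symm.dist_map, EuclideanSpace.dist_eq, Fin.sum_univ_three]
  refine Real.sqrt_le_iff.2 ⟨by positivity, ?_⟩
  have h1 := hh.dist_le_mul y z
  have h2 : dist (y 0) (z 0) ^ 2 + dist (y 1) (z 1) ^ 2 = dist y z ^ 2 := by
    rw [EuclideanSpace.dist_eq, Real.sq_sqrt (by positivity), Fin.sum_univ_two]
  have h3 : dist (h y) (h z) ^ 2 ≤ (L * dist y z) ^ 2 := by gcongr
  have h4 : 0 ≤ (L : ℝ) * dist y z ^ 2 := by positivity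
  have h5 : ((1 + L : NNReal) : ℝ) = 1 + L := by push_cast; ring
  simp only [Matrix.cons_val_zero, Matrix.cons_val_one, Matrix.cons_val] 
  rw [h5]
  nlinarith

lemma measurePreserving_coords :
    MeasurePreserving (fun q : E2 × ℝ => (!₂[q.1 0, q.1 1, q.2] : E3))
      (volume.prod volume) volume := by
  have h1 : MeasurePreserving (fun q : E2 × ℝ => (q.2, WithLp.ofLp q.1))
      (volume.prod volume) (volume.prod volume) :=
    (MeasurePreserving.prod (MeasurePreserving.id _) (PiLp.volume_preserving_ofLp (Fin 2))).comp
      Measure.measurePreserving_swap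
  have h2 := (volume_preserving_piFinSuccAbove (fun _ : Fin 3 => ℝ) 2).symm
  have h3 := (PiLp.volume_preserving_toLp (Fin 3)).comp (h2.comp h1)
  have h4 : (fun q : E2 × ℝ => (!₂[q.1 0, q.1 1, q.2] : E3)) = WithLp.toLp 2 ∘
      (MeasurableEquiv.piFinSuccAbove (fun _ : Fin 3 => ℝ) 2).symm ∘
        fun q : E2 × ℝ => (q.2, WithLp.ofLp q.1) := by
    funext q
    ext i
    fin_cases i <;> rfl
  rw [h4]
  exact h3

/-- The coordinates adapted to a graph preserve the volume. -/
lemma measurePreserving_graph (hh : Continuous h) :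
    MeasurePreserving (fun q : E2 × ℝ => graphMap A h q.1 + q.2 • vertical A)
      (volume.prod volume) volume := by
  -- A shear acts on each fibre as a translation, so it preserves volume although h need not be
  -- differentiable.
  have h1 : MeasurePreserving (fun q : E2 × ℝ => (q.1, h q.1 + q.2))
      (volume.prod volume) (volume.prod volume) :=
    (MeasurePreserving.id _).skew_product (g := fun y s => h y + s)
      ((hh.comp continuous_fst).add continuous_snd).measurable
      (ae_of_all _ fun y => (measurePreserving_add_left volume (h y)).map_eq)
  have h2 := A.symm.measurePreserving.comp (measurePreserving_coords.comp h1)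
  have h3 : (fun q : E2 × ℝ => graphMap A h q.1 + q.2 • vertical A) = A.symm ∘
      (fun q : E2 × ℝ => (!₂[q.1 0, q.1 1, q.2] : E3)) ∘ fun q : E2 × ℝ => (q.1, h q.1 + q.2) := by
    funext q
    apply A.injective
    ext i
    fin_cases i <;> simp [graphMap, vertical]
  rw [h3]
  exact h2

lemma lintegral_eq_lintegral_graph (hh : Continuous h) {g : E3 → ℝ≥0∞} (hg : Measurable g) :
    ∫⁻ z, g z = ∫⁻ y : E2, ∫⁻ s : ℝ, g (graphMap A h y + s • vertical A) := by
  have hm := measurePreserving_graph (A := A) hh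
  rw [← hm.lintegral_comp hg]
  exact lintegral_prod _ (hg.comp hm.measurable).aemeasurable

lemma euclideanHausdorffMeasure_image_le {X Y : Type*} [MetricSpace X] [MeasurableSpace X]
    [BorelSpace X] [MetricSpace Y] [MeasurableSpace Y] [BorelSpace Y] {K : NNReal} {f : X → Y}
    (hf : LipschitzWith K f) (d : ℕ) (s : Set X) :
    (Measure.euclideanHausdorffMeasure d : Measure Y) (f '' s)
      ≤ (K : ℝ≥0∞) ^ d * (Measure.euclideanHausdorffMeasure d : Measure X) s := by
  simp only [Measure.euclideanHausdorffMeasure_def, Measure.smul_apply, ENNReal.smul_def,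
    smul_eq_mul]
  rw [mul_left_comm]
  gcongr
  simpa using hf.hausdorffMeasure_image_le (d := d) (by positivity) s

/-- In the ball of radius `r` around `x`, the set `Ω` is the epigraph of `h` in the coordinates
given by `A`. -/
structure IsLocalGraph (Ω : Set E3) (x : E3) (r : ℝ) (A : E3 ≃ₗᵢ[ℝ] E3) (L : NNReal)
    (h : E2 → ℝ) : Prop where
  lip : LipschitzWith L h
  pos : 0 < r
  mem_iff : ∀ y ∈ Metric.ball x r, (y ∈ Ω ↔ h (baseProj A y) < A y 2)

lemma HasLipschitzBoundary.exists_isLocalGraph {Ω : Set E3} (hΩ : HasLipschitzBoundary Ω) {x : E3}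
    (hx : x ∈ frontier Ω) : ∃ r A L h, IsLocalGraph Ω x r A L h := by
  obtain ⟨A, L, h, r, h1, h2, h3⟩ := hΩ x hx
  exact ⟨r, A, L, h, h1, h2, h3⟩

namespace IsLocalGraph

variable {Ω : Set E3} {x : E3} {r : ℝ}

/-- A point strictly below the graph has a neighbourhood that misses Ω. A point on the graph is the
limit of points of Ω directly above it. -/
lemma mem_frontier_iff (hG : IsLocalGraph Ω x r A L h) (hΩ : IsOpen Ω) {y : E3}
    (hy : y ∈ Metric.ball x r) : y ∈ frontier Ω ↔ h (baseProj A y) = A y 2 := by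
  have hcont : Continuous fun z : E3 => h (baseProj A z) :=
    hG.lip.continuous.comp (lipschitzWith_baseProj A).continuous
  have hcont2 : Continuous fun z : E3 => A z 2 :=
    (EuclideanSpace.proj (2 : Fin 3) : E3 →L[ℝ] ℝ).continuous.comp A.continuous
  rw [hΩ.frontier_eq, Set.mem_sdiff, hG.mem_iff y hy, not_lt]
  constructor
  · rintro ⟨h1, h2⟩
    refine le_antisymm (not_lt.1 fun hlt => ?_) h2
    have hU : IsOpen (Metric.ball x r ∩ {z | A z 2 < h (baseProj A z)}) :=
      Metric.isOpen_ball.inter (isOpen_lt hcont2 hcont)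
    obtain ⟨z, ⟨hz1, hz2⟩, hz3⟩ := mem_closure_iff.1 h1 _ hU ⟨hy, hlt⟩
    exact lt_asymm hz2 ((hG.mem_iff z hz1).1 hz3)
  · intro heq
    refine ⟨?_, heq.ge⟩
    have hlim : Tendsto (fun s : ℝ => y + s • vertical A) (𝓝[>] 0) (𝓝 y) := by
      have : Continuous fun s : ℝ => y + s • vertical A := by fun_prop
      simpa using (this.tendsto 0).mono_left nhdsWithin_le_nhds
    refine mem_closure_of_tendsto hlim ?_
    filter_upwards [hlim (Metric.isOpen_ball.mem_nhds hy), self_mem_nhdsWithin] with s hs hs0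
    rw [hG.mem_iff _ hs, baseProj_add_smul_vertical, apply_two_add_smul_vertical, heq]
    exact lt_add_of_pos_right _ hs0

lemma graphMap_baseProj (hG : IsLocalGraph Ω x r A L h) (hΩ : IsOpen Ω) {y : E3}
    (hy : y ∈ Metric.ball x r) (hf : y ∈ frontier Ω) : graphMap A h (baseProj A y) = y := by
  have := graphMap_baseProj_add A h y
  rwa [(hG.mem_frontier_iff hΩ hy).1 hf, sub_self, zero_smul, add_zero] at this

lemma graphMap_mem_frontier (hG : IsLocalGraph Ω x r A L h) (hΩ : IsOpen Ω) {y : E2}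
    (hy : graphMap A h y ∈ Metric.ball x r) : graphMap A h y ∈ frontier Ω := by
  rw [hG.mem_frontier_iff hΩ hy, baseProj_graphMap, apply_two_graphMap]

lemma measurable_graphMap (hG : IsLocalGraph Ω x r A L h) : Measurable (graphMap A h) :=
  (lipschitzWith_graphMap hG.lip).continuous.measurable

/-- The graph map is (1 + L)-Lipschitz, so it enlarges two-dimensional measure by at most (1 + L)².
Together with the reverse bound below this replaces the area formula: only comparability of the
measures is needed. -/
lemma surfaceMeasure_restrict_le (hG : IsLocalGraph Ω x r A L h) (hΩ : IsOpen Ω) :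
    (surfaceMeasure Ω).restrict (Metric.ball x r)
      ≤ (((1 + L : NNReal) : ℝ≥0∞) ^ 2) • (volume : Measure E2).map (graphMap A h) := by
  refine Measure.le_iff.2 fun s hs => ?_
  rw [surfaceMeasure, Measure.restrict_restrict Metric.isOpen_ball.measurableSet,
    Measure.restrict_apply hs, Measure.smul_apply, Measure.map_apply hG.measurable_graphMap hs,
    smul_eq_mul, ← EuclideanSpace.euclideanHausdorffMeasure_eq_volume 2]
  refine le_trans (measure_mono ?_)
    (euclideanHausdorffMeasure_image_le (lipschitzWith_graphMap (A := A) hG.lip) 2 _)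
  rintro y ⟨hys, hyb, hyf⟩
  have := hG.graphMap_baseProj hΩ hyb hyf
  exact ⟨baseProj A y, by rwa [mem_preimage, this], this⟩

/-- Projection to the base inverts the graph map and is 1-Lipschitz, so it does not increase area.
-/
lemma map_graphMap_restrict_le (hG : IsLocalGraph Ω x r A L h) (hΩ : IsOpen Ω) :
    ((volume : Measure E2).map (graphMap A h)).restrict (Metric.ball x r) ≤ surfaceMeasure Ω := by
  refine Measure.le_iff.2 fun s hs => ?_
  have hb := (Metric.isOpen_ball (x := x) (ε := r)).measurableSet
  rw [surfaceMeasure, Measure.restrict_apply hs, Measure.restrict_apply hs,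
    Measure.map_apply hG.measurable_graphMap (hs.inter hb),
    ← EuclideanSpace.euclideanHausdorffMeasure_eq_volume 2]
  have h1 := euclideanHausdorffMeasure_image_le (lipschitzWith_baseProj A) 2 (s ∩ frontier Ω)
  rw [ENNReal.coe_one, one_pow, one_mul] at h1
  refine le_trans (measure_mono ?_) h1
  rintro y ⟨hys, hyb⟩
  exact ⟨graphMap A h y, ⟨hys, hG.graphMap_mem_frontier hΩ hyb⟩, baseProj_graphMap A h y⟩

/-- Integrals over inner vertical segments starting at the boundary are dominated by integrals
over `Ω`. -/
lemma lintegral_surface_lintegral_segment_le (hG : IsLocalGraph Ω x r A L h) (hΩ : IsOpen Ω)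
    {g : E3 → ℝ≥0∞} (hg : Measurable g) :
    ∫⁻ y in Metric.ball x (r / 2), (∫⁻ s in Ioo (0 : ℝ) (r / 2), g (y + s • vertical A))
        ∂surfaceMeasure Ω
      ≤ ((1 + L : NNReal) : ℝ≥0∞) ^ 2 * ∫⁻ z in Ω, g z := by
  have hr := hG.pos
  have hgm := hG.measurable_graphMap
  have hcont := (lipschitzWith_graphMap (A := A) hG.lip).continuous
  have hb : MeasurableSet (Metric.ball x (r / 2)) := Metric.isOpen_ball.measurableSet
  have hsub : Metric.ball x (r / 2) ⊆ Metric.ball x r := Metric.ball_subset_ball (by linarith)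
  have hmeas : Measurable fun y : E3 => ∫⁻ s in Ioo (0 : ℝ) (r / 2), g (y + s • vertical A) := by
    refine Measurable.lintegral_prod_right' (f := fun p : E3 × ℝ => g (p.1 + p.2 • vertical A)) ?_
    exact hg.comp (by fun_prop)
  have hle : (surfaceMeasure Ω).restrict (Metric.ball x (r / 2))
      ≤ (((1 + L : NNReal) : ℝ≥0∞) ^ 2) •
        ((volume : Measure E2).map (graphMap A h)).restrict (Metric.ball x (r / 2)) := by
    have := Measure.restrict_mono_measure (hG.surfaceMeasure_restrict_le hΩ)
      (Metric.ball x (r / 2))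
    rwa [Measure.restrict_restrict hb, inter_eq_left.2 hsub, Measure.restrict_smul] at this
  refine (lintegral_mono' hle le_rfl).trans ?_
  rw [lintegral_smul_measure, smul_eq_mul]
  refine mul_le_mul_right ?_ _
  rw [← lintegral_indicator hb, lintegral_map (hmeas.indicator hb) hgm,
    ← lintegral_indicator hΩ.measurableSet,
    lintegral_eq_lintegral_graph (A := A) hG.lip.continuous (hg.indicator hΩ.measurableSet)]
  refine lintegral_mono fun y => ?_
  by_cases hy : graphMap A h y ∈ Metric.ball x (r / 2)
  · rw [indicator_of_mem hy, ← lintegral_indicator measurableSet_Ioo]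
    refine lintegral_mono fun s => ?_
    by_cases hs : s ∈ Ioo 0 (r / 2)
    -- The base point lies within r/2 of x and the segment is shorter than r/2, so it stays in the
    -- ball where Ω is an epigraph.
    · have hmem : graphMap A h y + s • vertical A ∈ Metric.ball x r := by
        rw [Metric.mem_ball, dist_eq_norm] at hy ⊢
        calc ‖graphMap A h y + s • vertical A - x‖
            = ‖(graphMap A h y - x) + s • vertical A‖ := by congr 1; abel
          _ ≤ ‖graphMap A h y - x‖ + ‖s • vertical A‖ := norm_add_le _ _
          _ = ‖graphMap A h y - x‖ + s := by
            rw [norm_smul, norm_vertical, mul_one, Real.norm_of_nonneg hs.1.le]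
          _ < r := by linarith [hs.2]
      have hmem' : graphMap A h y + s • vertical A ∈ Ω := by
        rw [hG.mem_iff _ hmem]
        simpa using hs.1
      rw [indicator_of_mem hs, indicator_of_mem hmem']
    · rw [indicator_of_notMem hs]
      exact zero_le
  · rw [indicator_of_notMem hy]
    exact zero_le

/-- Volume integrals over a thin neighbourhood of the boundary are dominated by integrals over
vertical segments through the boundary. -/
lemma lintegral_le_lintegral_surface_lintegral_segment (hG : IsLocalGraph Ω x r A L h)
    (hΩ : IsOpen Ω) {S : Set E3} (hS : MeasurableSet S) (hSb : S ⊆ Metric.ball x (r / 2)) {t : ℝ}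
    (ht : (1 + L) * t < r / 2) (hSt : ∀ z ∈ S, ∃ w ∈ frontier Ω, dist z w ≤ t)
    {g : E3 → ℝ≥0∞} (hg : Measurable g) :
    ∫⁻ z in S, g z ≤ ∫⁻ y, (∫⁻ s in Icc (-((1 + L) * t)) ((1 + L) * t), g (y + s • vertical A))
      ∂surfaceMeasure Ω := by
  have hr := hG.pos
  have hgm := hG.measurable_graphMap
  have hb : MeasurableSet (Metric.ball x r) := Metric.isOpen_ball.measurableSet
  have hmeas : Measurable fun y : E3 =>
      ∫⁻ s in Icc (-((1 + L) * t)) ((1 + L) * t), g (y + s • vertical A) := by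
    refine Measurable.lintegral_prod_right' (f := fun p : E3 × ℝ => g (p.1 + p.2 • vertical A)) ?_
    exact hg.comp (by fun_prop)
  refine le_trans ?_ (lintegral_mono' (hG.map_graphMap_restrict_le hΩ) le_rfl)
  rw [← lintegral_indicator hb, lintegral_map (hmeas.indicator hb) hgm,
    ← lintegral_indicator hS,
    lintegral_eq_lintegral_graph (A := A) hG.lip.continuous (hg.indicator hS)]
  refine lintegral_mono fun y => ?_
  have key : ∀ s, graphMap A h y + s • vertical A ∈ S →
      graphMap A h y ∈ Metric.ball x r ∧ s ∈ Icc (-((1 + L) * t)) ((1 + L) * t) := by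
    intro s hs
    obtain ⟨w, hwf, hwt⟩ := hSt _ hs
    set z := graphMap A h y + s • vertical A with hz
    have ht0 : 0 ≤ t := dist_nonneg.trans hwt
    have htr : t < r / 2 := by
      have : 0 ≤ (L : ℝ) * t := by positivity
      linarith
    have hzb : dist z x < r / 2 := hSb hs
    have hwb : w ∈ Metric.ball x r := by
      rw [Metric.mem_ball]
      calc dist w x ≤ dist w z + dist z x := dist_triangle _ _ _
        _ < r := by rw [dist_comm w z]; linarith
    have hw := (hG.mem_frontier_iff hΩ hwb).1 hwf
    -- The height s of z above the graph is compared with the nearby boundary point w, whose height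
    -- is zero: moving by at most t changes the third coordinate by at most t and the value of h by
    -- at most L t.
    have hzs : s = (A z 2 - A w 2) + (h (baseProj A w) - h (baseProj A z)) := by
      rw [hw, hz]
      simp
    have h1 := abs_apply_two_sub_le A z w
    have h2 : |h (baseProj A w) - h (baseProj A z)| ≤ L * dist z w := by
      rw [← Real.dist_eq, dist_comm z w]
      exact (hG.lip.dist_le_mul _ _).trans
        (mul_le_mul_of_nonneg_left (dist_baseProj_le A w z) L.coe_nonneg)
    have habs : |s| ≤ (1 + L) * t := by
      rw [hzs]
      refine (abs_add_le _ _).trans ?_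
      have : (L : ℝ) * dist z w ≤ L * t := mul_le_mul_of_nonneg_left hwt L.coe_nonneg
      linarith
    refine ⟨?_, abs_le.1 habs⟩
    rw [Metric.mem_ball, dist_eq_norm]
    have : graphMap A h y - x = (z - x) - s • vertical A := by rw [hz]; abel
    rw [this]
    calc ‖(z - x) - s • vertical A‖ ≤ ‖z - x‖ + ‖s • vertical A‖ := norm_sub_le _ _
      _ = ‖z - x‖ + |s| := by rw [norm_smul, norm_vertical, mul_one, Real.norm_eq_abs]
      _ < r := by rw [← dist_eq_norm]; linarith
  by_cases hy : graphMap A h y ∈ Metric.ball x r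
  · rw [indicator_of_mem hy, ← lintegral_indicator measurableSet_Icc]
    refine lintegral_mono fun s => ?_
    by_cases hs : graphMap A h y + s • vertical A ∈ S
    · rw [indicator_of_mem hs, indicator_of_mem (key s hs).2]
    · rw [indicator_of_notMem hs]
      exact zero_le
  · have : ∀ s, S.indicator g (graphMap A h y + s • vertical A) = 0 := fun s =>
      indicator_of_notMem (fun hs => hy (key s hs).1) _
    simp [this]

end IsLocalGraph

end Charts

/-! ### Mollification -/

section Mollification

lemma eLpNorm_two_sq {α F : Type*} {m : MeasurableSpace α} {μ : Measure α} [NormedAddCommGroup F]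
    (f : α → F) : eLpNorm f 2 μ ^ 2 = ∫⁻ x, ‖f x‖ₑ ^ 2 ∂μ := by
  have := eLpNorm_nnreal_pow_eq_lintegral (f := f) (μ := μ) (p := 2) two_ne_zero
  simpa using this

/-- Cauchy–Schwarz against the constant 1; for a probability measure it is Jensen's inequality for
the square. -/
lemma sq_lintegral_le {α : Type*} {m : MeasurableSpace α} {μ : Measure α} {f : α → ℝ≥0∞}
    (hf : AEMeasurable f μ) : (∫⁻ x, f x ∂μ) ^ 2 ≤ μ univ * ∫⁻ x, f x ^ 2 ∂μ := by
  have h := ENNReal.lintegral_mul_le_Lp_mul_Lq μ Real.HolderConjugate.two_two hf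
    (aemeasurable_const (b := (1 : ℝ≥0∞)))
  have h2 : ∀ a : ℝ≥0∞, (a ^ (1 / 2 : ℝ)) ^ 2 = a := fun a => by
    rw [← ENNReal.rpow_natCast, ← ENNReal.rpow_mul]
    norm_num
  calc (∫⁻ x, f x ∂μ) ^ 2
      ≤ ((∫⁻ x, f x ^ (2 : ℝ) ∂μ) ^ (1 / 2 : ℝ) * (∫⁻ _, 1 ^ (2 : ℝ) ∂μ) ^ (1 / 2 : ℝ)) ^ 2 := by
        gcongr
        simpa using h
    _ = (∫⁻ x, f x ^ (2 : ℝ) ∂μ) * μ univ := by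
        rw [mul_pow, h2, h2]
        simp
    _ = _ := by
        rw [mul_comm]
        simp

variable {F : Type*} [NormedAddCommGroup F] [InnerProductSpace ℝ F] [CompleteSpace F]

/-- Translations are continuous in `L²`. -/
lemma exists_forall_eLpNorm_translate_sub_le {w : E3 → F} (hw : MemLp w 2 volume) {η : ℝ≥0∞}
    (hη : 0 < η) : ∃ δ > 0, ∀ z : E3, ‖z‖ < δ →
      eLpNorm (fun x => w (x - z) - w x) 2 volume ≤ η := by
  let g : E3 → C(E3, E3) := fun z => ⟨fun x => x - z, by fun_prop⟩
  have hg : Continuous g := by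
    refine ContinuousMap.continuous_of_continuous_uncurry _ ?_
    show Continuous fun p : E3 × E3 => p.2 - p.1
    fun_prop
  have hgm : ∀ z, MeasurePreserving (g z) volume volume := fun z =>
    measurePreserving_sub_right volume z
  have hc := Continuous.compMeasurePreservingLp (f := fun _ : E3 => hw.toLp w)
    continuous_const hg hgm ENNReal.ofNat_ne_top
  have hlim : Tendsto (fun z => edist (Lp.compMeasurePreserving (g z) (hgm z) (hw.toLp w))
      (Lp.compMeasurePreserving (g 0) (hgm 0) (hw.toLp w))) (𝓝 0) (𝓝 0) := by
    have := (hc.tendsto 0).edist (tendsto_const_nhds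
      (x := Lp.compMeasurePreserving (g 0) (hgm 0) (hw.toLp w)))
    simpa using this
  obtain ⟨δ, hδ, hball⟩ := Metric.eventually_nhds_iff.1 (hlim.eventually (gt_mem_nhds hη))
  refine ⟨δ, hδ, fun z hz => ?_⟩
  have h1 := (hball (y := z) (by simpa using hz)).le
  rw [Lp.edist_def] at h1
  refine le_trans (le_of_eq (eLpNorm_congr_ae ?_)) h1
  have hcomp : ∀ z, (Lp.compMeasurePreserving (g z) (hgm z) (hw.toLp w) : E3 → F)
      =ᵐ[volume] fun x => w (x - z) := fun z =>
    (Lp.coeFn_compMeasurePreserving _ _).trans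
      ((hgm z).quasiMeasurePreserving.ae_eq_comp hw.coeFn_toLp)
  filter_upwards [hcomp z, hcomp 0] with x hx hx0
  rw [Pi.sub_apply, hx, hx0, sub_zero]

/-- Convolution with a probability density concentrated near the origin is close to the identity
in `L²`. -/
lemma exists_forall_eLpNorm_convolution_sub_le {w : E3 → F} (hw : MemLp w 2 volume) {η : ℝ≥0∞}
    (hη : 0 < η) : ∃ δ > 0, ∀ ρ : E3 → ℝ, Continuous ρ → HasCompactSupport ρ → (∀ z, 0 ≤ ρ z) →
      ∫ z, ρ z = 1 → (∀ z, ρ z ≠ 0 → ‖z‖ < δ) →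
      eLpNorm (fun x => (∫ z, ρ z • w (x - z)) - w x) 2 volume ≤ η := by
  obtain ⟨δ, hδ, h⟩ := exists_forall_eLpNorm_translate_sub_le hw hη
  refine ⟨δ, hδ, fun ρ hρ hρc hρ0 hρ1 hρs => ?_⟩
  -- A strongly measurable representative makes (x, z) ↦ w(x - z) - w(x) jointly measurable, as
  -- Tonelli requires.
  obtain ⟨w', hw'm, hww'⟩ := hw.aestronglyMeasurable
  have hloc : LocallyIntegrable w volume := hw.locallyIntegrable (by norm_num)
  have hconv : ∀ x, Integrable (fun z => ρ z • w (x - z)) volume := fun x =>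
    hρc.convolutionExists_left (ContinuousLinearMap.lsmul ℝ ℝ) hρ hloc x
  have hρi : Integrable ρ volume := hρ.integrable_of_hasCompactSupport hρc
  have hρl : ∫⁻ z, ‖ρ z‖ₑ = 1 := by
    rw [← ofReal_integral_norm_eq_lintegral_enorm hρi]
    simp only [Real.norm_of_nonneg (hρ0 _), hρ1, ENNReal.ofReal_one]
  let k : E3 → E3 → ℝ≥0∞ := fun x z => ‖w' (x - z) - w' x‖ₑ
  have hkm : Measurable (Function.uncurry k) := by
    refine StronglyMeasurable.enorm (f := fun p : E3 × E3 => w' (p.1 - p.2) - w' p.1) ?_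
    exact (hw'm.comp_measurable (by fun_prop)).sub (hw'm.comp_measurable measurable_fst)
  have hk1 : ∀ x, Measurable fun z => k x z := fun x => hkm.comp measurable_prodMk_left
  have hk2 : ∀ z, Measurable fun x => k x z := fun z => hkm.comp measurable_prodMk_right
  have hρm : Measurable fun z => ‖ρ z‖ₑ := hρ.measurable.enorm
  -- The density ρ defines a probability measure, so Jensen bounds the squared mean of w(x - z) -
  -- w(x) by the mean of its square. Exchanging integrals leaves an average of squared L² moduli of
  -- continuity, each at most η².
  let P : Measure E3 := volume.withDensity fun z => ‖ρ z‖ₑ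
  have hP : P univ = 1 := by
    rw [withDensity_apply _ MeasurableSet.univ, setLIntegral_univ, hρl]
  have hpt : ∀ᵐ x, ‖(∫ z, ρ z • w (x - z)) - w x‖ₑ ^ 2 ≤ ∫⁻ z, ‖ρ z‖ₑ * k x z ^ 2 := by
    filter_upwards [hww'] with x hx
    have e1 : (∫ z, ρ z • w (x - z)) - w x = ∫ z, ρ z • (w (x - z) - w x) := by
      simp only [smul_sub]
      rw [integral_sub (hconv x) (hρi.smul_const _), integral_smul_const, hρ1, one_smul]
    have e2 : ‖(∫ z, ρ z • w (x - z)) - w x‖ₑ ≤ ∫⁻ z, k x z ∂P := by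
      rw [e1]
      refine (enorm_integral_le_lintegral_enorm _).trans (le_of_eq ?_)
      rw [lintegral_withDensity_eq_lintegral_mul _ hρm (hk1 x)]
      have hqm : Measure.QuasiMeasurePreserving (fun z : E3 => x - z) volume volume :=
        (Measure.measurePreserving_sub_left volume x).quasiMeasurePreserving
      refine lintegral_congr_ae ?_
      filter_upwards [hqm.ae_eq_comp hww'] with z hz
      simp only [Function.comp_apply] at hz
      simp only [Pi.mul_apply, k, enorm_smul, hz, hx]
    calc ‖(∫ z, ρ z • w (x - z)) - w x‖ₑ ^ 2 ≤ (∫⁻ z, k x z ∂P) ^ 2 := by gcongr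
      _ ≤ P univ * ∫⁻ z, k x z ^ 2 ∂P :=
          sq_lintegral_le (hk1 x).aemeasurable
      _ = ∫⁻ z, ‖ρ z‖ₑ * k x z ^ 2 := by
          rw [hP, one_mul, lintegral_withDensity_eq_lintegral_mul _ hρm
            ((hk1 x).pow_const 2)]
          rfl
  have hsq : eLpNorm (fun x => (∫ z, ρ z • w (x - z)) - w x) 2 volume ^ 2 ≤ η ^ 2 := by
    rw [eLpNorm_two_sq]
    calc ∫⁻ x, ‖(∫ z, ρ z • w (x - z)) - w x‖ₑ ^ 2
        ≤ ∫⁻ x, ∫⁻ z, ‖ρ z‖ₑ * k x z ^ 2 := lintegral_mono_ae hpt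
      _ = ∫⁻ z, ∫⁻ x, ‖ρ z‖ₑ * k x z ^ 2 := by
          refine lintegral_lintegral_swap (Measurable.aemeasurable ?_)
          exact (hρm.comp measurable_snd).mul (hkm.pow_const 2)
      _ ≤ ∫⁻ z, ‖ρ z‖ₑ * η ^ 2 := by
          refine lintegral_mono fun z => ?_
          simp only
          rw [lintegral_const_mul _ ((hk2 z).pow_const 2)]
          by_cases hz : ρ z = 0
          · simp [hz]
          · gcongr
            have := h z (hρs z hz)
            calc ∫⁻ x, k x z ^ 2 = eLpNorm (fun x => w (x - z) - w x) 2 volume ^ 2 := by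
                  rw [eLpNorm_two_sq]
                  have hqm : Measure.QuasiMeasurePreserving (fun x : E3 => x - z) volume volume :=
                    (measurePreserving_sub_right volume z).quasiMeasurePreserving
                  refine lintegral_congr_ae ?_
                  filter_upwards [hqm.ae_eq_comp hww', hww'] with x h1 h2
                  simp only [Function.comp_apply] at h1
                  simp only [k, h1, h2]
              _ ≤ η ^ 2 := by gcongr
      _ = η ^ 2 := by rw [lintegral_mul_const _ hρm, hρl, one_mul]
  exact (ENNReal.pow_le_pow_left_iff two_ne_zero).1 hsq

end Mollification

/-! ### Partitions of unity and inner cones -/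

/-- Smooth partitions of unity on a compact set, subordinate to balls of prescribed radii. -/
lemma exists_finite_smooth_partition {K : Set E3} (hK : IsCompact K) {r : E3 → ℝ}
    (hr : ∀ x ∈ K, 0 < r x) :
    ∃ (t : Finset E3) (χ : t → E3 → ℝ), (∀ x ∈ t, x ∈ K) ∧
      (∀ i, ContDiff ℝ ∞ (χ i) ∧ HasCompactSupport (χ i) ∧
        tsupport (χ i) ⊆ Metric.ball (i : E3) (r i)) ∧
      (∀ i y, 0 ≤ χ i y) ∧ (∀ y, ∑ i, χ i y ≤ 1) ∧ ∀ y ∈ K, ∑ i, χ i y = 1 := by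
  obtain ⟨t, htK, hcov⟩ := hK.elim_nhds_subcover (fun x => Metric.ball x (r x))
    fun x hx => Metric.ball_mem_nhds x (hr x hx)
  obtain ⟨f, hf⟩ := SmoothPartitionOfUnity.exists_isSubordinate (modelWithCornersSelf ℝ E3)
    hK.isClosed (fun i : t => Metric.ball (i : E3) (r i)) (fun _ => Metric.isOpen_ball)
    (fun y hy => by
      obtain ⟨x, hx, hyx⟩ := mem_iUnion₂.1 (hcov hy)
      exact mem_iUnion.2 ⟨⟨x, hx⟩, hyx⟩)
  refine ⟨t, fun i => f i, htK, fun i => ⟨(f i).contMDiff.contDiff, ?_, hf i⟩, f.nonneg, ?_, ?_⟩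
  · exact (Metric.isBounded_ball.subset (hf i)).isCompact_closure.of_isClosed_subset
      (isClosed_tsupport _) subset_closure
  · intro y
    rw [← finsum_eq_sum_of_fintype]
    exact f.sum_le_one y
  · intro y hy
    rw [← finsum_eq_sum_of_fintype]
    exact f.sum_eq_one hy

/-- Near every point of its closure, a Lipschitz domain contains the translates of a small cone. -/
lemma exists_inner_cone {Ω : Set E3} (hΩ : IsOpen Ω) (hL : HasLipschitzBoundary Ω) {x₀ : E3}
    (hx₀ : x₀ ∈ closure Ω) : ∃ R > 0, ∃ (e : E3) (κ : ℝ), 0 < κ ∧ κ ≤ 1 ∧ ‖e‖ ≤ 1 ∧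
      ∀ ε, 0 < ε → ε < R → ∀ x ∈ Ω, x ∈ Metric.ball x₀ R → ∀ q : E3, ‖q‖ ≤ κ * ε →
        x + ε • e + q ∈ Ω := by
  by_cases hx : x₀ ∈ Ω
  · obtain ⟨R, hR, hball⟩ := Metric.isOpen_iff.1 hΩ x₀ hx
    refine ⟨R / 2, by positivity, 0, 1, one_pos, le_rfl, by simp, fun ε _ h2 x _ hxb q hq => ?_⟩
    apply hball
    rw [Metric.mem_ball, dist_eq_norm] at hxb ⊢
    have : x + ε • (0 : E3) + q - x₀ = (x - x₀) + q := by rw [smul_zero]; abel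
    rw [this]
    linarith [norm_add_le (x - x₀) q]
  · have hfr : x₀ ∈ frontier Ω := by
      rw [hΩ.frontier_eq]
      exact ⟨hx₀, hx⟩
    obtain ⟨r, A, L, h, hG⟩ := hL.exists_isLocalGraph hfr
    have hr := hG.pos
    have hL0 : (0 : ℝ) ≤ L := L.coe_nonneg
    -- A step ε upwards gains height ε over the graph and a perturbation q loses at most (1 + L)‖q‖,
    -- so any opening below 1/(1 + L) works.
    have hκ : (1 + (L : ℝ)) * (1 / (2 + L)) < 1 := by
      rw [mul_one_div, div_lt_one (by positivity)]
      linarith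
    have hκ0 : (0 : ℝ) < 1 / (2 + L) := by positivity
    have hκ1 : (1 : ℝ) / (2 + L) ≤ 1 := by
      rw [div_le_one (by positivity)]
      linarith
    refine ⟨r / 4, by positivity, vertical A, 1 / (2 + L), hκ0, hκ1, (norm_vertical A).le,
      fun ε h1 h2 x hxΩ hxb q hq => ?_⟩
    have hq' : ‖q‖ ≤ ε := hq.trans (mul_le_of_le_one_left h1.le hκ1)
    rw [Metric.mem_ball, dist_eq_norm] at hxb
    have hxr : x ∈ Metric.ball x₀ r := by
      rw [Metric.mem_ball, dist_eq_norm]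
      linarith
    have hyr : x + ε • vertical A + q ∈ Metric.ball x₀ r := by
      rw [Metric.mem_ball, dist_eq_norm]
      have e1 : x + ε • vertical A + q - x₀ = (x - x₀) + (ε • vertical A + q) := by abel
      have e2 : ‖ε • vertical A‖ = ε := by
        rw [norm_smul, norm_vertical, mul_one, Real.norm_of_nonneg h1.le]
      rw [e1]
      linarith [norm_add_le (x - x₀) (ε • vertical A + q), norm_add_le (ε • vertical A) q]
    have hx2 := (hG.mem_iff x hxr).1 hxΩ
    rw [hG.mem_iff _ hyr]
    set y := x + ε • vertical A with hy
    have e1 : h (baseProj A (y + q)) ≤ h (baseProj A y) + L * ‖q‖ := by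
      have := hG.lip.dist_le_mul (baseProj A (y + q)) (baseProj A y)
      rw [Real.dist_eq] at this
      have h3 : dist (baseProj A (y + q)) (baseProj A y) ≤ ‖q‖ := by
        simpa [dist_eq_norm] using dist_baseProj_le A (y + q) y
      have := (le_abs_self _).trans (this.trans (mul_le_mul_of_nonneg_left h3 hL0))
      linarith
    have e2 : A y 2 - ‖q‖ ≤ A (y + q) 2 := by
      have := abs_apply_two_sub_le A y (y + q)
      rw [dist_eq_norm] at this
      have h3 : ‖y - (y + q)‖ = ‖q‖ := by rw [sub_add_cancel_left, norm_neg]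
      linarith [le_abs_self (A y 2 - A (y + q) 2)]
    have e3 : h (baseProj A y) = h (baseProj A x) := by rw [hy, baseProj_add_smul_vertical]
    have e4 : A y 2 = A x 2 + ε := by rw [hy, apply_two_add_smul_vertical]
    have e5 : (1 + (L : ℝ)) * ‖q‖ < ε := by
      calc (1 + (L : ℝ)) * ‖q‖ ≤ (1 + L) * (1 / (2 + L) * ε) := by gcongr
        _ = ((1 + L) * (1 / (2 + L))) * ε := by ring
        _ < 1 * ε := by gcongr
        _ = ε := one_mul _
    linarith

/-! ### Density of smooth functions -/

section Density

variable {Ω : Set E3} {F : Type*} [NormedAddCommGroup F] [InnerProductSpace ℝ F]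

lemma integrable_smul_L2 {ψ : E3 → ℝ} (hψ : Continuous ψ) (hc : HasCompactSupport ψ) (u : L2 Ω F) :
    Integrable (fun x => ψ x • u x) (volume.restrict Ω) := by
  have hm : MemLp ψ 2 (volume.restrict Ω) := hψ.memLp_of_hasCompactSupport hc
  exact memLp_one_iff_integrable.1 ((Lp.memLp u).smul hm)

lemma memLp_smul_L2 {ψ : E3 → ℝ} (hψ : Continuous ψ) (hc : HasCompactSupport ψ) (u : L2 Ω F) :
    MemLp (fun x => ψ x • u x) 2 (volume.restrict Ω) := by
  obtain ⟨C, hC⟩ := hc.exists_bound_of_continuous hψ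
  refine MemLp.of_le_mul (c := C) (Lp.memLp u)
    (hψ.aestronglyMeasurable.smul (Lp.aestronglyMeasurable u)) (ae_of_all _ fun x => ?_)
  rw [norm_smul]
  exact mul_le_mul_of_nonneg_right (hC x) (norm_nonneg _)

lemma continuous_fderiv_apply {χ : E3 → ℝ} (hχ : ContDiff ℝ ∞ χ) (v : E3) :
    Continuous fun x => fderiv ℝ χ x v :=
  (hχ.continuous_fderiv (by simp)).clm_apply continuous_const

/-- The localisation `χ u` of `u`, extended by zero. -/
def cutField (χ : E3 → ℝ) (u : H1 Ω F) : E3 → F :=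
  Ω.indicator fun y => χ y • fieldOf u y

/-- The weak gradient of the localisation `χ u`, extended by zero. -/
def cutGrad (χ : E3 → ℝ) (u : H1 Ω F) : E3 → Grad F :=
  Ω.indicator fun y => WithLp.toLp 2 fun i =>
    fderiv ℝ χ y (EuclideanSpace.single i 1) • fieldOf u y + χ y • gradOf u y i

lemma memLp_cutField (hΩ : IsOpen Ω) {χ : E3 → ℝ} (hχ : ContDiff ℝ ∞ χ)
    (hc : HasCompactSupport χ) (u : H1 Ω F) : MemLp (cutField χ u) 2 volume :=
  (memLp_indicator_iff_restrict hΩ.measurableSet).2 (memLp_smul_L2 hχ.continuous hc (fieldOf u))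

lemma memLp_cutGrad (hΩ : IsOpen Ω) {χ : E3 → ℝ} (hχ : ContDiff ℝ ∞ χ)
    (hc : HasCompactSupport χ) (u : H1 Ω F) : MemLp (cutGrad χ u) 2 volume := by
  refine (memLp_indicator_iff_restrict hΩ.measurableSet).2 (MemLp.of_eval_piLp fun i => ?_)
  refine (memLp_smul_L2 (continuous_fderiv_apply hχ _) (hc.fderiv_apply (𝕜 := ℝ) _)
    (fieldOf u)).add ?_
  refine (memLp_smul_L2 hχ.continuous hc (gradComp i (gradOf u))).ae_eq ?_
  filter_upwards [ContinuousLinearMap.coeFn_compLpL (p := 2)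
      (PiLp.proj 2 (fun _ : Fin 3 => F) i : Grad F →L[ℝ] F) (gradOf u)] with x hx
  rw [gradComp, hx]
  rfl

lemma integrable_smul_grad {ψ : E3 → ℝ} (hψ : Continuous ψ) (hc : HasCompactSupport ψ)
    (G : L2 Ω (Grad F)) (i : Fin 3) :
    Integrable (fun x => ψ x • G x i) (volume.restrict Ω) := by
  refine (integrable_smul_L2 hψ hc (gradComp i G)).congr ?_
  filter_upwards [ContinuousLinearMap.coeFn_compLpL (p := 2)
      (PiLp.proj 2 (fun _ : Fin 3 => F) i : Grad F →L[ℝ] F) G] with x hx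
  rw [gradComp, hx]
  rfl

variable [CompleteSpace F]

lemma hasCompactSupport_cutField {χ : E3 → ℝ} (hc : HasCompactSupport χ) (u : H1 Ω F) :
    HasCompactSupport (cutField χ u) := by
  refine hc.mono fun y hy => ?_
  intro h0
  apply hy
  simp only [cutField, indicator, h0, zero_smul, ite_self]

/-- The gradient of a mollification of `χ u` is the mollification of its weak gradient, at every
point from which the mollifier does not reach outside of `Ω`. -/
lemma classicalGrad_convolution_cutField (hΩ : IsOpen Ω) {χ : E3 → ℝ} (hχ : ContDiff ℝ ∞ χ)
    (hc : HasCompactSupport χ) (u : H1 Ω F) {ρ : E3 → ℝ} (hρ : ContDiff ℝ ∞ ρ)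
    (hρc : HasCompactSupport ρ) {x : E3}
    (hx : ∀ y, x - y ∈ tsupport ρ → y ∈ tsupport χ → y ∈ Ω) :
    classicalGrad (fun x => ∫ z, ρ z • cutField χ u (x - z)) x
      = ∫ z, ρ z • cutGrad χ u (x - z) := by
  have hloc : LocallyIntegrable (cutField χ u) volume :=
    (memLp_cutField hΩ hχ hc u).locallyIntegrable (by norm_num)
  have hlocG : LocallyIntegrable (cutGrad χ u) volume :=
    (memLp_cutGrad hΩ hχ hc u).locallyIntegrable (by norm_num)
  have hρ1 : ContDiff ℝ 1 ρ := hρ.of_le (by exact_mod_cast le_top)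
  have hd : HasFDerivAt (fun x => ∫ z, ρ z • cutField χ u (x - z))
      (∫ z, (ContinuousLinearMap.precompL E3 (ContinuousLinearMap.lsmul ℝ ℝ (E := F)))
        (fderiv ℝ ρ z) (cutField χ u (x - z))) x :=
    hρc.hasFDerivAt_convolution_left (ContinuousLinearMap.lsmul ℝ ℝ) hρ1 hloc x
  have hexG : Integrable (fun z => ρ z • cutGrad χ u (x - z)) volume :=
    hρc.convolutionExists_left (ContinuousLinearMap.lsmul ℝ ℝ) hρ.continuous hlocG x
  have hexD : Integrable (fun z =>
      (ContinuousLinearMap.precompL E3 (ContinuousLinearMap.lsmul ℝ ℝ (E := F)))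
        (fderiv ℝ ρ z) (cutField χ u (x - z))) volume :=
    (hρc.fderiv (𝕜 := ℝ)).convolutionExists_left _ (hρ.continuous_fderiv (by simp)) hloc x
  ext i
  set e : E3 := EuclideanSpace.single i 1 with he
  have hL : classicalGrad (fun x => ∫ z, ρ z • cutField χ u (x - z)) x i
      = ∫ y in Ω, (fderiv ℝ ρ (x - y) e * χ y) • fieldOf u y := by
    simp only [classicalGrad]
    rw [hd.fderiv, ContinuousLinearMap.integral_apply hexD,
      ← integral_sub_left_eq_self _ volume x, ← integral_indicator hΩ.measurableSet]
    refine integral_congr_ae (ae_of_all _ fun y => ?_)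
    simp only [ContinuousLinearMap.precompL_apply, ContinuousLinearMap.lsmul_apply, sub_sub_cancel]
    by_cases hy : y ∈ Ω
    · simp only [cutField, indicator_of_mem hy, smul_smul, he]
    · simp only [cutField, indicator_of_notMem hy, smul_zero]
  have hR : (∫ z, ρ z • cutGrad χ u (x - z)) i
      = ∫ y in Ω, ρ (x - y) • (fderiv ℝ χ y e • fieldOf u y + χ y • gradOf u y i) := by
    have h1 := (PiLp.proj 2 (fun _ : Fin 3 => F) i : Grad F →L[ℝ] F).integral_comp_comm hexG
    refine h1.symm.trans ?_
    rw [← integral_sub_left_eq_self _ volume x, ← integral_indicator hΩ.measurableSet]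
    refine integral_congr_ae (ae_of_all _ fun y => ?_)
    simp only [PiLp.proj_apply, sub_sub_cancel, PiLp.smul_apply]
    by_cases hy : y ∈ Ω
    · simp only [cutGrad, indicator_of_mem hy, he]
    · simp only [cutGrad, indicator_of_notMem hy, PiLp.zero_apply, smul_zero]
  rw [hL, hR]
  -- The mollifier seen from x, times the cutoff, is a test function supported in Ω. The definition
  -- of the weak gradient applied to it moves the derivative from ρ onto χ u.
  let θ : E3 → ℝ := fun y => ρ (x - y) * χ y
  have hρx : ContDiff ℝ ∞ fun y => ρ (x - y) := hρ.comp (contDiff_const.sub contDiff_id)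
  have hθ : ContDiff ℝ ∞ θ := hρx.mul hχ
  have hθc : HasCompactSupport θ := hc.mul_left
  have hθs : tsupport θ ⊆ Ω := by
    intro y hy
    have hy1 : y ∈ tsupport χ := tsupport_mul_subset_right hy
    have hy2 : y ∈ tsupport fun y => ρ (x - y) := tsupport_mul_subset_left hy
    refine hx y ?_ hy1
    have hsub : tsupport (fun y => ρ (x - y)) ⊆ (fun y => x - y) ⁻¹' tsupport ρ := by
      refine closure_minimal (fun z hz => subset_tsupport ρ hz) ?_
      exact (isClosed_tsupport ρ).preimage (by fun_prop)
    exact hsub hy2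
  have hθd : ∀ y, fderiv ℝ θ y e = -(fderiv ℝ ρ (x - y) e * χ y) + ρ (x - y) * fderiv ℝ χ y e := by
    intro y
    have d1 : HasFDerivAt (fun y => ρ (x - y)) (-(fderiv ℝ ρ (x - y))) y := by
      have h1 : HasFDerivAt ρ (fderiv ℝ ρ (x - y)) (x - y) :=
        (hρ.differentiable (by simp)).differentiableAt.hasFDerivAt
      have h2 : HasFDerivAt (fun y : E3 => x - y) (-ContinuousLinearMap.id ℝ E3) y := by
        simpa using (hasFDerivAt_id y).const_sub x
      have h3 : HasFDerivAt (fun y => ρ (x - y))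
          (fderiv ℝ ρ (x - y) ∘L (-ContinuousLinearMap.id ℝ E3)) y := h1.comp y h2
      rwa [ContinuousLinearMap.comp_neg, ContinuousLinearMap.comp_id] at h3
    have d2 : HasFDerivAt χ (fderiv ℝ χ y) y :=
      (hχ.differentiable (by simp)).differentiableAt.hasFDerivAt
    have d3 : HasFDerivAt θ _ y := d1.mul d2
    rw [d3.fderiv]
    simp only [add_apply, smul_apply, smul_eq_mul, neg_apply]
    ring
  have hweak := u.2 θ hθ hθc hθs i
  change ∫ y in Ω, fderiv ℝ θ y e • fieldOf u y = -∫ y in Ω, θ y • gradOf u y i at hweak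
  have c1 : Continuous fun y => fderiv ℝ ρ (x - y) e * χ y :=
    ((continuous_fderiv_apply hρ e).comp (by fun_prop)).mul hχ.continuous
  have c2 : Continuous fun y => ρ (x - y) * fderiv ℝ χ y e :=
    hρx.continuous.mul (continuous_fderiv_apply hχ e)
  have i1 := integrable_smul_L2 c1 hc.mul_left (fieldOf u)
  have i2 := integrable_smul_L2 c2 ((hc.fderiv_apply (𝕜 := ℝ) e).mul_left) (fieldOf u)
  have i3 := integrable_smul_grad hθ.continuous hθc (gradOf u) i
  have e1 : ∫ y in Ω, fderiv ℝ θ y e • fieldOf u y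
      = -(∫ y in Ω, (fderiv ℝ ρ (x - y) e * χ y) • fieldOf u y)
        + ∫ y in Ω, (ρ (x - y) * fderiv ℝ χ y e) • fieldOf u y := by
    rw [← integral_neg, ← integral_add i1.fun_neg i2]
    refine integral_congr_ae (ae_of_all _ fun y => ?_)
    simp only [hθd, add_smul, neg_smul]
  have e2 : ∫ y in Ω, ρ (x - y) • (fderiv ℝ χ y e • fieldOf u y + χ y • gradOf u y i)
      = (∫ y in Ω, (ρ (x - y) * fderiv ℝ χ y e) • fieldOf u y)
        + ∫ y in Ω, θ y • gradOf u y i := by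
    rw [← integral_add i2 i3]
    refine integral_congr_ae (ae_of_all _ fun y => ?_)
    simp only [smul_add, smul_smul, θ]
  rw [e2]
  rw [e1] at hweak
  rw [neg_add_eq_iff_eq_add, ← sub_eq_add_neg, eq_sub_iff_add_eq] at hweak
  rw [← hweak]

/-- Smooth approximation of a localised Sobolev function. -/
lemma exists_smooth_approx_cut (hΩ : IsOpen Ω) {x₀ e : E3} {R κ : ℝ} (hR : 0 < R) (hκ : 0 < κ)
    (hκ1 : κ ≤ 1) (he : ‖e‖ ≤ 1)
    (hcone : ∀ ε, 0 < ε → ε < R → ∀ x ∈ Ω, x ∈ Metric.ball x₀ R → ∀ q : E3, ‖q‖ ≤ κ * ε →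
      x + ε • e + q ∈ Ω)
    {χ : E3 → ℝ} (hχ : ContDiff ℝ ∞ χ) (hc : HasCompactSupport χ)
    (hs : tsupport χ ⊆ Metric.ball x₀ (R / 2)) (u : H1 Ω F) {η : ℝ≥0∞} (hη : 0 < η) :
    ∃ φ : E3 → F, ContDiff ℝ ∞ φ ∧ HasCompactSupport φ ∧
      eLpNorm (fun x => φ x - cutField χ u x) 2 (volume.restrict Ω) ≤ η ∧
      eLpNorm (fun x => classicalGrad φ x - cutGrad χ u x) 2 (volume.restrict Ω) ≤ η := by
  obtain ⟨δ₁, hδ₁, H₁⟩ := exists_forall_eLpNorm_convolution_sub_le (memLp_cutField hΩ hχ hc u) hη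
  obtain ⟨δ₂, hδ₂, H₂⟩ := exists_forall_eLpNorm_convolution_sub_le (memLp_cutGrad hΩ hχ hc u) hη
  -- The mollifier will be supported within 2ε of the origin, so 2ε must stay below both
  -- approximation thresholds and below the R/4 that keeps x in the ball where the cone condition
  -- holds.
  set ε := min (R / 4) (min (δ₁ / 2) (δ₂ / 2)) / 2 with hεdef
  have hmin : 0 < min (R / 4) (min (δ₁ / 2) (δ₂ / 2)) := by positivity
  have hε : 0 < ε := by positivity
  have hεR : 2 * ε ≤ R / 4 := by
    rw [hεdef]; linarith [min_le_left (R / 4) (min (δ₁ / 2) (δ₂ / 2))]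
  have hεδ : 2 * ε ≤ min (δ₁ / 2) (δ₂ / 2) := by
    rw [hεdef]; linarith [min_le_right (R / 4) (min (δ₁ / 2) (δ₂ / 2))]
  have hεδ₁ : 2 * ε < δ₁ := by linarith [min_le_left (δ₁ / 2) (δ₂ / 2)]
  have hεδ₂ : 2 * ε < δ₂ := by linarith [min_le_right (δ₁ / 2) (δ₂ / 2)]
  have hκε : 0 < κ * ε := by positivity
  -- The mollifier is centred at -εe, so that it samples u at points x + εe + q with ‖q‖ ≤ κε. By
  -- the cone condition these lie in Ω, and extension by zero creates no boundary layer there.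
  let b : ContDiffBump (-(ε • e)) := ⟨κ * ε / 2, κ * ε, by positivity, by linarith⟩
  let ρ : E3 → ℝ := b.normed volume
  have hρ : ContDiff ℝ ∞ ρ := b.contDiff_normed
  have hρc : HasCompactSupport ρ := b.hasCompactSupport_normed
  have hρt : ∀ z ∈ tsupport ρ, ‖z + ε • e‖ ≤ κ * ε := by
    intro z hz
    have hz' : z ∈ Metric.closedBall (-(ε • e)) b.rOut := by
      rw [← b.tsupport_normed_eq (μ := volume)]
      exact hz
    rwa [Metric.mem_closedBall, dist_eq_norm, sub_neg_eq_add] at hz'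
  have hρn : ∀ z ∈ tsupport ρ, ‖z‖ ≤ 2 * ε := by
    intro z hz
    have h1 := hρt z hz
    have h2 : ‖ε • e‖ ≤ ε := by
      rw [norm_smul, Real.norm_of_nonneg hε.le]
      exact mul_le_of_le_one_right hε.le he
    have h3 : ‖z‖ ≤ ‖z + ε • e‖ + ‖ε • e‖ := by
      have := norm_sub_le (z + ε • e) (ε • e)
      rwa [add_sub_cancel_right] at this
    have h4 : κ * ε ≤ ε := mul_le_of_le_one_left hε.le hκ1
    linarith
  have hρ0 : ∀ z, 0 ≤ ρ z := fun z => b.nonneg_normed z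
  have hρ1 : ∫ z, ρ z = 1 := b.integral_normed
  have hsmall : ∀ {δ}, 2 * ε < δ → ∀ z, ρ z ≠ 0 → ‖z‖ < δ := fun hδ z hz =>
    (hρn z (subset_tsupport ρ hz)).trans_lt hδ
  have hloc : LocallyIntegrable (cutField χ u) volume :=
    (memLp_cutField hΩ hχ hc u).locallyIntegrable (by norm_num)
  refine ⟨fun x => ∫ z, ρ z • cutField χ u (x - z),
    hρc.contDiff_convolution_left (n := ⊤) (ContinuousLinearMap.lsmul ℝ ℝ) hρ hloc,
    hρc.convolution (ContinuousLinearMap.lsmul ℝ ℝ) (hasCompactSupport_cutField hc u), ?_, ?_⟩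
  · exact (eLpNorm_mono_measure _ Measure.restrict_le_self).trans
      (H₁ ρ hρ.continuous hρc hρ0 hρ1 (hsmall hεδ₁))
  · refine le_trans (le_of_eq (eLpNorm_congr_ae ?_))
      ((eLpNorm_mono_measure _ Measure.restrict_le_self).trans
        (H₂ ρ hρ.continuous hρc hρ0 hρ1 (hsmall hεδ₂)))
    filter_upwards [ae_restrict_mem hΩ.measurableSet] with x hx
    rw [classicalGrad_convolution_cutField hΩ hχ hc u hρ hρc]
    intro y hy1 hy2
    have h1 := hρn _ hy1
    have h2 : y = x + ε • e + -(x - y + ε • e) := by abel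
    rw [h2]
    refine hcone ε hε (by linarith) x hx ?_ _ (by rw [norm_neg]; exact hρt _ hy1)
    have h3 := hs hy2
    rw [Metric.mem_ball, dist_eq_norm] at h3 ⊢
    have h4 : x - x₀ = (x - y) + (y - x₀) := by abel
    rw [h4]
    linarith [norm_add_le (x - y) (y - x₀)]

lemma classicalGrad_sum {ι : Type*} (s : Finset ι) {φ : ι → E3 → F}
    (hφ : ∀ i ∈ s, ContDiff ℝ ∞ (φ i)) (x : E3) :
    classicalGrad (fun x => ∑ i ∈ s, φ i x) x = ∑ i ∈ s, classicalGrad (φ i) x := by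
  ext j
  have hd : ∀ i ∈ s, DifferentiableAt ℝ (φ i) x := fun i hi =>
    ((hφ i hi).differentiable (by simp)).differentiableAt
  simp only [classicalGrad, fderiv_fun_sum hd, WithLp.ofLp_sum, Finset.sum_apply,
    sum_apply]

/-- Smooth functions are dense in `H¹(Ω)` if `Ω` is a bounded Lipschitz domain. -/
theorem exists_smooth_approx (hΩ : IsOpen Ω) (hb : Bornology.IsBounded Ω)
    (hL : HasLipschitzBoundary Ω) (u : H1 Ω F) {η : ℝ≥0∞} (hη : 0 < η) :
    ∃ φ : E3 → F, ContDiff ℝ ∞ φ ∧ HasCompactSupport φ ∧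
      eLpNorm (fun x => φ x - fieldOf u x) 2 (volume.restrict Ω) ≤ η ∧
      eLpNorm (fun x => classicalGrad φ x - gradOf u x) 2 (volume.restrict Ω) ≤ η := by
  choose! R hR e κ hκ hκ1 he hcone using fun x (hx : x ∈ closure Ω) => exists_inner_cone hΩ hL hx
  obtain ⟨t, χ, htK, hχ, -, -, hsum⟩ := exists_finite_smooth_partition hb.isCompact_closure
    (r := fun x => R x / 2) fun x hx => half_pos (hR x hx)
  -- The tolerance is shared among the pieces; the added 1 covers an empty partition.
  have hη' : 0 < η / (t.card + 1 : ℝ≥0∞) := by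
    refine ENNReal.div_pos hη.ne' ?_
    exact_mod_cast ENNReal.natCast_ne_top (t.card + 1)
  choose φ hφ1 hφ2 hφ3 hφ4 using fun i : t =>
    exists_smooth_approx_cut hΩ (hR i (htK i i.2)) (hκ i (htK i i.2)) (hκ1 i (htK i i.2))
      (he i (htK i i.2)) (hcone i (htK i i.2)) (hχ i).1 (hχ i).2.1 (hχ i).2.2 u hη'
  have hbound : ∑ _i : t, η / (t.card + 1 : ℝ≥0∞) ≤ η := by
    rw [Finset.sum_const, Finset.card_univ, Fintype.card_coe, nsmul_eq_mul]
    calc (t.card : ℝ≥0∞) * (η / (t.card + 1))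
        ≤ (t.card + 1) * (η / (t.card + 1)) := by gcongr; exact le_self_add
      _ ≤ η := ENNReal.mul_div_le
  have hsum1 : ∀ y ∈ Ω, ∑ i, χ i y = 1 := fun y hy => hsum y (subset_closure hy)
  -- The cutoffs sum to one on the open set Ω, so their derivatives cancel and the localised
  -- gradients add up to the gradient of u.
  have hsum0 : ∀ y ∈ Ω, ∀ v, ∑ i, fderiv ℝ (χ i) y v = 0 := by
    intro y hy v
    have hd : ∀ i ∈ Finset.univ, DifferentiableAt ℝ (χ i) y := fun i _ =>
      ((hχ i).1.differentiable (by simp)).differentiableAt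
    have h1 : fderiv ℝ (fun y => ∑ i, χ i y) y = 0 := by
      have : (fun y => ∑ i, χ i y) =ᶠ[𝓝 y] fun _ => (1 : ℝ) := by
        filter_upwards [hΩ.mem_nhds hy] with z hz using hsum1 z hz
      rw [this.fderiv_eq]
      simp
    rw [fderiv_fun_sum hd] at h1
    have := congrArg (fun l : E3 →L[ℝ] ℝ => l v) h1
    simpa using this
  refine ⟨fun x => ∑ i, φ i x, ContDiff.sum fun i _ => hφ1 i, ?_, ?_, ?_⟩
  · refine HasCompactSupport.intro (isCompact_iUnion fun i => hφ2 i) fun x hx => ?_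
    refine Finset.sum_eq_zero fun i _ => image_eq_zero_of_notMem_tsupport fun h => hx ?_
    exact mem_iUnion.2 ⟨i, h⟩
  · refine le_trans ?_ ((Finset.sum_le_sum fun i _ => hφ3 i).trans hbound)
    refine le_trans (le_of_eq (eLpNorm_congr_ae ?_)) (eLpNorm_sum_le (fun i _ =>
      ((hφ1 i).continuous.aestronglyMeasurable).sub
        ((memLp_cutField hΩ (hχ i).1 (hχ i).2.1 u).aestronglyMeasurable.restrict)) one_le_two)
    filter_upwards [ae_restrict_mem hΩ.measurableSet] with x hx
    have h1 : ∑ i, cutField (χ i) u x = fieldOf u x := by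
      simp only [cutField, indicator_of_mem hx]
      rw [← Finset.sum_smul, hsum1 x hx, one_smul]
    rw [Finset.sum_apply, Finset.sum_sub_distrib, h1]
  · refine le_trans ?_ ((Finset.sum_le_sum fun i _ => hφ4 i).trans hbound)
    refine le_trans (le_of_eq (eLpNorm_congr_ae ?_)) (eLpNorm_sum_le (fun i _ => ?_) one_le_two)
    · filter_upwards [ae_restrict_mem hΩ.measurableSet] with x hx
      have h1 : ∑ i, cutGrad (χ i) u x = gradOf u x := by
        ext j
        simp only [cutGrad, indicator_of_mem hx, WithLp.ofLp_sum, Finset.sum_apply,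
          Finset.sum_add_distrib]
        rw [← Finset.sum_smul, ← Finset.sum_smul, hsum1 x hx, hsum0 x hx, zero_smul, one_smul,
          zero_add]
      rw [Finset.sum_apply, Finset.sum_sub_distrib, h1, classicalGrad_sum _ fun i _ => hφ1 i]
    · refine AEStronglyMeasurable.sub ?_
        ((memLp_cutGrad hΩ (hχ i).1 (hχ i).2.1 u).aestronglyMeasurable.restrict)
      refine Continuous.aestronglyMeasurable ?_
      refine (PiLp.continuous_toLp 2 _).comp (continuous_pi fun j => ?_)
      exact ((hφ1 i).continuous_fderiv (by simp)).clm_apply continuous_const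

end Density

/-! ### The trace inequality -/

section TraceInequality

variable {Ω : Set E3} {F : Type*} [NormedAddCommGroup F] [InnerProductSpace ℝ F]

lemma ennreal_add_sq_le (a b : ℝ≥0∞) : (a + b) ^ 2 ≤ 2 * (a ^ 2 + b ^ 2) := by
  rcases eq_or_ne a ⊤ with rfl | ha
  · simp
  rcases eq_or_ne b ⊤ with rfl | hb
  · simp
  lift a to NNReal using ha
  lift b to NNReal using hb
  exact_mod_cast (add_sq_le : (a + b) ^ 2 ≤ 2 * (a ^ 2 + b ^ 2))

/-- The value of a function at an endpoint of an interval is controlled by the `H¹` norm. -/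
lemma ofReal_mul_enorm_sq_le [CompleteSpace F] {f f' : ℝ → F} (hf : ∀ s, HasDerivAt f (f' s) s)
    (hf' : Continuous f') (δ : ℝ) :
    ENNReal.ofReal δ * ‖f 0‖ₑ ^ 2 ≤ 2 * (∫⁻ s in Ioo 0 δ, ‖f s‖ₑ ^ 2)
      + 2 * ENNReal.ofReal δ ^ 2 * ∫⁻ s in Ioo 0 δ, ‖f' s‖ₑ ^ 2 := by
  set I := ∫⁻ s in Ioo 0 δ, ‖f' s‖ₑ with hI
  have hfc : Continuous f := continuous_iff_continuousAt.2 fun s => (hf s).continuousAt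
  -- For every s the value at 0 is f(s) minus the integral of f' over (0, s); the estimate is this
  -- bound integrated over s in (0, δ).
  have hpt : ∀ s ∈ Ioo 0 δ, ‖f 0‖ₑ ^ 2 ≤ 2 * (‖f s‖ₑ ^ 2 + I ^ 2) := by
    intro s hs
    have h1 : ∫ t in (0 : ℝ)..s, f' t = f s - f 0 :=
      intervalIntegral.integral_eq_sub_of_hasDerivAt (fun t _ => hf t) (hf'.intervalIntegrable _ _)
    have h2 : ‖f s - f 0‖ₑ ≤ I := by
      rw [← h1, intervalIntegral.integral_of_le hs.1.le, integral_Ioc_eq_integral_Ioo]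
      refine (enorm_integral_le_lintegral_enorm _).trans ?_
      exact lintegral_mono_set (Ioo_subset_Ioo_right hs.2.le)
    have h3 : ‖f 0‖ₑ ≤ ‖f s‖ₑ + I := by
      have : f 0 = f s - (f s - f 0) := by abel
      calc ‖f 0‖ₑ = ‖f s - (f s - f 0)‖ₑ := by rw [← this]
        _ ≤ ‖f s‖ₑ + ‖f s - f 0‖ₑ := enorm_sub_le
        _ ≤ _ := by gcongr
    calc ‖f 0‖ₑ ^ 2 ≤ (‖f s‖ₑ + I) ^ 2 := by gcongr
      _ ≤ 2 * (‖f s‖ₑ ^ 2 + I ^ 2) := ennreal_add_sq_le _ _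
  have hvol : (volume.restrict (Ioo 0 δ)) univ = ENNReal.ofReal δ := by simp
  have hI2 : I ^ 2 ≤ ENNReal.ofReal δ * ∫⁻ s in Ioo 0 δ, ‖f' s‖ₑ ^ 2 := by
    rw [← hvol]
    exact sq_lintegral_le hf'.enorm.measurable.aemeasurable
  calc ENNReal.ofReal δ * ‖f 0‖ₑ ^ 2 = ∫⁻ _s in Ioo 0 δ, ‖f 0‖ₑ ^ 2 := by
        rw [lintegral_const, hvol, mul_comm]
    _ ≤ ∫⁻ s in Ioo 0 δ, 2 * (‖f s‖ₑ ^ 2 + I ^ 2) :=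
        setLIntegral_mono' measurableSet_Ioo hpt
    _ = 2 * (∫⁻ s in Ioo 0 δ, ‖f s‖ₑ ^ 2) + 2 * (I ^ 2 * ENNReal.ofReal δ) := by
        rw [lintegral_const_mul' _ _ ENNReal.ofNat_ne_top,
          lintegral_add_right _ measurable_const, lintegral_const, hvol, mul_add]
    _ ≤ 2 * (∫⁻ s in Ioo 0 δ, ‖f s‖ₑ ^ 2)
        + 2 * ((ENNReal.ofReal δ * ∫⁻ s in Ioo 0 δ, ‖f' s‖ₑ ^ 2) * ENNReal.ofReal δ) := by gcongr
    _ = _ := by ring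

lemma continuous_classicalGrad {φ : E3 → F} (hφ : ContDiff ℝ ∞ φ) :
    Continuous (classicalGrad φ) :=
  (PiLp.continuous_toLp 2 _).comp (continuous_pi fun _ =>
    (hφ.continuous_fderiv (by simp)).clm_apply continuous_const)

lemma hasCompactSupport_classicalGrad {φ : E3 → F} (hc : HasCompactSupport φ) :
    HasCompactSupport (classicalGrad φ) := by
  refine (hc.fderiv (𝕜 := ℝ)).mono fun x hx h0 => hx ?_
  simp only [classicalGrad, h0]
  ext i
  simp

lemma norm_fderiv_apply_le (φ : E3 → F) (x v : E3) :
    ‖fderiv ℝ φ x v‖ ≤ 3 * ‖v‖ * ‖classicalGrad φ x‖ := by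
  have hv : v = ∑ i, v i • EuclideanSpace.single i (1 : ℝ) := by
    ext j; simp [Pi.single_apply]
  conv_lhs => rw [hv]
  rw [map_sum]
  refine (norm_sum_le _ _).trans ?_
  have h : ∀ i ∈ Finset.univ, ‖fderiv ℝ φ x (v i • EuclideanSpace.single i (1 : ℝ))‖
      ≤ ‖v‖ * ‖classicalGrad φ x‖ := by
    intro i _
    rw [map_smul, norm_smul]
    exact mul_le_mul (PiLp.norm_apply_le v i) (PiLp.norm_apply_le (classicalGrad φ x) i)
      (norm_nonneg _) (norm_nonneg _)
  refine (Finset.sum_le_sum h).trans (le_of_eq ?_)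
  rw [Finset.sum_const, Finset.card_univ, Fintype.card_fin, nsmul_eq_mul]
  push_cast
  ring

/-- The one-dimensional estimate is applied along the inner vertical segment from each boundary
point and integrated over the surface. The factor 18 is 2·3², with the 3 from
`norm_fderiv_apply_le`, and 2 + 18d² dominates both coefficients. -/
lemma IsLocalGraph.exists_trace_le {x : E3} {r : ℝ} {A : E3 ≃ₗᵢ[ℝ] E3} {L : NNReal} {h : E2 → ℝ}
    (hG : IsLocalGraph Ω x r A L h) (hΩ : IsOpen Ω) :
    ∃ C : ℝ≥0∞, C ≠ ⊤ ∧ ∀ (F : Type) [NormedAddCommGroup F] [InnerProductSpace ℝ F]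
      [CompleteSpace F] (φ : E3 → F), ContDiff ℝ ∞ φ →
      ∫⁻ y in Metric.ball x (r / 2), ‖φ y‖ₑ ^ 2 ∂surfaceMeasure Ω
        ≤ C * ((∫⁻ z in Ω, ‖φ z‖ₑ ^ 2) + ∫⁻ z in Ω, ‖classicalGrad φ z‖ₑ ^ 2) := by
  have hδ : 0 < r / 2 := half_pos hG.pos
  set d := ENNReal.ofReal (r / 2) with hd
  have hd0 : d ≠ 0 := (ENNReal.ofReal_pos.2 hδ).ne'
  have hdt : d ≠ ⊤ := ENNReal.ofReal_ne_top
  set B : ℝ≥0∞ := ((1 + L : NNReal) : ℝ≥0∞) ^ 2 with hB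
  have hBt : B ≠ ⊤ := ENNReal.pow_ne_top ENNReal.coe_ne_top
  refine ⟨(2 + 18 * d ^ 2) * B / d, ?_, fun F _ _ _ φ hφ => ?_⟩
  · refine ENNReal.div_ne_top (ENNReal.mul_ne_top ?_ hBt) hd0
    exact ENNReal.add_ne_top.2 ⟨ENNReal.ofNat_ne_top,
      ENNReal.mul_ne_top ENNReal.ofNat_ne_top (ENNReal.pow_ne_top hdt)⟩
  · set e := vertical A with he
    have hm1 : Measurable fun z => ‖φ z‖ₑ ^ 2 := (hφ.continuous.enorm.measurable).pow_const 2
    have hm2 : Measurable fun z => ‖classicalGrad φ z‖ₑ ^ 2 :=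
      ((continuous_classicalGrad hφ).enorm.measurable).pow_const 2
    have hpt : ∀ y, d * ‖φ y‖ₑ ^ 2 ≤ 2 * (∫⁻ s in Ioo 0 (r / 2), ‖φ (y + s • e)‖ₑ ^ 2)
        + 18 * d ^ 2 * ∫⁻ s in Ioo 0 (r / 2), ‖classicalGrad φ (y + s • e)‖ₑ ^ 2 := by
      intro y
      have hder : ∀ s : ℝ, HasDerivAt (fun s : ℝ => φ (y + s • e)) (fderiv ℝ φ (y + s • e) e) s := by
        intro s
        have h1 : HasFDerivAt φ (fderiv ℝ φ (y + s • e)) (y + s • e) :=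
          (hφ.differentiable (by simp)).differentiableAt.hasFDerivAt
        have h2 : HasDerivAt (fun s : ℝ => y + s • e) e s := by
          simpa using ((hasDerivAt_id s).smul_const e).const_add y
        exact h1.comp_hasDerivAt s h2
      have hcd : Continuous fun s : ℝ => fderiv ℝ φ (y + s • e) e :=
        ((hφ.continuous_fderiv (by simp)).comp (by fun_prop)).clm_apply continuous_const
      have key := ofReal_mul_enorm_sq_le hder hcd (r / 2)
      rw [zero_smul, add_zero] at key
      refine key.trans ?_
      have hle : ∫⁻ s in Ioo 0 (r / 2), ‖fderiv ℝ φ (y + s • e) e‖ₑ ^ 2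
          ≤ 9 * ∫⁻ s in Ioo 0 (r / 2), ‖classicalGrad φ (y + s • e)‖ₑ ^ 2 := by
        rw [← lintegral_const_mul' _ _ ENNReal.ofNat_ne_top]
        refine lintegral_mono fun s => ?_
        have h1 : ‖fderiv ℝ φ (y + s • e) e‖ₑ ≤ 3 * ‖classicalGrad φ (y + s • e)‖ₑ := by
          have := norm_fderiv_apply_le φ (y + s • e) e
          rw [he, norm_vertical, mul_one, ← he] at this
          rw [← ofReal_norm, ← ofReal_norm, ← ENNReal.ofReal_ofNat 3, ← ENNReal.ofReal_mul (by norm_num)]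
          exact ENNReal.ofReal_le_ofReal this
        calc ‖fderiv ℝ φ (y + s • e) e‖ₑ ^ 2 ≤ (3 * ‖classicalGrad φ (y + s • e)‖ₑ) ^ 2 := by gcongr
          _ = 9 * ‖classicalGrad φ (y + s • e)‖ₑ ^ 2 := by ring
      calc _ ≤ 2 * (∫⁻ s in Ioo 0 (r / 2), ‖φ (y + s • e)‖ₑ ^ 2) + 2 * d ^ 2 *
            (9 * ∫⁻ s in Ioo 0 (r / 2), ‖classicalGrad φ (y + s • e)‖ₑ ^ 2) := by gcongr
        _ = _ := by ring
    have hms : ∀ {g : E3 → ℝ≥0∞}, Measurable g →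
        Measurable fun y => ∫⁻ s in Ioo (0 : ℝ) (r / 2), g (y + s • e) := by
      intro g hg
      refine Measurable.lintegral_prod_right' (f := fun p : E3 × ℝ => g (p.1 + p.2 • e)) ?_
      exact hg.comp (by fun_prop)
    have hint : d * ∫⁻ y in Metric.ball x (r / 2), ‖φ y‖ₑ ^ 2 ∂surfaceMeasure Ω
        ≤ (2 + 18 * d ^ 2) * B
          * ((∫⁻ z in Ω, ‖φ z‖ₑ ^ 2) + ∫⁻ z in Ω, ‖classicalGrad φ z‖ₑ ^ 2) := by
      rw [← lintegral_const_mul' _ _ hdt]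
      refine (lintegral_mono hpt).trans ?_
      rw [lintegral_add_left ((hms hm1).const_mul 2), lintegral_const_mul _ (hms hm1),
        lintegral_const_mul _ (hms hm2)]
      have k1 := hG.lintegral_surface_lintegral_segment_le hΩ hm1
      have k2 := hG.lintegral_surface_lintegral_segment_le hΩ hm2
      calc _ ≤ 2 * (B * ∫⁻ z in Ω, ‖φ z‖ₑ ^ 2)
            + 18 * d ^ 2 * (B * ∫⁻ z in Ω, ‖classicalGrad φ z‖ₑ ^ 2) := by gcongr
        _ ≤ (2 + 18 * d ^ 2) * (B * ∫⁻ z in Ω, ‖φ z‖ₑ ^ 2)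
            + (2 + 18 * d ^ 2) * (B * ∫⁻ z in Ω, ‖classicalGrad φ z‖ₑ ^ 2) := by
            gcongr
            · exact le_self_add
            · exact le_add_self
        _ = _ := by ring
    rw [ENNReal.mul_comm_div, mul_div_assoc', ENNReal.le_div_iff_mul_le (Or.inl hd0) (Or.inl hdt)]
    rw [mul_comm]
    exact hint

end TraceInequality

/-! ### The trace operator -/

section Trace

variable {Ω : Set E3}

/-- The trace inequality for smooth functions on a bounded Lipschitz domain. -/
theorem exists_trace_inequality (hΩ : IsOpen Ω) (hb : Bornology.IsBounded Ω)
    (hL : HasLipschitzBoundary Ω) :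
    ∃ C : ℝ≥0∞, C ≠ ⊤ ∧ ∀ (F : Type) [NormedAddCommGroup F] [InnerProductSpace ℝ F]
      [CompleteSpace F] (φ : E3 → F), ContDiff ℝ ∞ φ →
      eLpNorm φ 2 (surfaceMeasure Ω) ≤ C * (eLpNorm φ 2 (volume.restrict Ω)
        + eLpNorm (classicalGrad φ) 2 (volume.restrict Ω)) := by
  choose! r A L h hG using fun x (hx : x ∈ frontier Ω) => hL.exists_isLocalGraph hx
  choose! c hct hc using fun x (hx : x ∈ frontier Ω) => (hG x hx).exists_trace_le hΩ
  have hK : IsCompact (frontier Ω) :=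
    hb.isCompact_closure.of_isClosed_subset isClosed_frontier frontier_subset_closure
  obtain ⟨t, htK, hcov⟩ := hK.elim_nhds_subcover (fun x => Metric.ball x (r x / 2))
    fun x hx => Metric.ball_mem_nhds x (half_pos (hG x hx).pos)
  set S := ∑ x ∈ t, c x with hS
  have hSt : S ≠ ⊤ := (ENNReal.sum_lt_top.2 fun x hx => (hct x (htK x hx)).lt_top).ne
  refine ⟨S ^ (1 / 2 : ℝ), ENNReal.rpow_ne_top_of_nonneg (by norm_num) hSt,
    fun F _ _ _ φ hφ => ?_⟩
  have hroot : (S ^ (1 / 2 : ℝ)) ^ 2 = S := by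
    rw [← ENNReal.rpow_natCast, ← ENNReal.rpow_mul]
    norm_num
  have hm : Measurable fun z => ‖φ z‖ₑ ^ 2 := (hφ.continuous.enorm.measurable).pow_const 2
  have hle : ∫⁻ y, ‖φ y‖ₑ ^ 2 ∂surfaceMeasure Ω
      ≤ S * ((∫⁻ z in Ω, ‖φ z‖ₑ ^ 2) + ∫⁻ z in Ω, ‖classicalGrad φ z‖ₑ ^ 2) := by
    calc ∫⁻ y, ‖φ y‖ₑ ^ 2 ∂surfaceMeasure Ω
        ≤ ∫⁻ y, ∑ x ∈ t, (Metric.ball x (r x / 2)).indicator (fun z => ‖φ z‖ₑ ^ 2) y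
            ∂surfaceMeasure Ω := by
          refine lintegral_mono_ae ?_
          filter_upwards [ae_restrict_mem isClosed_frontier.measurableSet] with y hy
          obtain ⟨x, hx, hyx⟩ := mem_iUnion₂.1 (hcov hy)
          refine le_trans ?_ (Finset.single_le_sum (fun _ _ => zero_le) hx)
          rw [indicator_of_mem hyx]
      _ = ∑ x ∈ t, ∫⁻ y in Metric.ball x (r x / 2), ‖φ y‖ₑ ^ 2 ∂surfaceMeasure Ω := by
          rw [lintegral_finsetSum _ fun x _ => hm.indicator Metric.isOpen_ball.measurableSet]
          refine Finset.sum_congr rfl fun x _ => ?_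
          rw [lintegral_indicator Metric.isOpen_ball.measurableSet]
      _ ≤ ∑ x ∈ t, c x * ((∫⁻ z in Ω, ‖φ z‖ₑ ^ 2) + ∫⁻ z in Ω, ‖classicalGrad φ z‖ₑ ^ 2) :=
          Finset.sum_le_sum fun x hx => hc x (htK x hx) F φ hφ
      _ = _ := by rw [← Finset.sum_mul]
  rw [← ENNReal.pow_le_pow_left_iff two_ne_zero, mul_pow, hroot, eLpNorm_two_sq]
  refine hle.trans ?_
  gcongr
  rw [← eLpNorm_two_sq, ← eLpNorm_two_sq, add_sq]
  exact add_le_add_left le_self_add _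

/-- For a bump function equal to one on the closure of Ω, the left side of the trace inequality is
the square root of the boundary area. -/
lemma isFiniteMeasure_surfaceMeasure (hΩ : IsOpen Ω) (hb : Bornology.IsBounded Ω)
    (hL : HasLipschitzBoundary Ω) : IsFiniteMeasure (surfaceMeasure Ω) := by
  obtain ⟨C, hC, h⟩ := exists_trace_inequality hΩ hb hL
  obtain ⟨R, hR⟩ := hb.closure.subset_closedBall (0 : E3)
  let b : ContDiffBump (0 : E3) := ⟨max R 1, max R 1 + 1, by positivity, by linarith⟩
  have hb1 : ∀ x ∈ closure Ω, b x = 1 := fun x hx =>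
    b.one_of_mem_closedBall (Metric.closedBall_subset_closedBall (le_max_left _ _) (hR hx))
  have hbd : ContDiff ℝ ∞ b := b.contDiff
  have hbc : HasCompactSupport b := b.hasCompactSupport
  have h1 : eLpNorm b 2 (surfaceMeasure Ω) < ⊤ := by
    refine (h ℝ b hbd).trans_lt (ENNReal.mul_lt_top hC.lt_top (ENNReal.add_lt_top.2 ⟨?_, ?_⟩))
    · exact (b.continuous.memLp_of_hasCompactSupport hbc).eLpNorm_lt_top
    · exact ((continuous_classicalGrad hbd).memLp_of_hasCompactSupport
        (hasCompactSupport_classicalGrad hbc)).eLpNorm_lt_top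
  refine ⟨?_⟩
  have h2 : (surfaceMeasure Ω) univ = eLpNorm b 2 (surfaceMeasure Ω) ^ 2 := by
    rw [eLpNorm_two_sq, ← lintegral_one]
    refine lintegral_congr_ae ?_
    filter_upwards [ae_restrict_mem isClosed_frontier.measurableSet] with y hy
    rw [hb1 y (frontier_subset_closure hy)]
    simp
  rw [h2]
  exact ENNReal.pow_lt_top h1

variable {F : Type} [NormedAddCommGroup F] [InnerProductSpace ℝ F]

lemma fieldOf_add (u w : H1 Ω F) : fieldOf (u + w) = fieldOf u + fieldOf w := rfl
lemma gradOf_add (u w : H1 Ω F) : gradOf (u + w) = gradOf u + gradOf w := rfl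
lemma fieldOf_smul (c : ℝ) (u : H1 Ω F) : fieldOf (c • u) = c • fieldOf u := rfl
lemma gradOf_smul (c : ℝ) (u : H1 Ω F) : gradOf (c • u) = c • gradOf u := rfl

lemma inner_H1 (u w : H1 Ω F) :
    inner ℝ u w = inner ℝ (fieldOf u) (fieldOf w) + inner ℝ (gradOf u) (gradOf w) :=
  WithLp.prod_inner_apply _ _

lemma norm_fieldOf_le (u : H1 Ω F) : ‖fieldOf u‖ ≤ ‖u‖ := by
  have h := inner_H1 u u
  rw [real_inner_self_eq_norm_sq, real_inner_self_eq_norm_sq, real_inner_self_eq_norm_sq] at h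
  exact le_of_sq_le_sq (by nlinarith [sq_nonneg ‖gradOf u‖]) (norm_nonneg _)

lemma norm_gradOf_le (u : H1 Ω F) : ‖gradOf u‖ ≤ ‖u‖ := by
  have h := inner_H1 u u
  rw [real_inner_self_eq_norm_sq, real_inner_self_eq_norm_sq, real_inner_self_eq_norm_sq] at h
  exact le_of_sq_le_sq (by nlinarith [sq_nonneg ‖fieldOf u‖]) (norm_nonneg _)

/-- The function underlying an element of `H¹`, as a continuous linear map. -/
def fieldL : H1 Ω F →L[ℝ] L2 Ω F :=
  LinearMap.mkContinuous ⟨⟨fieldOf, fieldOf_add⟩, fieldOf_smul⟩ 1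
    fun u => by rw [one_mul]; exact norm_fieldOf_le u

/-- The weak gradient as a continuous linear map. -/
def gradL : H1 Ω F →L[ℝ] L2 Ω (Grad F) :=
  LinearMap.mkContinuous ⟨⟨gradOf, gradOf_add⟩, gradOf_smul⟩ 1
    fun u => by rw [one_mul]; exact norm_gradOf_le u

lemma classicalGrad_sub {φ ψ : E3 → F} (hφ : ContDiff ℝ ∞ φ) (hψ : ContDiff ℝ ∞ ψ) (x : E3) :
    classicalGrad (fun x => φ x - ψ x) x = classicalGrad φ x - classicalGrad ψ x := by
  ext i
  simp only [classicalGrad, PiLp.sub_apply]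
  rw [fderiv_fun_sub ((hφ.differentiable (by simp)).differentiableAt)
    ((hψ.differentiable (by simp)).differentiableAt)]
  rfl

lemma classicalGrad_add {φ ψ : E3 → F} (hφ : ContDiff ℝ ∞ φ) (hψ : ContDiff ℝ ∞ ψ) (x : E3) :
    classicalGrad (fun x => φ x + ψ x) x = classicalGrad φ x + classicalGrad ψ x := by
  ext i
  simp only [classicalGrad, PiLp.add_apply]
  rw [fderiv_fun_add ((hφ.differentiable (by simp)).differentiableAt)
    ((hψ.differentiable (by simp)).differentiableAt)]
  rfl

lemma classicalGrad_const_smul {φ : E3 → F} (hφ : ContDiff ℝ ∞ φ) (c : ℝ) (x : E3) :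
    classicalGrad (fun x => c • φ x) x = c • classicalGrad φ x := by
  ext i
  simp only [classicalGrad, PiLp.smul_apply]
  rw [fderiv_fun_const_smul ((hφ.differentiable (by simp)).differentiableAt)]
  rfl

lemma memLp_smooth (μ : Measure E3) [IsFiniteMeasureOnCompacts μ] {φ : E3 → F}
    (hφ : ContDiff ℝ ∞ φ) (hc : HasCompactSupport φ) : MemLp φ 2 μ :=
  hφ.continuous.memLp_of_hasCompactSupport hc

lemma memLp_classicalGrad (μ : Measure E3) [IsFiniteMeasureOnCompacts μ] {φ : E3 → F}
    (hφ : ContDiff ℝ ∞ φ) (hc : HasCompactSupport φ) : MemLp (classicalGrad φ) 2 μ :=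
  (continuous_classicalGrad hφ).memLp_of_hasCompactSupport (hasCompactSupport_classicalGrad hc)

lemma tendsto_toLp_iff_eLpNorm {α E : Type*} {m : MeasurableSpace α} {μ : Measure α}
    [NormedAddCommGroup E] {f : ℕ → α → E} (hf : ∀ j, MemLp (f j) 2 μ) (g : Lp E 2 μ) :
    Tendsto (fun j => (hf j).toLp (f j)) atTop (𝓝 g) ↔
      Tendsto (fun j => eLpNorm (fun x => f j x - g x) 2 μ) atTop (𝓝 0) := by
  rw [tendsto_iff_edist_tendsto_0]
  have : ∀ j, edist ((hf j).toLp (f j)) g = eLpNorm (fun x => f j x - g x) 2 μ := fun j => by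
    rw [Lp.edist_def]
    refine eLpNorm_congr_ae ?_
    filter_upwards [(hf j).coeFn_toLp] with x hx
    rw [Pi.sub_apply, hx]
  simp only [this]

/-- Traces in terms of convergence in `L²`. -/
lemma isTrace_iff [IsFiniteMeasure (surfaceMeasure Ω)] (u : H1 Ω F)
    (g : Lp F 2 (surfaceMeasure Ω)) :
    IsTrace u g ↔ ∃ (φ : ℕ → E3 → F) (h : ∀ j, ContDiff ℝ ∞ (φ j) ∧ HasCompactSupport (φ j)),
      Tendsto (fun j => (memLp_smooth (volume.restrict Ω) (h j).1 (h j).2).toLp (φ j)) atTop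
        (𝓝 (fieldOf u)) ∧
      Tendsto (fun j => (memLp_classicalGrad (volume.restrict Ω) (h j).1 (h j).2).toLp _) atTop
        (𝓝 (gradOf u)) ∧
      Tendsto (fun j => (memLp_smooth (surfaceMeasure Ω) (h j).1 (h j).2).toLp (φ j)) atTop
        (𝓝 g) := by
  constructor
  · rintro ⟨φ, h, h1, h2, h3⟩
    exact ⟨φ, h, (tendsto_toLp_iff_eLpNorm _ _).2 h1, (tendsto_toLp_iff_eLpNorm _ _).2 h2,
      (tendsto_toLp_iff_eLpNorm _ _).2 h3⟩
  · rintro ⟨φ, h, h1, h2, h3⟩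
    exact ⟨φ, h, (tendsto_toLp_iff_eLpNorm _ _).1 h1, (tendsto_toLp_iff_eLpNorm _ _).1 h2,
      (tendsto_toLp_iff_eLpNorm _ _).1 h3⟩

/-- The trace inequality for φ - ψ. This Lipschitz bound yields existence, uniqueness and
boundedness of traces. -/
lemma exists_dist_toLp_trace_le [CompleteSpace F] (hΩ : IsOpen Ω) (hb : Bornology.IsBounded Ω)
    (hL : HasLipschitzBoundary Ω) [IsFiniteMeasure (surfaceMeasure Ω)] :
    ∃ C : ℝ, 0 ≤ C ∧ ∀ (φ ψ : E3 → F) (hφ : ContDiff ℝ ∞ φ) (hφc : HasCompactSupport φ)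
      (hψ : ContDiff ℝ ∞ ψ) (hψc : HasCompactSupport ψ),
      dist ((memLp_smooth (surfaceMeasure Ω) hφ hφc).toLp φ)
          ((memLp_smooth (surfaceMeasure Ω) hψ hψc).toLp ψ)
        ≤ C * (dist ((memLp_smooth (volume.restrict Ω) hφ hφc).toLp φ)
            ((memLp_smooth (volume.restrict Ω) hψ hψc).toLp ψ)
          + dist ((memLp_classicalGrad (volume.restrict Ω) hφ hφc).toLp _)
            ((memLp_classicalGrad (volume.restrict Ω) hψ hψc).toLp _)) := by
  obtain ⟨C, hC, h⟩ := exists_trace_inequality hΩ hb hL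
  refine ⟨C.toReal, ENNReal.toReal_nonneg, fun φ ψ hφ hφc hψ hψc => ?_⟩
  have key := h F (fun x => φ x - ψ x) (hφ.sub hψ)
  have e2 : classicalGrad (fun x => φ x - ψ x) = classicalGrad φ - classicalGrad ψ :=
    funext fun x => classicalGrad_sub hφ hψ x
  rw [e2] at key
  rw [dist_edist, dist_edist, dist_edist, Lp.edist_toLp_toLp, Lp.edist_toLp_toLp,
    Lp.edist_toLp_toLp, ← ENNReal.toReal_add, ← ENNReal.toReal_mul]
  · refine ENNReal.toReal_mono (ENNReal.mul_ne_top hC (ENNReal.add_ne_top.2 ⟨?_, ?_⟩)) key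
    · exact ((memLp_smooth _ hφ hφc).sub (memLp_smooth _ hψ hψc)).eLpNorm_ne_top
    · exact ((memLp_classicalGrad _ hφ hφc).sub (memLp_classicalGrad _ hψ hψc)).eLpNorm_ne_top
  · exact ((memLp_smooth _ hφ hφc).sub (memLp_smooth _ hψ hψc)).eLpNorm_ne_top
  · exact ((memLp_classicalGrad _ hφ hφc).sub (memLp_classicalGrad _ hψ hψc)).eLpNorm_ne_top

lemma exists_dist_trace_le [CompleteSpace F] (hΩ : IsOpen Ω) (hb : Bornology.IsBounded Ω)
    (hL : HasLipschitzBoundary Ω) :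
    ∃ C : ℝ, 0 ≤ C ∧ ∀ (u w : H1 Ω F) (g k : Lp F 2 (surfaceMeasure Ω)), IsTrace u g →
      IsTrace w k → dist g k ≤ C * (dist (fieldOf u) (fieldOf w) + dist (gradOf u) (gradOf w)) := by
  have := isFiniteMeasure_surfaceMeasure hΩ hb hL
  obtain ⟨C, hC, h⟩ := exists_dist_toLp_trace_le (F := F) hΩ hb hL
  refine ⟨C, hC, fun u w g k hu hw => ?_⟩
  obtain ⟨φ, hφ, h1, h2, h3⟩ := (isTrace_iff u g).1 hu
  obtain ⟨ψ, hψ, k1, k2, k3⟩ := (isTrace_iff w k).1 hw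
  exact le_of_tendsto_of_tendsto' (h3.dist k3) (((h1.dist k1).add (h2.dist k2)).const_mul C)
    fun j => h (φ j) (ψ j) (hφ j).1 (hφ j).2 (hψ j).1 (hψ j).2

/-- Smooth approximations of u are Cauchy in H¹, so by the trace inequality their boundary values
are Cauchy in L²(∂Ω), which is complete. -/
theorem exists_isTrace [CompleteSpace F] (hΩ : IsOpen Ω) (hb : Bornology.IsBounded Ω)
    (hL : HasLipschitzBoundary Ω) (u : H1 Ω F) : ∃ g, IsTrace u g := by
  have := isFiniteMeasure_surfaceMeasure hΩ hb hL
  obtain ⟨C, hC, h⟩ := exists_dist_toLp_trace_le (F := F) hΩ hb hL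
  choose φ hφ1 hφ2 hφ3 hφ4 using fun j : ℕ => exists_smooth_approx hΩ hb hL u
    (η := ((j : ℝ≥0∞) + 1)⁻¹) (ENNReal.inv_pos.2 (by
      exact_mod_cast ENNReal.natCast_ne_top (j + 1)))
  have hη : Tendsto (fun j : ℕ => ((j : ℝ≥0∞) + 1)⁻¹) atTop (𝓝 0) := by
    have := (tendsto_add_atTop_iff_nat 1).2 ENNReal.tendsto_inv_nat_nhds_zero
    simpa using this
  have h1 := (tendsto_toLp_iff_eLpNorm
    (fun j => memLp_smooth (volume.restrict Ω) (hφ1 j) (hφ2 j)) (fieldOf u)).2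
    (tendsto_of_tendsto_of_tendsto_of_le_of_le tendsto_const_nhds hη (fun _ => zero_le) hφ3)
  have h2 := (tendsto_toLp_iff_eLpNorm
    (fun j => memLp_classicalGrad (volume.restrict Ω) (hφ1 j) (hφ2 j)) (gradOf u)).2
    (tendsto_of_tendsto_of_tendsto_of_le_of_le tendsto_const_nhds hη (fun _ => zero_le) hφ4)
  have hcau : CauchySeq fun j =>
      (memLp_smooth (surfaceMeasure Ω) (hφ1 j) (hφ2 j)).toLp (φ j) := by
    rw [cauchySeq_iff_tendsto_dist_atTop_0]
    have c1 := cauchySeq_iff_tendsto_dist_atTop_0.1 h1.cauchySeq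
    have c2 := cauchySeq_iff_tendsto_dist_atTop_0.1 h2.cauchySeq
    have c3 := (c1.add c2).const_mul C
    rw [add_zero, mul_zero] at c3
    exact squeeze_zero (fun _ => dist_nonneg)
      (fun p => h (φ p.1) (φ p.2) (hφ1 _) (hφ2 _) (hφ1 _) (hφ2 _)) c3
  obtain ⟨g, hg⟩ := cauchySeq_tendsto_of_complete hcau
  exact ⟨g, (isTrace_iff u g).2 ⟨φ, fun j => ⟨hφ1 j, hφ2 j⟩, h1, h2, hg⟩⟩

lemma IsTrace.add [IsFiniteMeasure (surfaceMeasure Ω)] {u w : H1 Ω F}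
    {g k : Lp F 2 (surfaceMeasure Ω)} (hu : IsTrace u g) (hw : IsTrace w k) :
    IsTrace (u + w) (g + k) := by
  obtain ⟨φ, hφ, h1, h2, h3⟩ := (isTrace_iff u g).1 hu
  obtain ⟨ψ, hψ, k1, k2, k3⟩ := (isTrace_iff w k).1 hw
  refine (isTrace_iff _ _).2 ⟨fun j x => φ j x + ψ j x,
    fun j => ⟨(hφ j).1.add (hψ j).1, (hφ j).2.add (hψ j).2⟩, h1.add k1, ?_, h3.add k3⟩
  refine (h2.add k2).congr fun j => ?_
  rw [← MemLp.toLp_add]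
  exact MemLp.toLp_congr _ _
    (ae_of_all _ fun x => (classicalGrad_add (hφ j).1 (hψ j).1 x).symm)

lemma IsTrace.smul [IsFiniteMeasure (surfaceMeasure Ω)] (c : ℝ) {u : H1 Ω F}
    {g : Lp F 2 (surfaceMeasure Ω)} (hu : IsTrace u g) : IsTrace (c • u) (c • g) := by
  obtain ⟨φ, hφ, h1, h2, h3⟩ := (isTrace_iff u g).1 hu
  refine (isTrace_iff _ _).2 ⟨fun j x => c • φ j x,
    fun j => ⟨contDiff_const.smul (hφ j).1, (hφ j).2.smul_left⟩, h1.const_smul c, ?_,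
    h3.const_smul c⟩
  refine (h2.const_smul c).congr fun j => ?_
  rw [← MemLp.toLp_const_smul]
  exact MemLp.toLp_congr _ _
    (ae_of_all _ fun x => (classicalGrad_const_smul (hφ j).1 c x).symm)

variable [CompleteSpace F]

lemma isTrace_trace (hΩ : IsOpen Ω) (hb : Bornology.IsBounded Ω) (hL : HasLipschitzBoundary Ω)
    (u : H1 Ω F) : IsTrace u (trace u) := by
  have h := exists_isTrace hΩ hb hL u
  rw [trace, dif_pos h]
  exact h.choose_spec

lemma IsTrace.unique (hΩ : IsOpen Ω) (hb : Bornology.IsBounded Ω) (hL : HasLipschitzBoundary Ω)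
    {u : H1 Ω F} {g k : Lp F 2 (surfaceMeasure Ω)} (hg : IsTrace u g) (hk : IsTrace u k) :
    g = k := by
  obtain ⟨C, -, h⟩ := exists_dist_trace_le (F := F) hΩ hb hL
  have := h u u g k hg hk
  simpa using this

/-- The trace operator is linear and bounded on a bounded Lipschitz domain. -/
theorem exists_traceL (hΩ : IsOpen Ω) (hb : Bornology.IsBounded Ω)
    (hL : HasLipschitzBoundary Ω) :
    ∃ Tr : H1 Ω F →L[ℝ] Lp F 2 (surfaceMeasure Ω), ∀ u, Tr u = trace u := by
  have := isFiniteMeasure_surfaceMeasure hΩ hb hL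
  obtain ⟨C, hC, h⟩ := exists_dist_trace_le (F := F) hΩ hb hL
  have hadd : ∀ u w : H1 Ω F, trace (u + w) = trace u + trace w := fun u w =>
    (isTrace_trace hΩ hb hL (u + w)).unique hΩ hb hL
      ((isTrace_trace hΩ hb hL u).add (isTrace_trace hΩ hb hL w))
  have hsmul : ∀ (c : ℝ) (u : H1 Ω F), trace (c • u) = c • trace u := fun c u =>
    (isTrace_trace hΩ hb hL (c • u)).unique hΩ hb hL ((isTrace_trace hΩ hb hL u).smul c)
  let l : H1 Ω F →ₗ[ℝ] Lp F 2 (surfaceMeasure Ω) := ⟨⟨trace, hadd⟩, hsmul⟩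
  refine ⟨l.mkContinuous (C * 2) fun u => ?_, fun u => rfl⟩
  have h0 : trace (0 : H1 Ω F) = 0 := l.map_zero
  have := h u 0 (trace u) (trace 0) (isTrace_trace hΩ hb hL u) (isTrace_trace hΩ hb hL 0)
  have e1 : fieldOf (0 : H1 Ω F) = 0 := fieldL.map_zero
  have e2 : gradOf (0 : H1 Ω F) = 0 := gradL.map_zero
  rw [h0, e1, e2, dist_zero_right, dist_zero_right, dist_zero_right] at this
  refine this.trans ?_
  rw [mul_assoc, two_mul]
  gcongr
  · exact norm_fieldOf_le u
  · exact norm_gradOf_le u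

end Trace

/-! ### Integration by parts for smooth functions -/

section Green

variable {Ω : Set E3}

/-- Without boundary points, s would be covered by the disjoint open sets interior of Ω and exterior
of Ω, and would meet both. -/
lemma exists_mem_frontier_of_isPreconnected {s : Set E3} (hs : IsPreconnected s) {z w : E3}
    (hzs : z ∈ s) (hws : w ∈ s) (hz : z ∈ Ω) (hw : w ∉ Ω) : ∃ y ∈ s, y ∈ frontier Ω := by
  by_contra! h
  have hcl : ∀ y ∈ s, y ∈ closure Ω → y ∈ interior Ω := fun y hy hyc => by
    by_contra hi
    exact h y hy ⟨hyc, hi⟩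
  obtain ⟨y, -, hy1, hy2⟩ := hs (interior Ω) (closure Ω)ᶜ isOpen_interior
    isClosed_closure.isOpen_compl
    (fun y hy => (em (y ∈ closure Ω)).imp (hcl y hy) id)
    ⟨z, hzs, hcl z hzs (subset_closure hz)⟩
    ⟨w, hws, fun hwc => hw (interior_subset (hcl w hws hwc))⟩
  exact hy2 (interior_subset_closure hy1)

lemma exists_mem_frontier_segment {z w : E3} (hz : z ∈ Ω) (hw : w ∉ Ω) :
    ∃ y ∈ segment ℝ z w, y ∈ frontier Ω :=
  exists_mem_frontier_of_isPreconnected (convex_segment z w).isPreconnected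
    (left_mem_segment ℝ z w) (right_mem_segment ℝ z w) hz hw

/-- Where translation by `b` changes membership in `Ω`, the boundary is within distance `‖b‖`. -/
lemma exists_mem_frontier_dist_le {b z : E3} (hz : z ∈ symmDiff Ω ((fun z => z - b) ⁻¹' Ω)) :
    ∃ w ∈ frontier Ω, dist z w ≤ ‖b‖ := by
  have key : ∀ y ∈ segment ℝ z (z - b), dist z y ≤ ‖b‖ := by
    intro y hy
    have h := dist_add_dist_of_mem_segment hy
    have h2 : dist z (z - b) = ‖b‖ := by rw [dist_eq_norm]; congr 1; abel
    linarith [dist_nonneg (x := y) (y := z - b)]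
  rcases hz with ⟨h1, h2⟩ | ⟨h1, h2⟩
  · obtain ⟨y, hy, hyf⟩ := exists_mem_frontier_segment h1 (fun h => h2 (mem_preimage.2 h))
    exact ⟨y, hyf, key y hy⟩
  · obtain ⟨y, hy, hyf⟩ := exists_mem_frontier_segment (mem_preimage.1 h1) h2
    rw [segment_symm] at hy
    exact ⟨y, hyf, key y hy⟩

/-- A change of variables moves the translation from ψ to the domain, so the two integrals differ
only where membership in Ω and in Ω + b differs. -/
lemma enorm_integral_translate_sub_le (hΩ : MeasurableSet Ω) {ψ : E3 → ℝ} (hψ : Integrable ψ)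
    (b : E3) : ‖(∫ x in Ω, ψ (x + b)) - ∫ x in Ω, ψ x‖ₑ
      ≤ ∫⁻ z in symmDiff Ω ((fun z => z - b) ⁻¹' Ω), ‖ψ z‖ₑ := by
  have hpre : MeasurableSet ((fun z => z - b) ⁻¹' Ω) := (measurable_sub_const b) hΩ
  have h1 : ∫ x in Ω, ψ (x + b) = ∫ z, ((fun z => z - b) ⁻¹' Ω).indicator ψ z := by
    rw [← integral_indicator hΩ,
      ← integral_add_right_eq_self (fun z => ((fun z => z - b) ⁻¹' Ω).indicator ψ z) b]
    refine integral_congr_ae (ae_of_all _ fun x => ?_)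
    dsimp only
    by_cases hx : x ∈ Ω
    · rw [indicator_of_mem hx, indicator_of_mem (by simpa using hx)]
    · rw [indicator_of_notMem hx, indicator_of_notMem (by simpa using hx)]
  rw [h1, ← integral_indicator hΩ, ← integral_sub (hψ.indicator hpre) (hψ.indicator hΩ),
    ← lintegral_indicator (hΩ.symmDiff hpre)]
  refine (enorm_integral_le_lintegral_enorm _).trans (lintegral_mono fun z => ?_)
  by_cases h1 : z ∈ Ω <;> by_cases h2 : z ∈ (fun z => z - b) ⁻¹' Ω <;>
    simp [indicator, h1, h2, symmDiff_def]

lemma hasDerivAt_integral_translate {Ω : Set E3} (hv : volume Ω ≠ ⊤) {ψ : E3 → ℝ}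
    (hψ : ContDiff ℝ ∞ ψ) (hc : HasCompactSupport ψ) (a : E3) :
    HasDerivAt (fun t : ℝ => ∫ x in Ω, ψ (x + t • a)) (∫ x in Ω, fderiv ℝ ψ x a) 0 := by
  have hcont : Continuous (fderiv ℝ ψ) := hψ.continuous_fderiv (by simp)
  obtain ⟨Λ, hΛ⟩ := hcont.bounded_above_of_compact_support (hc.fderiv (𝕜 := ℝ))
  have hfin : IsFiniteMeasure (volume.restrict Ω) := ⟨by simpa using hv.lt_top⟩
  have key := hasDerivAt_integral_of_dominated_loc_of_deriv_le (μ := volume.restrict Ω)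
    (F := fun (t : ℝ) x => ψ (x + t • a)) (F' := fun t x => fderiv ℝ ψ (x + t • a) a) (x₀ := 0)
    (bound := fun _ => Λ * ‖a‖) (s := univ) univ_mem
    (Eventually.of_forall fun t =>
      (hψ.continuous.comp (by fun_prop : Continuous fun x : E3 => x + t • a)).aestronglyMeasurable)
    (by simpa using (hψ.continuous.integrable_of_hasCompactSupport hc).restrict)
    ((hcont.comp (by fun_prop : Continuous fun x : E3 => x + (0 : ℝ) • a)).clm_apply
      continuous_const).aestronglyMeasurable
    (ae_of_all _ fun x t _ => ((fderiv ℝ ψ (x + t • a)).le_opNorm a).trans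
      (mul_le_mul_of_nonneg_right (hΛ _) (norm_nonneg a)))
    (integrable_const _)
    (ae_of_all _ fun x t _ => by
      have h1 : HasDerivAt (fun t : ℝ => x + t • a) a t := by
        simpa using ((hasDerivAt_id t).smul_const a).const_add x
      exact ((hψ.differentiable (by simp)) (x + t • a)).hasFDerivAt.comp_hasDerivAt t h1)
  simpa using key.2

/-- The integral of a derivative over `Ω` is controlled by boundary values. -/
theorem exists_abs_integral_fderiv_le (hΩ : IsOpen Ω) (hb : Bornology.IsBounded Ω)
    (hL : HasLipschitzBoundary Ω) :
    ∃ C : ℝ, 0 ≤ C ∧ ∀ ψ : E3 → ℝ, ContDiff ℝ ∞ ψ → HasCompactSupport ψ → ∀ a : E3,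
      |∫ x in Ω, fderiv ℝ ψ x a| ≤ C * ‖a‖ * ∫ y, |ψ y| ∂surfaceMeasure Ω := by
  have hfin := isFiniteMeasure_surfaceMeasure hΩ hb hL
  choose! r A L h hG using fun x (hx : x ∈ frontier Ω) => hL.exists_isLocalGraph hx
  have hr : ∀ x ∈ frontier Ω, 0 < r x := fun x hx => (hG x hx).pos
  have hKc : IsCompact (frontier Ω) :=
    Metric.isCompact_of_isClosed_isBounded isClosed_frontier
      (hb.closure.subset frontier_subset_closure)
  obtain ⟨F, hFK, hcov⟩ := hKc.elim_nhds_subcover (fun x => Metric.ball x (r x / 4))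
    fun x hx => Metric.ball_mem_nhds x (by linarith [hr x hx])
  -- The derivative of t ↦ ∫_Ω ψ(x + ta) is estimated through difference quotients, whose error
  -- lives in a strip of width t‖a‖ around the boundary. In a chart the strip lies over vertical
  -- segments of length 2(1 + L)t‖a‖, which gives the constant after division by t.
  refine ⟨∑ x ∈ F, 2 * (1 + L x), by positivity, fun ψ hψ hc a => ?_⟩
  obtain ⟨Λ, hΛ⟩ := hψ.lipschitzWith_of_hasCompactSupport hc (by simp)
  have hint : Integrable ψ := hψ.continuous.integrable_of_hasCompactSupport hc
  have hintσ : Integrable (fun y => |ψ y|) (surfaceMeasure Ω) :=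
    (hψ.continuous.integrable_of_hasCompactSupport hc).abs
  set I := ∫ y, |ψ y| ∂surfaceMeasure Ω with hI
  set m := (surfaceMeasure Ω).real univ with hm
  have hm0 : 0 ≤ m := measureReal_nonneg
  -- the estimate for difference quotients
  have hstrip : ∀ t : ℝ, 0 < t → (∀ x ∈ F, (1 + L x) * (t * ‖a‖) < r x / 4) →
      |(∫ x in Ω, ψ (x + t • a)) - ∫ x in Ω, ψ x|
        ≤ ∑ x ∈ F, 2 * (1 + L x) * (t * ‖a‖) * (I + Λ * ((1 + L x) * (t * ‖a‖)) * m) := by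
    intro t ht hsmall
    set S := symmDiff Ω ((fun z => z - t • a) ⁻¹' Ω) with hS
    have hSm : MeasurableSet S :=
      hΩ.measurableSet.symmDiff ((measurable_sub_const _) hΩ.measurableSet)
    have hta : ‖t • a‖ = t * ‖a‖ := by rw [norm_smul, Real.norm_of_nonneg ht.le]
    have hSd : ∀ z ∈ S, ∃ w ∈ frontier Ω, dist z w ≤ t * ‖a‖ := fun z hz => by
      rw [← hta]; exact exists_mem_frontier_dist_le hz
    have hpiece : ∀ x ∈ F, ∫⁻ z in S ∩ Metric.ball x (r x / 2), ‖ψ z‖ₑ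
        ≤ ENNReal.ofReal (2 * (1 + L x) * (t * ‖a‖) * (I + Λ * ((1 + L x) * (t * ‖a‖)) * m)) := by
      intro x hx
      have hxf := hFK x hx
      set κ := (1 + (L x : ℝ)) * (t * ‖a‖) with hκ
      have hκ0 : 0 ≤ κ := by positivity
      refine ((hG x hxf).lintegral_le_lintegral_surface_lintegral_segment hΩ
        (hSm.inter Metric.isOpen_ball.measurableSet) inter_subset_right
        ((hsmall x hx).trans_le (by linarith [hr x hxf])) (fun z hz => hSd z hz.1)
        hψ.continuous.enorm.measurable).trans ?_
      rw [← hκ]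
      calc ∫⁻ y, (∫⁻ s in Icc (-κ) κ, ‖ψ (y + s • vertical (A x))‖ₑ) ∂surfaceMeasure Ω
          ≤ ∫⁻ y, ENNReal.ofReal (2 * κ * (|ψ y| + Λ * κ)) ∂surfaceMeasure Ω := by
            refine lintegral_mono fun y => ?_
            -- On the segment ψ differs from its boundary value by at most Λκ; this error is of
            -- second order in t after integration and disappears in the limit.
            calc ∫⁻ s in Icc (-κ) κ, ‖ψ (y + s • vertical (A x))‖ₑ
                ≤ ∫⁻ s in Icc (-κ) κ, ENNReal.ofReal (|ψ y| + Λ * κ) := by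
                  refine setLIntegral_mono' measurableSet_Icc fun s hs => ?_
                  rw [Real.enorm_eq_ofReal_abs]
                  refine ENNReal.ofReal_le_ofReal ?_
                  have h1 := hΛ.dist_le_mul (y + s • vertical (A x)) y
                  have h2 : dist (y + s • vertical (A x)) y = |s| := by
                    rw [dist_eq_norm, add_sub_cancel_left, norm_smul, norm_vertical, mul_one,
                      Real.norm_eq_abs]
                  rw [h2, Real.dist_eq] at h1
                  have h3 : (Λ : ℝ) * |s| ≤ Λ * κ :=
                    mul_le_mul_of_nonneg_left (abs_le.2 hs) Λ.coe_nonneg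
                  have h4 := abs_sub_abs_le_abs_sub (ψ (y + s • vertical (A x))) (ψ y)
                  linarith
              _ = ENNReal.ofReal (2 * κ * (|ψ y| + Λ * κ)) := by
                  rw [lintegral_const, Measure.restrict_apply_univ, Real.volume_Icc,
                    ← ENNReal.ofReal_mul (by positivity)]
                  congr 1; ring
        _ = ENNReal.ofReal (∫ y, 2 * κ * (|ψ y| + Λ * κ) ∂surfaceMeasure Ω) := by
            rw [ofReal_integral_eq_lintegral_ofReal]
            · exact (hintσ.add (integrable_const _)).const_mul _
            · exact ae_of_all _ fun y => by positivity
        _ = _ := by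
            rw [integral_const_mul, integral_add hintσ (integrable_const _), integral_const,
              smul_eq_mul, ← hI, ← hm]
            congr 1; rw [hκ]; ring
    -- A point of the strip is closer than r/4 to a boundary point, which lies in a covering ball of
    -- radius r/4; hence balls of radius r/2 cover the strip.
    have hScov : S ⊆ ⋃ x : F, S ∩ Metric.ball (x : E3) (r x / 2) := by
      intro z hz
      obtain ⟨w, hwf, hzw⟩ := hSd z hz
      obtain ⟨x, hx, hwx⟩ := mem_iUnion₂.1 (hcov hwf)
      refine mem_iUnion.2 ⟨⟨x, hx⟩, hz, ?_⟩
      have h1 : t * ‖a‖ ≤ (1 + L x) * (t * ‖a‖) := by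
        have : 0 ≤ (L x : ℝ) * (t * ‖a‖) := by positivity
        linarith
      have h2 := hsmall x hx
      rw [Metric.mem_ball] at hwx ⊢
      linarith [dist_triangle z w x]
    have hmain : ‖(∫ x in Ω, ψ (x + t • a)) - ∫ x in Ω, ψ x‖ₑ ≤ ENNReal.ofReal
        (∑ x ∈ F, 2 * (1 + L x) * (t * ‖a‖) * (I + Λ * ((1 + L x) * (t * ‖a‖)) * m)) := by
      refine (enorm_integral_translate_sub_le hΩ.measurableSet hint (t • a)).trans ?_
      rw [← hS, ENNReal.ofReal_sum_of_nonneg fun x _ => by positivity]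
      refine (lintegral_mono_set hScov).trans ?_
      refine (lintegral_iUnion_le _ _).trans ?_
      rw [tsum_fintype, ← Finset.sum_coe_sort F]
      exact Finset.sum_le_sum fun x _ => hpiece x x.2
    rw [Real.enorm_eq_ofReal_abs] at hmain
    exact (ENNReal.ofReal_le_ofReal_iff (by positivity)).1 hmain
  have hd := hasDerivAt_integral_translate (Ω := Ω) hb.measure_lt_top.ne hψ hc a
  have hslope := (hasDerivAt_iff_tendsto_slope_zero.1 hd).abs.mono_left
    (nhdsWithin_mono 0 fun t (ht : t ∈ Ioi (0 : ℝ)) => (mem_Ioi.1 ht).ne')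
  have hlim : Tendsto (fun t : ℝ => ∑ x ∈ F, 2 * (1 + L x) * ‖a‖ *
      (I + Λ * ((1 + L x) * (t * ‖a‖)) * m)) (𝓝[>] 0)
      (𝓝 (∑ x ∈ F, 2 * (1 + L x) * ‖a‖ * (I + Λ * ((1 + L x) * (0 * ‖a‖)) * m))) :=
    (Continuous.tendsto (by fun_prop) 0).mono_left nhdsWithin_le_nhds
  have hle := le_of_tendsto_of_tendsto hslope hlim ?_
  · refine hle.trans (le_of_eq ?_)
    simp only [zero_mul, mul_zero, add_zero]
    rw [← Finset.sum_mul, ← Finset.sum_mul]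
  · have hev : ∀ᶠ t : ℝ in 𝓝[>] 0, ∀ x ∈ F, (1 + L x) * (t * ‖a‖) < r x / 4 := by
      refine nhdsWithin_le_nhds ?_
      refine (eventually_all_finset F).2 fun x hx => ?_
      have hc : Continuous fun t : ℝ => (1 + (L x : ℝ)) * (t * ‖a‖) := by fun_prop
      have := hc.tendsto 0
      simp only [zero_mul, mul_zero] at this
      exact this.eventually (gt_mem_nhds (by linarith [hr x (hFK x hx)]))
    filter_upwards [hev, self_mem_nhdsWithin] with t ht ht0
    have h1 := hstrip t ht0 ht
    have ht0' : (0 : ℝ) < t := ht0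
    simp only [zero_add, zero_smul, add_zero]
    rw [smul_eq_mul, abs_mul, abs_of_pos (inv_pos.2 ht0'), inv_mul_le_iff₀ ht0']
    refine h1.trans (le_of_eq ?_)
    rw [Finset.mul_sum]
    refine Finset.sum_congr rfl fun x _ => ?_
    ring

end Green

/-! ### Integration by parts near a flat piece of the boundary -/

section FlatGreen

variable {Ω : Set E3} {K : ℕ} {Γ : Fin K → Set E3} {n : Fin K → E3}

lemma apply_two_eq_inner (A : E3 ≃ₗᵢ[ℝ] E3) (y : E3) : A y 2 = inner ℝ y (vertical A) := by
  rw [← A.inner_map_map, vertical, A.apply_symm_apply, EuclideanSpace.inner_single_right]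
  simp

/-- The reflection exchanging e with the third coordinate vector serves as the chart rotation. -/
lemma exists_vertical_eq {e : E3} (he : ‖e‖ = 1) : ∃ A : E3 ≃ₗᵢ[ℝ] E3, vertical A = e := by
  refine ⟨(ℝ ∙ (e - EuclideanSpace.single 2 1))ᗮ.reflection, ?_⟩
  rw [vertical, LinearIsometryEquiv.symm_apply_eq]
  exact (Submodule.reflection_sub (by simp [he])).symm

/-- Near a point of an inlet or outlet, `Ω` is a half space. -/
lemma IsInletOutletDomain.exists_flat_chart (hΩ : IsInletOutletDomain Ω Γ n) {k : Fin K} {x : E3}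
    (hx : x ∈ Γ k) : ∃ (ρ : ℝ) (A : E3 ≃ₗᵢ[ℝ] E3) (c : ℝ),
      IsLocalGraph Ω x ρ A 0 (fun _ => c) ∧ vertical A = -n k ∧
        Metric.ball x ρ ∩ frontier Ω ⊆ Γ k := by
  obtain ⟨U, hU, hUΓ⟩ := hΩ.relOpen k
  obtain ⟨c, hc⟩ := hΩ.flat k
  obtain ⟨ε, hε, hout⟩ := hΩ.outward k x hx
  obtain ⟨A, hA⟩ := exists_vertical_eq (e := -n k) (by rw [norm_neg, hΩ.unit k])
  obtain ⟨ρ, hρ, hρU⟩ := Metric.isOpen_iff.1 hU x (hUΓ ▸ hx).1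
  have hnn : inner ℝ (n k) (n k) = (1 : ℝ) := by
    rw [real_inner_self_eq_norm_sq, hΩ.unit k, one_pow]
  have hfr : Metric.ball x ρ ∩ frontier Ω ⊆ Γ k := fun y hy => by
    rw [hUΓ]; exact ⟨hρU hy.1, hy.2⟩
  have hlin : IsLinearMap ℝ fun y : E3 => inner ℝ y (n k) :=
    ⟨fun y z => inner_add_left _ _ _, fun a y => by rw [real_inner_smul_left, smul_eq_mul]⟩
  -- Inside the ball the boundary lies in the plane of Γ k. Each open half ball is connected and
  -- misses it, so it lies in Ω or in the complement; `outward` decides which.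
  have hlow : IsPreconnected (Metric.ball x ρ ∩ {y : E3 | inner ℝ y (n k) < c}) :=
    ((convex_ball x ρ).inter (convex_halfSpace_lt hlin c)).isPreconnected
  have hupp : IsPreconnected (Metric.ball x ρ ∩ {y : E3 | c < inner ℝ y (n k)}) :=
    ((convex_ball x ρ).inter (convex_halfSpace_gt hlin c)).isPreconnected
  obtain ⟨s, hs0, hs1⟩ := exists_between (lt_min hε hρ)
  have hsε : s ∈ Ioo 0 ε := ⟨hs0, hs1.trans_le (min_le_left _ _)⟩
  have hball : ∀ y ∈ Metric.ball x ρ, y ∈ Ω → inner ℝ y (n k) ≤ c := by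
    intro y hy hyΩ
    by_contra! hlt
    have hw : x + s • n k ∈ Metric.ball x ρ ∩ {y : E3 | c < inner ℝ y (n k)} := by
      constructor
      · rw [Metric.mem_ball, dist_eq_norm, add_sub_cancel_left, norm_smul, hΩ.unit k, mul_one,
          Real.norm_of_nonneg hs0.le]
        exact hs1.trans_le (min_le_right _ _)
      · rw [mem_ofPred_eq, inner_add_left, real_inner_smul_left, hnn, hc x hx]
        linarith
    obtain ⟨z, ⟨hz1, hz2⟩, hzf⟩ := exists_mem_frontier_of_isPreconnected hupp ⟨hy, hlt⟩ hw hyΩ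
      fun h => (hout s hsε).2 (subset_closure h)
    exact (ne_of_gt hz2) (hc z (hfr ⟨hz1, hzf⟩))
  refine ⟨ρ, A, -c, ⟨LipschitzWith.const _, hρ, fun y hy => ?_⟩, hA, hfr⟩
  rw [apply_two_eq_inner, hA, inner_neg_right, neg_lt_neg_iff]
  constructor
  · intro hyΩ
    refine lt_of_le_of_ne (hball y hy hyΩ) fun heq => ?_
    -- A point of the open set Ω on the plane itself would have points of Ω beyond the plane,
    -- contrary to `hball`.
    have hlim : Tendsto (fun s : ℝ => y + s • n k) (𝓝[>] 0) (𝓝 y) := by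
      have : Continuous fun s : ℝ => y + s • n k := by fun_prop
      simpa using (this.tendsto 0).mono_left nhdsWithin_le_nhds
    obtain ⟨s, hs1, hs2, hs3⟩ := ((hlim.eventually (Metric.isOpen_ball.mem_nhds hy)).and
      ((hlim.eventually (hΩ.isOpen.mem_nhds hyΩ)).and self_mem_nhdsWithin)).exists
    have := hball _ hs1 hs2
    rw [inner_add_left, real_inner_smul_left, hnn, heq] at this
    have hs3' : 0 < s := hs3
    linarith
  · intro hlt
    by_contra hyΩ
    have hw : x - s • n k ∈ Metric.ball x ρ ∩ {y : E3 | inner ℝ y (n k) < c} := by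
      constructor
      · rw [Metric.mem_ball, dist_eq_norm, sub_sub_cancel_left, norm_neg, norm_smul, hΩ.unit k,
          mul_one, Real.norm_of_nonneg hs0.le]
        exact hs1.trans_le (min_le_right _ _)
      · rw [mem_ofPred_eq, inner_sub_left, real_inner_smul_left, hnn, hc x hx]
        linarith
    obtain ⟨z, ⟨hz1, hz2⟩, hzf⟩ := exists_mem_frontier_of_isPreconnected hlow hw ⟨hy, hlt⟩
      (hout s hsε).1 hyΩ
    exact (ne_of_lt hz2) (hc z (hfr ⟨hz1, hzf⟩))

/-- For Lipschitz constant 0 the two comparison inequalities both have constant one. -/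
lemma IsLocalGraph.surfaceMeasure_restrict_eq {x : E3} {r c : ℝ} {A : E3 ≃ₗᵢ[ℝ] E3}
    (hG : IsLocalGraph Ω x r A 0 (fun _ => c)) (hΩ : IsOpen Ω) :
    (surfaceMeasure Ω).restrict (Metric.ball x r)
      = ((volume : Measure E2).map (graphMap A fun _ => c)).restrict (Metric.ball x r) := by
  have hb := (Metric.isOpen_ball (x := x) (ε := r)).measurableSet
  refine le_antisymm ?_ ?_
  · have h := Measure.restrict_mono_measure (hG.surfaceMeasure_restrict_le hΩ) (Metric.ball x r)
    rw [Measure.restrict_restrict hb, inter_self] at h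
    simpa using h
  · have h := Measure.restrict_mono_measure (hG.map_graphMap_restrict_le hΩ) (Metric.ball x r)
    rwa [Measure.restrict_restrict hb, inter_self] at h

/-- The indicator of the half space is constant along tangential lines, so integrating by parts
against it leaves nothing. -/
lemma integral_halfSpace_fderiv_tangent (A : E3 ≃ₗᵢ[ℝ] E3) (c : ℝ) {ψ : E3 → ℝ}
    (hψ : ContDiff ℝ ∞ ψ) (hc : HasCompactSupport ψ) {a : E3} (ha : inner ℝ a (vertical A) = 0) :
    ∫ z in {z | c < A z 2}, fderiv ℝ ψ z a = 0 := by
  have hH : MeasurableSet {z | c < A z 2} := by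
    simp only [apply_two_eq_inner]
    exact measurableSet_lt measurable_const (by fun_prop)
  have h1 : Integrable fun z => fderiv ℝ ψ z a :=
    ((hψ.continuous_fderiv (by simp)).clm_apply continuous_const).integrable_of_hasCompactSupport
      (hc.fderiv_apply (𝕜 := ℝ) a)
  have h2 : Integrable ψ := hψ.continuous.integrable_of_hasCompactSupport hc
  have key := integral_bilinear_hasLineDerivAt_right_eq_neg_left_of_integrable (μ := volume)
    (f := {z : E3 | c < A z 2}.indicator fun _ => (1 : ℝ)) (f' := fun _ => 0) (g := ψ)
    (g' := fun z => fderiv ℝ ψ z a) (v := a) (B := ContinuousLinearMap.mul ℝ ℝ) (by simp)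
    ((h1.indicator hH).congr (ae_of_all _ fun z => by simp [indicator]))
    ((h2.indicator hH).congr (ae_of_all _ fun z => by simp [indicator]))
    (fun z _ => by
      have : ∀ t : ℝ, z + t • a ∈ {z | c < A z 2} ↔ z ∈ {z | c < A z 2} := fun t => by
        simp only [apply_two_eq_inner, mem_ofPred_eq, inner_add_left, real_inner_smul_left, ha,
          mul_zero, add_zero]
      simp only [HasLineDerivAt, indicator, this]
      exact hasDerivAt_const _ _)
    (fun z _ => ((hψ.differentiable (by simp)) z).hasFDerivAt.hasLineDerivAt a)
  rw [← integral_indicator hH]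
  simpa [indicator, ← ite_and] using key

/-- In graph coordinates this is the fundamental theorem of calculus on each vertical ray; the sign
comes from the lower endpoint. -/
lemma integral_halfSpace_fderiv_vertical (A : E3 ≃ₗᵢ[ℝ] E3) (c : ℝ) {ψ : E3 → ℝ}
    (hψ : ContDiff ℝ ∞ ψ) (hc : HasCompactSupport ψ) :
    ∫ z in {z | c < A z 2}, fderiv ℝ ψ z (vertical A)
      = -∫ y : E2, ψ (graphMap A (fun _ => c) y) := by
  have hH : MeasurableSet {z | c < A z 2} := by
    simp only [apply_two_eq_inner]
    exact measurableSet_lt measurable_const (by fun_prop)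
  have h1 : Integrable fun z => fderiv ℝ ψ z (vertical A) :=
    ((hψ.continuous_fderiv (by simp)).clm_apply continuous_const).integrable_of_hasCompactSupport
      (hc.fderiv_apply (𝕜 := ℝ) _)
  have h2 := h1.indicator hH
  have hmp := measurePreserving_graph (A := A) (h := fun _ => c) continuous_const
  rw [← integral_indicator hH, ← hmp.map_eq, integral_map hmp.measurable.aemeasurable
    (by rw [hmp.map_eq]; exact h2.aestronglyMeasurable), integral_prod, ← integral_neg]
  · refine integral_congr_ae (ae_of_all _ fun y => ?_)
    dsimp only
    set f : ℝ → ℝ := fun s => ψ (graphMap A (fun _ => c) y + s • vertical A) with hf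
    have hline : Isometry fun s : ℝ => graphMap A (fun _ => c) y + s • vertical A :=
      Isometry.of_dist_eq fun s t => by
        rw [dist_add_left, dist_eq_norm, ← sub_smul, norm_smul, norm_vertical, mul_one,
          ← dist_eq_norm]
    have hfd : ContDiff ℝ 1 f := (hψ.comp (by fun_prop)).of_le (by simp)
    have hfc : HasCompactSupport f := hc.comp_isClosedEmbedding hline.isClosedEmbedding
    have hderiv : ∀ s, deriv f s
        = fderiv ℝ ψ (graphMap A (fun _ => c) y + s • vertical A) (vertical A) := fun s => by
      have h1 : HasDerivAt (fun t : ℝ => graphMap A (fun _ => c) y + t • vertical A)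
          (vertical A) s := by
        simpa using ((hasDerivAt_id s).smul_const (vertical A)).const_add (graphMap A (fun _ => c) y)
      exact (((hψ.differentiable (by simp)) _).hasFDerivAt.comp_hasDerivAt s h1).deriv
    have key := hfc.integral_Ioi_deriv_eq hfd 0
    rw [← integral_indicator measurableSet_Ioi] at key
    have hf0 : f 0 = ψ (graphMap A (fun _ => c) y) := by simp [hf]
    rw [hf0] at key
    rw [← key]
    refine integral_congr_ae (ae_of_all _ fun s => ?_)
    simp only [indicator, mem_ofPred_eq, apply_two_add_smul_vertical, apply_two_graphMap, mem_Ioi,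
      lt_add_iff_pos_right, hderiv]
  · exact hmp.integrable_comp_of_integrable h2

/-- The divergence theorem for functions supported near a flat piece of the boundary. -/
lemma IsLocalGraph.integral_fderiv_eq {x : E3} {r c : ℝ} {A : E3 ≃ₗᵢ[ℝ] E3}
    (hG : IsLocalGraph Ω x r A 0 (fun _ => c)) (hΩ : IsOpen Ω) {ψ : E3 → ℝ}
    (hψ : ContDiff ℝ ∞ ψ) (hc : HasCompactSupport ψ) (hs : tsupport ψ ⊆ Metric.ball x r) (a : E3) :
    ∫ z in Ω, fderiv ℝ ψ z a = inner ℝ a (-vertical A) * ∫ y, ψ y ∂surfaceMeasure Ω := by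
  have hb := (Metric.isOpen_ball (x := x) (ε := r)).measurableSet
  have hH : MeasurableSet {z | c < A z 2} := by
    simp only [apply_two_eq_inner]
    exact measurableSet_lt measurable_const (by fun_prop)
  have h0 : ∀ z, z ∉ Metric.ball x r → fderiv ℝ ψ z = 0 := fun z hz => by
    by_contra h
    exact hz (hs (support_fderiv_subset ℝ h))
  have h0' : ∀ z, z ∉ Metric.ball x r → ψ z = 0 := fun z hz =>
    image_eq_zero_of_notMem_tsupport fun h => hz (hs h)
  have hint : ∀ b : E3, Integrable fun z => fderiv ℝ ψ z b := fun b =>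
    ((hψ.continuous_fderiv (by simp)).clm_apply continuous_const).integrable_of_hasCompactSupport
      (hc.fderiv_apply (𝕜 := ℝ) b)
  have hhalf : ∫ z in Ω, fderiv ℝ ψ z a = ∫ z in {z | c < A z 2}, fderiv ℝ ψ z a := by
    rw [← integral_indicator hΩ.measurableSet, ← integral_indicator hH]
    refine integral_congr_ae (ae_of_all _ fun z => ?_)
    by_cases hz : z ∈ Metric.ball x r
    · simp only [indicator, hG.mem_iff z hz, mem_ofPred_eq]
    · simp [indicator, h0 z hz]
  set e := vertical A with he
  have hee : inner ℝ e e = (1 : ℝ) := by rw [real_inner_self_eq_norm_sq, he, norm_vertical, one_pow]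
  -- The direction a is split into its vertical part, which produces the boundary term, and a
  -- tangential part, which contributes zero.
  have hdec : ∀ z, fderiv ℝ ψ z a = inner ℝ a e * fderiv ℝ ψ z e
      + fderiv ℝ ψ z (a - inner ℝ a e • e) := fun z => by
    rw [map_sub, map_smul, smul_eq_mul]; ring
  have hsurf : ∫ y, ψ y ∂surfaceMeasure Ω = ∫ y : E2, ψ (graphMap A (fun _ => c) y) := by
    rw [← setIntegral_eq_integral_of_forall_compl_eq_zero (s := Metric.ball x r) h0',
      hG.surfaceMeasure_restrict_eq hΩ,
      setIntegral_eq_integral_of_forall_compl_eq_zero (s := Metric.ball x r) h0',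
      integral_map hG.measurable_graphMap.aemeasurable hψ.continuous.aestronglyMeasurable]
  rw [hhalf, hsurf]
  simp only [hdec]
  rw [integral_add ((hint e).restrict.const_mul _) (hint _).restrict, integral_const_mul,
    integral_halfSpace_fderiv_vertical A c hψ hc, integral_halfSpace_fderiv_tangent A c hψ hc,
    inner_neg_right]
  · ring
  · rw [inner_sub_left, real_inner_smul_left, hee]; ring

end FlatGreen

/-! ### Integration by parts with walls, inlets and outlets -/

section WallGreen

variable {Ω : Set E3} {K : ℕ} {Γ : Fin K → Set E3} {n : Fin K → E3}

lemma IsInletOutletDomain.measurableSet (hΩ : IsInletOutletDomain Ω Γ n) (k : Fin K) :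
    MeasurableSet (Γ k) := by
  obtain ⟨U, hU, hUΓ⟩ := hΩ.relOpen k
  rw [hUΓ]
  exact hU.measurableSet.inter isClosed_frontier.measurableSet

lemma IsInletOutletDomain.subset_frontier (hΩ : IsInletOutletDomain Ω Γ n) (k : Fin K) :
    Γ k ⊆ frontier Ω := by
  obtain ⟨U, hU, hUΓ⟩ := hΩ.relOpen k
  rw [hUΓ]
  exact inter_subset_right

lemma IsInletOutletDomain.isFiniteMeasure (hΩ : IsInletOutletDomain Ω Γ n) :
    IsFiniteMeasure (surfaceMeasure Ω) :=
  isFiniteMeasure_surfaceMeasure hΩ.isOpen hΩ.isBounded hΩ.lipschitz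

/-- The defect in the divergence theorem when only inlets and outlets are taken into account. -/
def greenDefect (Γ : Fin K → Set E3) (n : Fin K → E3) (Ω : Set E3) (a : E3) (ψ : E3 → ℝ) : ℝ :=
  (∫ x in Ω, fderiv ℝ ψ x a) - ∑ k, inner ℝ a (n k) * ∫ y in Γ k, ψ y ∂surfaceMeasure Ω

lemma greenDefect_add (hΩ : IsInletOutletDomain Ω Γ n) (a : E3) {φ ψ : E3 → ℝ}
    (hφ : ContDiff ℝ ∞ φ) (hφc : HasCompactSupport φ) (hψ : ContDiff ℝ ∞ ψ)
    (hψc : HasCompactSupport ψ) :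
    greenDefect Γ n Ω a (fun x => φ x + ψ x) = greenDefect Γ n Ω a φ + greenDefect Γ n Ω a ψ := by
  have := hΩ.isFiniteMeasure
  have h1 : ∀ {φ : E3 → ℝ}, ContDiff ℝ ∞ φ → HasCompactSupport φ →
      IntegrableOn (fun z => fderiv ℝ φ z a) Ω := fun hφ hc =>
    (((hφ.continuous_fderiv (by simp)).clm_apply continuous_const).integrable_of_hasCompactSupport
      (hc.fderiv_apply (𝕜 := ℝ) a)).integrableOn
  have h2 : ∀ {φ : E3 → ℝ}, ContDiff ℝ ∞ φ → HasCompactSupport φ → ∀ k,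
      IntegrableOn φ (Γ k) (surfaceMeasure Ω) := fun hφ hc k =>
    (hφ.continuous.integrable_of_hasCompactSupport hc).integrableOn
  have e1 : ∀ x, fderiv ℝ (fun x => φ x + ψ x) x a = fderiv ℝ φ x a + fderiv ℝ ψ x a := fun x => by
    rw [fderiv_fun_add (hφ.differentiable (by simp) x) (hψ.differentiable (by simp) x)]
    rfl
  simp only [greenDefect, e1]
  rw [integral_add (h1 hφ hφc) (h1 hψ hψc)]
  simp only [integral_add (h2 hφ hφc _) (h2 hψ hψc _), mul_add, Finset.sum_add_distrib]
  ring

lemma greenDefect_sum (hΩ : IsInletOutletDomain Ω Γ n) (a : E3) {ι : Type*} (s : Finset ι)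
    {φ : ι → E3 → ℝ} (hφ : ∀ i, ContDiff ℝ ∞ (φ i)) (hφc : ∀ i, HasCompactSupport (φ i)) :
    greenDefect Γ n Ω a (fun x => ∑ i ∈ s, φ i x) = ∑ i ∈ s, greenDefect Γ n Ω a (φ i) := by
  classical
  induction s using Finset.induction_on with
  | empty => simp [greenDefect]
  | insert i s hi ih =>
    simp only [Finset.sum_insert hi]
    have hc : HasCompactSupport fun x => ∑ i ∈ s, φ i x := by
      have : (fun x => ∑ i ∈ s, φ i x) = ∑ i ∈ s, φ i := by ext x; simp
      rw [this]
      exact Finset.sum_induction φ HasCompactSupport (fun _ _ => HasCompactSupport.add)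
        HasCompactSupport.zero fun i _ => hφc i
    rw [greenDefect_add hΩ a (hφ i) (hφc i) (ContDiff.sum fun i _ => hφ i) hc, ih]

/-- The divergence theorem for functions supported near a point of an inlet or outlet. -/
lemma greenDefect_eq_zero (hΩ : IsInletOutletDomain Ω Γ n) {k : Fin K} {x : E3} {ρ c : ℝ}
    {A : E3 ≃ₗᵢ[ℝ] E3} (hG : IsLocalGraph Ω x ρ A 0 (fun _ => c)) (hA : vertical A = -n k)
    (hsub : Metric.ball x ρ ∩ frontier Ω ⊆ Γ k) (a : E3) {ψ : E3 → ℝ} (hψ : ContDiff ℝ ∞ ψ)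
    (hc : HasCompactSupport ψ) (hs : tsupport ψ ⊆ Metric.ball x ρ) :
    greenDefect Γ n Ω a ψ = 0 := by
  have h0 : ∀ z, z ∉ Metric.ball x ρ → ψ z = 0 := fun z hz =>
    image_eq_zero_of_notMem_tsupport fun h => hz (hs h)
  rw [greenDefect, hG.integral_fderiv_eq hΩ.isOpen hψ hc hs, hA, neg_neg, sub_eq_zero,
    Finset.sum_eq_single k]
  · congr 1
    rw [surfaceMeasure, Measure.restrict_restrict (hΩ.measurableSet k),
      inter_eq_left.2 (hΩ.subset_frontier k)]
    refine setIntegral_eq_of_subset_of_forall_sdiff_eq_zero isClosed_frontier.measurableSet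
      (hΩ.subset_frontier k) fun y hy => h0 y fun hyb => hy.2 (hsub ⟨hyb, hy.1⟩)
  · intro j _ hj
    rw [setIntegral_eq_zero_of_forall_eq_zero, mul_zero]
    intro y hy
    refine h0 y fun hyb => ?_
    exact (hΩ.disjoint j k hj).ne_of_mem hy (hsub ⟨hyb, hΩ.subset_frontier j hy⟩) rfl
  · simp

/-- The defect is linear in ψ and vanishes for functions supported near inlet or outlet points.
Cutting away a compact part of the Γ_k of almost full area therefore does not change it, and the
crude bound over the whole boundary shrinks to one over the wall. -/
theorem IsInletOutletDomain.exists_abs_greenDefect_le (hΩ : IsInletOutletDomain Ω Γ n) :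
    ∃ C : ℝ, 0 ≤ C ∧ ∀ ψ : E3 → ℝ, ContDiff ℝ ∞ ψ → HasCompactSupport ψ → ∀ a : E3,
      |greenDefect Γ n Ω a ψ| ≤ C * ‖a‖ * ∫ y in wall Ω Γ, |ψ y| ∂surfaceMeasure Ω := by
  have hfin := hΩ.isFiniteMeasure
  obtain ⟨C, hC, hest⟩ := exists_abs_integral_fderiv_le hΩ.isOpen hΩ.isBounded hΩ.lipschitz
  -- C bounds the volume integral, and each of the K boundary terms costs at most ‖a‖ ∫ |ψ| because
  -- n_k is a unit vector.
  have hcrude : ∀ ψ : E3 → ℝ, ContDiff ℝ ∞ ψ → HasCompactSupport ψ → ∀ a : E3,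
      |greenDefect Γ n Ω a ψ| ≤ (C + K) * ‖a‖ * ∫ y, |ψ y| ∂surfaceMeasure Ω := by
    intro ψ hψ hc a
    have hi : Integrable ψ (surfaceMeasure Ω) := hψ.continuous.integrable_of_hasCompactSupport hc
    have h1 : ∀ k, |inner ℝ a (n k) * ∫ y in Γ k, ψ y ∂surfaceMeasure Ω|
        ≤ ‖a‖ * ∫ y, |ψ y| ∂surfaceMeasure Ω := by
      intro k
      rw [abs_mul]
      refine mul_le_mul ?_ ?_ (abs_nonneg _) (norm_nonneg _)
      · have := abs_real_inner_le_norm a (n k)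
        rwa [hΩ.unit k, mul_one] at this
      · exact abs_integral_le_integral_abs.trans
          (setIntegral_le_integral hi.abs (ae_of_all _ fun y => abs_nonneg _))
    calc |greenDefect Γ n Ω a ψ|
        ≤ |∫ x in Ω, fderiv ℝ ψ x a|
          + |∑ k, inner ℝ a (n k) * ∫ y in Γ k, ψ y ∂surfaceMeasure Ω| := abs_sub _ _
      _ ≤ C * ‖a‖ * (∫ y, |ψ y| ∂surfaceMeasure Ω)
          + ∑ _k : Fin K, ‖a‖ * ∫ y, |ψ y| ∂surfaceMeasure Ω := by
          refine add_le_add (hest ψ hψ hc a) ?_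
          exact (Finset.abs_sum_le_sum_abs _ _).trans (Finset.sum_le_sum fun k _ => h1 k)
      _ = _ := by
          rw [Finset.sum_const, Finset.card_univ, Fintype.card_fin, nsmul_eq_mul]
          ring
  refine ⟨C + K, by positivity, fun ψ hψ hc a => ?_⟩
  obtain ⟨m, hm⟩ := hψ.continuous.bounded_above_of_compact_support hc
  have hm0 : 0 ≤ m := (norm_nonneg _).trans (hm 0)
  have hG : MeasurableSet (⋃ k, Γ k) := MeasurableSet.iUnion hΩ.measurableSet
  have hW : MeasurableSet (wall Ω Γ) := isClosed_frontier.measurableSet.diff hG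
  have hint : Integrable ψ (surfaceMeasure Ω) := hψ.continuous.integrable_of_hasCompactSupport hc
  have hkey : ∀ ε : ℝ, 0 < ε → |greenDefect Γ n Ω a ψ| ≤ (C + K) * ‖a‖ *
      ((∫ y in wall Ω Γ, |ψ y| ∂surfaceMeasure Ω) + m * ε) := by
    intro ε hε
    -- Inner regularity: the charts can shrink towards the edge of Γ_k, so finitely many of them
    -- cover only a compact part Q, up to area ε.
    obtain ⟨Q, hQG, hQ, hQε⟩ := hG.exists_isCompact_sdiff_lt (measure_ne_top (surfaceMeasure Ω) _)
      (ENNReal.ofReal_pos.2 hε).ne'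
    have hch : ∀ x ∈ Q, ∃ (ρ : ℝ) (k : Fin K) (A : E3 ≃ₗᵢ[ℝ] E3) (c : ℝ),
        IsLocalGraph Ω x ρ A 0 (fun _ => c) ∧ vertical A = -n k ∧
          Metric.ball x ρ ∩ frontier Ω ⊆ Γ k := fun x hx => by
      obtain ⟨k, hk⟩ := mem_iUnion.1 (hQG hx)
      obtain ⟨ρ, A, c, h⟩ := hΩ.exists_flat_chart hk
      exact ⟨ρ, k, A, c, h⟩
    choose! ρ k A c hchart using hch
    obtain ⟨t, χ, htQ, hχ, hχ0, hχ1, hχQ⟩ :=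
      exists_finite_smooth_partition hQ (r := ρ) fun x hx => (hchart x hx).1.pos
    set η : E3 → ℝ := fun y => 1 - ∑ i, χ i y with hη
    have hηd : ContDiff ℝ ∞ η := contDiff_const.sub (ContDiff.sum fun i _ => (hχ i).1)
    have hη0 : ∀ y, 0 ≤ η y := fun y => sub_nonneg.2 (hχ1 y)
    have hη1 : ∀ y, η y ≤ 1 := fun y => sub_le_self _ (Finset.sum_nonneg fun i _ => hχ0 i y)
    have hsplit : ψ = fun y => η y * ψ y + ∑ i, χ i y * ψ y := by
      ext y
      rw [← Finset.sum_mul, hη]; ring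
    have hzero : greenDefect Γ n Ω a ψ = greenDefect Γ n Ω a (fun y => η y * ψ y) := by
      conv_lhs => rw [hsplit]
      have hc2 : HasCompactSupport fun y => ∑ i, χ i y * ψ y := by
        have : (fun y => ∑ i, χ i y * ψ y) = (fun y => ∑ i, χ i y) * ψ := by
          ext y; simp [Finset.sum_mul]
        rw [this]
        exact hc.mul_left
      rw [greenDefect_add hΩ a (hηd.mul hψ) hc.mul_left
        (ContDiff.sum fun i _ => (hχ i).1.mul hψ) hc2,
        greenDefect_sum hΩ a Finset.univ (fun i => (hχ i).1.mul hψ) (fun i => hc.mul_left),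
        Finset.sum_eq_zero, add_zero]
      intro i _
      obtain ⟨h1, h2, h3⟩ := hchart i (htQ i i.2)
      exact greenDefect_eq_zero hΩ h1 h2 h3 a ((hχ i).1.mul hψ) hc.mul_left
        (tsupport_mul_subset_left.trans (hχ i).2.2)
    rw [hzero]
    refine (hcrude _ (hηd.mul hψ) hc.mul_left a).trans ?_
    refine mul_le_mul_of_nonneg_left ?_ (by positivity)
    -- The remaining factor η vanishes on Q and lies in [0, 1], so only the wall and the small set
    -- (⋃ Γ_k) \ Q contribute.
    have hae : ∀ᵐ y ∂surfaceMeasure Ω, |η y * ψ y| ≤ (wall Ω Γ).indicator (fun y => |ψ y|) y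
        + ((⋃ k, Γ k) \ Q).indicator (fun _ => m) y := by
      filter_upwards [ae_restrict_mem isClosed_frontier.measurableSet] with y hy
      have hle : |η y * ψ y| ≤ |ψ y| := by
        rw [abs_mul, abs_of_nonneg (hη0 y)]
        exact mul_le_of_le_one_left (abs_nonneg _) (hη1 y)
      have hn1 : 0 ≤ (wall Ω Γ).indicator (fun y => |ψ y|) y :=
        indicator_nonneg (fun _ _ => abs_nonneg _) y
      have hn2 : 0 ≤ ((⋃ k, Γ k) \ Q).indicator (fun _ => m) y :=
        indicator_nonneg (fun _ _ => hm0) y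
      by_cases hyG : y ∈ ⋃ k, Γ k
      · by_cases hyQ : y ∈ Q
        · have : η y = 0 := sub_eq_zero.2 (hχQ y hyQ).symm
          rw [this, zero_mul, abs_zero]
          exact add_nonneg hn1 hn2
        · rw [indicator_of_mem (show y ∈ (⋃ k, Γ k) \ Q from ⟨hyG, hyQ⟩)]
          have := hm y
          rw [Real.norm_eq_abs] at this
          linarith
      · rw [indicator_of_mem (show y ∈ wall Ω Γ from ⟨hy, hyG⟩)]
        linarith
    have hQm : MeasurableSet ((⋃ k, Γ k) \ Q) := hG.diff hQ.measurableSet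
    have hi1 := hint.abs.indicator hW
    have hi2 := (integrable_const (μ := surfaceMeasure Ω) m).indicator hQm
    calc ∫ y, |η y * ψ y| ∂surfaceMeasure Ω
        ≤ ∫ y, ((wall Ω Γ).indicator (fun y => |ψ y|) y
          + ((⋃ k, Γ k) \ Q).indicator (fun _ => m) y) ∂surfaceMeasure Ω :=
          integral_mono_ae
            (((hηd.mul hψ).continuous.integrable_of_hasCompactSupport hc.mul_left).abs)
            (hi1.add hi2) hae
      _ = (∫ y in wall Ω Γ, |ψ y| ∂surfaceMeasure Ω)
          + (surfaceMeasure Ω).real ((⋃ k, Γ k) \ Q) * m := by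
          rw [integral_add hi1 hi2, integral_indicator hW, integral_indicator hQm,
            setIntegral_const, smul_eq_mul]
      _ ≤ _ := by
          rw [mul_comm]
          gcongr
          exact ENNReal.toReal_le_of_le_ofReal hε.le hQε.le
  have hlim : Tendsto (fun ε : ℝ => (C + K) * ‖a‖ *
      ((∫ y in wall Ω Γ, |ψ y| ∂surfaceMeasure Ω) + m * ε)) (𝓝[>] 0) (𝓝 ((C + K) * ‖a‖ *
      ((∫ y in wall Ω Γ, |ψ y| ∂surfaceMeasure Ω) + m * 0))) :=
    (Continuous.tendsto (by fun_prop) 0).mono_left nhdsWithin_le_nhds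
  rw [mul_zero, add_zero] at hlim
  exact ge_of_tendsto hlim (eventually_nhdsWithin_of_forall fun ε hε => hkey ε hε)

end WallGreen

/-! ### Integration by parts in `H¹` -/

section SobolevGreen

variable {Ω : Set E3} {K : ℕ} {Γ : Fin K → Set E3} {n : Fin K → E3}

/-- Continuity of the L² pairing, stated for plain functions and an arbitrary measure: Green's
formula uses it on Ω, on each Γ_k and on the wall. -/
lemma tendsto_integral_inner {α E E' : Type*} {m : MeasurableSpace α} {μ : Measure α}
    [NormedAddCommGroup E] [NormedSpace ℝ E] [NormedAddCommGroup E'] [InnerProductSpace ℝ E']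
    (L : E →L[ℝ] E') {f : ℕ → α → E} {F : α → E} {g : ℕ → α → E'} {G : α → E'}
    (hf : ∀ j, MemLp (f j) 2 μ) (hF : MemLp F 2 μ) (hg : ∀ j, MemLp (g j) 2 μ) (hG : MemLp G 2 μ)
    (tf : Tendsto (fun j => eLpNorm (fun x => f j x - F x) 2 μ) atTop (𝓝 0))
    (tg : Tendsto (fun j => eLpNorm (fun x => g j x - G x) 2 μ) atTop (𝓝 0)) :
    Tendsto (fun j => ∫ x, inner ℝ (L (f j x)) (g j x) ∂μ) atTop
      (𝓝 (∫ x, inner ℝ (L (F x)) (G x) ∂μ)) := by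
  have h1 : Tendsto (fun j => (hf j).toLp (f j)) atTop (𝓝 (hF.toLp F)) := by
    rw [tendsto_iff_edist_tendsto_0]
    simp only [Lp.edist_toLp_toLp]
    exact tf
  have h2 : Tendsto (fun j => (hg j).toLp (g j)) atTop (𝓝 (hG.toLp G)) := by
    rw [tendsto_iff_edist_tendsto_0]
    simp only [Lp.edist_toLp_toLp]
    exact tg
  have key := (((L.compLpL 2 μ).continuous.tendsto _).comp h1).inner (𝕜 := ℝ) h2
  have hval : ∀ {a : α → E} {b : α → E'} (ha : MemLp a 2 μ) (hb : MemLp b 2 μ),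
      inner ℝ (L.compLpL 2 μ (ha.toLp a)) (hb.toLp b) = ∫ x, inner ℝ (L (a x)) (b x) ∂μ := by
    intro a b ha hb
    rw [L2.inner_def]
    refine integral_congr_ae ?_
    filter_upwards [L.coeFn_compLpL (p := 2) (ha.toLp a), ha.coeFn_toLp, hb.coeFn_toLp]
      with x h1 h2 h3
    rw [h1, h2, h3]
  rw [← hval hF hG]
  exact key.congr fun j => hval (hf j) (hg j)

/-- The map `(∂ᵢ Dⱼ)ᵢⱼ ↦ ∑ᵢ ∂ᵢ Dᵢ`. -/
def divMap : Grad (Grad E3) →L[ℝ] E3 :=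
  ∑ i, (PiLp.proj 2 (fun _ : Fin 3 => E3) i : Grad E3 →L[ℝ] E3) ∘L
    (PiLp.proj 2 (fun _ : Fin 3 => Grad E3) i : Grad (Grad E3) →L[ℝ] Grad E3)

lemma divMap_apply (G : Grad (Grad E3)) : divMap G = ∑ i, G i i := by
  simp [divMap, sum_apply]

/-- The map `D ↦ ∑ᵢ aᵢ Dᵢ`. -/
def dirMap (a : E3) : Grad E3 →L[ℝ] E3 :=
  ∑ i, a i • (PiLp.proj 2 (fun _ : Fin 3 => E3) i : Grad E3 →L[ℝ] E3)

lemma dirMap_apply (a : E3) (G : Grad E3) : dirMap a G = ∑ i, a i • G i := by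
  simp [dirMap, sum_apply]

lemma fderiv_inner_component {φ : E3 → Grad E3} {ψ : E3 → E3} (hφ : ContDiff ℝ ∞ φ)
    (hψ : ContDiff ℝ ∞ ψ) (i : Fin 3) (x : E3) :
    fderiv ℝ (fun x => inner ℝ (φ x i) (ψ x)) x (EuclideanSpace.single i 1)
      = inner ℝ (classicalGrad φ x i i) (ψ x) + inner ℝ (φ x i) (classicalGrad ψ x i) := by
  have h1 : HasFDerivAt (fun x => φ x i)
      ((PiLp.proj 2 (fun _ : Fin 3 => E3) i : Grad E3 →L[ℝ] E3) ∘L fderiv ℝ φ x) x :=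
    (PiLp.proj 2 (fun _ : Fin 3 => E3) i : Grad E3 →L[ℝ] E3).hasFDerivAt.comp x
      (hφ.differentiable (by simp) x).hasFDerivAt
  rw [fderiv_inner_apply ℝ h1.differentiableAt (hψ.differentiable (by simp) x), h1.fderiv]
  rw [add_comm]
  rfl

lemma contDiff_component {φ : E3 → Grad E3} (hφ : ContDiff ℝ ∞ φ) (i : Fin 3) :
    ContDiff ℝ ∞ fun x => φ x i :=
  (PiLp.proj 2 (fun _ : Fin 3 => E3) i : Grad E3 →L[ℝ] E3).contDiff.comp hφ

lemma hasCompactSupport_inner_left {φ : E3 → E3} {ψ : E3 → E3} (hψ : HasCompactSupport ψ) :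
    HasCompactSupport fun x => inner ℝ (φ x) (ψ x) := by
  refine hψ.mono fun x hx h0 => hx ?_
  simp [h0]

/-- By the product rule, the defects of the scalar functions ⟨φ_i, ψ⟩ in the directions e_i add up
to the defect in Green's formula for φ and ψ. -/
lemma sum_greenDefect_inner (hΩ : IsInletOutletDomain Ω Γ n) {φ : E3 → Grad E3} {ψ : E3 → E3}
    (hφ : ContDiff ℝ ∞ φ) (hψ : ContDiff ℝ ∞ ψ)
    (hψc : HasCompactSupport ψ) :
    ∑ i, greenDefect Γ n Ω (EuclideanSpace.single i 1) (fun x => inner ℝ (φ x i) (ψ x))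
      = (∫ x in Ω, inner ℝ (divMap (classicalGrad φ x)) (ψ x))
        + (∫ x in Ω, inner ℝ (φ x) (classicalGrad ψ x))
        - ∑ k, ∫ y in Γ k, inner ℝ (dirMap (n k) (φ y)) (ψ y) ∂surfaceMeasure Ω := by
  have := hΩ.isFiniteMeasure
  have hgφ := continuous_classicalGrad hφ
  have hgψ := continuous_classicalGrad hψ
  have c1 : ∀ i, Continuous fun x => φ x i := fun i => (contDiff_component hφ i).continuous
  have c2 : ∀ i, Continuous fun x => classicalGrad ψ x i := fun i =>
    (PiLp.proj 2 (fun _ : Fin 3 => E3) i : Grad E3 →L[ℝ] E3).continuous.comp hgψ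
  have c3 : ∀ i, Continuous fun x => classicalGrad φ x i i := fun i =>
    (PiLp.proj 2 (fun _ : Fin 3 => E3) i : Grad E3 →L[ℝ] E3).continuous.comp
      ((PiLp.proj 2 (fun _ : Fin 3 => Grad E3) i : Grad (Grad E3) →L[ℝ] Grad E3).continuous.comp
        hgφ)
  have i1 : ∀ i, IntegrableOn (fun x => inner ℝ (classicalGrad φ x i i) (ψ x)) Ω := fun i =>
    (((c3 i).inner hψ.continuous).integrable_of_hasCompactSupport
      (hasCompactSupport_inner_left hψc)).integrableOn
  have i2 : ∀ i, IntegrableOn (fun x => inner ℝ (φ x i) (classicalGrad ψ x i)) Ω := fun i =>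
    (((c1 i).inner (c2 i)).integrable_of_hasCompactSupport
      (hasCompactSupport_inner_left ((hasCompactSupport_classicalGrad hψc).mono
        fun x hx h0 => hx (by simp [h0])))).integrableOn
  have i3 : ∀ i k, IntegrableOn (fun x => inner ℝ (φ x i) (ψ x)) (Γ k) (surfaceMeasure Ω) :=
    fun i k => (((c1 i).inner hψ.continuous).integrable_of_hasCompactSupport
      (hasCompactSupport_inner_left hψc)).integrableOn
  have e1 : (∫ x in Ω, inner ℝ (divMap (classicalGrad φ x)) (ψ x))
      = ∑ i, ∫ x in Ω, inner ℝ (classicalGrad φ x i i) (ψ x) := by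
    simp only [divMap_apply, sum_inner]
    exact integral_finsetSum _ fun i _ => i1 i
  have e2 : (∫ x in Ω, inner ℝ (φ x) (classicalGrad ψ x))
      = ∑ i, ∫ x in Ω, inner ℝ (φ x i) (classicalGrad ψ x i) := by
    simp only [PiLp.inner_apply (𝕜 := ℝ) (ι := Fin 3) (f := fun _ => E3)]
    exact integral_finsetSum _ fun i _ => i2 i
  have e3 : ∀ k, ∫ y in Γ k, inner ℝ (dirMap (n k) (φ y)) (ψ y) ∂surfaceMeasure Ω
      = ∑ i, n k i * ∫ y in Γ k, inner ℝ (φ y i) (ψ y) ∂surfaceMeasure Ω := fun k => by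
    simp only [dirMap_apply, sum_inner, real_inner_smul_left]
    rw [integral_finsetSum _ fun i _ => (i3 i k).const_mul _]
    exact Finset.sum_congr rfl fun i _ => integral_const_mul _ _
  simp only [e1, e2, e3, greenDefect, fderiv_inner_component hφ hψ,
    EuclideanSpace.inner_single_left, map_one, one_mul]
  rw [Finset.sum_sub_distrib, Finset.sum_comm (γ := Fin K), ← Finset.sum_add_distrib]
  congr 1
  exact Finset.sum_congr rfl fun i _ => integral_add (i1 i) (i2 i)

/-- Green's formula for functions vanishing on the wall. -/
theorem IsInletOutletDomain.green (hΩ : IsInletOutletDomain Ω Γ n) (D : H1 Ω (Grad E3))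
    (w : H1 Ω E3) (hw : ∀ᵐ x ∂(surfaceMeasure Ω).restrict (wall Ω Γ), trace w x = 0) :
    (∫ x in Ω, inner ℝ (divMap (gradOf D x)) (fieldOf w x))
        + (∫ x in Ω, inner ℝ (fieldOf D x) (gradOf w x))
      = ∑ k, ∫ y in Γ k, inner ℝ (dirMap (n k) (trace D y)) (trace w y) ∂surfaceMeasure Ω := by
  have := hΩ.isFiniteMeasure
  obtain ⟨C, hC, hest⟩ := hΩ.exists_abs_greenDefect_le
  obtain ⟨φ, hφ, f1, f2, f3⟩ := isTrace_trace hΩ.isOpen hΩ.isBounded hΩ.lipschitz D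
  obtain ⟨ψ, hψ, g1, g2, g3⟩ := isTrace_trace hΩ.isOpen hΩ.isBounded hΩ.lipschitz w
  have hres : ∀ {E : Type} [NormedAddCommGroup E] {f : ℕ → E3 → E} (s : Set E3),
      Tendsto (fun j => eLpNorm (f j) 2 (surfaceMeasure Ω)) atTop (𝓝 0) →
      Tendsto (fun j => eLpNorm (f j) 2 ((surfaceMeasure Ω).restrict s)) atTop (𝓝 0) :=
    fun s h => tendsto_of_tendsto_of_tendsto_of_le_of_le tendsto_const_nhds h
      (fun _ => zero_le) fun j => eLpNorm_mono_measure _ Measure.restrict_le_self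
  have mφ : ∀ (μ : Measure E3) [IsFiniteMeasureOnCompacts μ] j, MemLp (φ j) 2 μ := fun μ _ j =>
    memLp_smooth μ (hφ j).1 (hφ j).2
  have mψ : ∀ (μ : Measure E3) [IsFiniteMeasureOnCompacts μ] j, MemLp (ψ j) 2 μ := fun μ _ j =>
    memLp_smooth μ (hψ j).1 (hψ j).2
  have t1 := tendsto_integral_inner divMap
    (fun j => memLp_classicalGrad (volume.restrict Ω) (hφ j).1 (hφ j).2) (Lp.memLp (gradOf D))
    (fun j => mψ _ j) (Lp.memLp (fieldOf w)) f2 g1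
  have t2 := tendsto_integral_inner (ContinuousLinearMap.id ℝ (Grad E3)) (fun j => mφ _ j)
    (Lp.memLp (fieldOf D)) (fun j => memLp_classicalGrad (volume.restrict Ω) (hψ j).1 (hψ j).2)
    (Lp.memLp (gradOf w)) f1 g2
  have t3 := fun k => tendsto_integral_inner (μ := (surfaceMeasure Ω).restrict (Γ k))
    (dirMap (n k)) (fun j => mφ _ j) ((Lp.memLp (trace D)).restrict _) (fun j => mψ _ j)
    ((Lp.memLp (trace w)).restrict _) (hres _ f3) (hres _ g3)
  have hnorm : ∀ {E : Type} [NormedAddCommGroup E] {f : ℕ → E3 → E} {g : E3 → E} {μ : Measure E3},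
      Tendsto (fun j => eLpNorm (fun x => f j x - g x) 2 μ) atTop (𝓝 0) →
      Tendsto (fun j => eLpNorm (fun x => ‖f j x‖ - ‖g x‖) 2 μ) atTop (𝓝 0) :=
    fun h => tendsto_of_tendsto_of_tendsto_of_le_of_le tendsto_const_nhds h
      (fun _ => zero_le) fun j => eLpNorm_mono fun x => abs_norm_sub_norm_le _ _
  -- The defect for the smooth approximations is at most 3C times ∫ |φ_j||ψ_j| over the wall, which
  -- tends to ∫ |tr D||tr w| = 0 because w vanishes there. The approximations themselves need not
  -- vanish on the wall.
  have t4 := tendsto_integral_inner (μ := (surfaceMeasure Ω).restrict (wall Ω Γ))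
    (ContinuousLinearMap.id ℝ ℝ) (fun j => (mφ _ j).norm) ((Lp.memLp (trace D)).restrict _).norm
    (fun j => (mψ _ j).norm) ((Lp.memLp (trace w)).restrict _).norm (hnorm (hres _ f3))
    (hnorm (hres _ g3))
  have hz : ∫ x in wall Ω Γ, inner ℝ ((ContinuousLinearMap.id ℝ ℝ) ‖trace D x‖) ‖trace w x‖
      ∂surfaceMeasure Ω = 0 := by
    refine integral_eq_zero_of_ae ?_
    filter_upwards [hw] with x hx
    simp [hx]
  rw [hz] at t4
  have hbound : ∀ j, |(∫ x in Ω, inner ℝ (divMap (classicalGrad (φ j) x)) (ψ j x))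
        + (∫ x in Ω, inner ℝ (ContinuousLinearMap.id ℝ (Grad E3) (φ j x)) (classicalGrad (ψ j) x))
        - ∑ k, ∫ y in Γ k, inner ℝ (dirMap (n k) (φ j y)) (ψ j y) ∂surfaceMeasure Ω|
      ≤ 3 * C * ∫ x in wall Ω Γ, inner ℝ ((ContinuousLinearMap.id ℝ ℝ) ‖φ j x‖) ‖ψ j x‖
        ∂surfaceMeasure Ω := by
    intro j
    have h := sum_greenDefect_inner hΩ (hφ j).1 (hψ j).1 (hψ j).2
    simp only [ContinuousLinearMap.id_apply]
    rw [← h]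
    refine (Finset.abs_sum_le_sum_abs _ _).trans ?_
    have hi : ∀ i ∈ Finset.univ, |greenDefect Γ n Ω (EuclideanSpace.single i 1)
        (fun x => inner ℝ (φ j x i) (ψ j x))|
        ≤ C * ∫ x in wall Ω Γ, inner ℝ ‖φ j x‖ ‖ψ j x‖ ∂surfaceMeasure Ω := by
      intro i _
      refine (hest _ ((contDiff_component (hφ j).1 i).inner ℝ (hψ j).1)
        (hasCompactSupport_inner_left (hψ j).2) _).trans ?_
      rw [PiLp.norm_single, norm_one, mul_one]
      refine mul_le_mul_of_nonneg_left (integral_mono ?_ ?_ fun x => ?_) hC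
      · exact ((((contDiff_component (hφ j).1 i).inner ℝ
          (hψ j).1).continuous.integrable_of_hasCompactSupport
          (hasCompactSupport_inner_left (hψ j).2)).abs)
      · refine Continuous.integrable_of_hasCompactSupport
          ((hφ j).1.continuous.norm.inner (hψ j).1.continuous.norm) ?_
        exact (hψ j).2.mono fun x hx h0 => hx (by simp [h0])
      · refine (abs_real_inner_le_norm _ _).trans ?_
        have : inner ℝ ‖φ j x‖ ‖ψ j x‖ = ‖φ j x‖ * ‖ψ j x‖ := by
          simp [mul_comm]
        rw [this]
        exact mul_le_mul_of_nonneg_right (PiLp.norm_apply_le _ i) (norm_nonneg _)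
    refine (Finset.sum_le_sum hi).trans (le_of_eq ?_)
    rw [Finset.sum_const, Finset.card_univ, Fintype.card_fin, nsmul_eq_mul]
    push_cast
    ring
  have hlim := le_of_tendsto_of_tendsto' ((t1.add t2).sub (tendsto_finsetSum _ fun k _ => t3 k)).abs
    (t4.const_mul (3 * C)) hbound
  rw [mul_zero] at hlim
  exact sub_eq_zero.1 (abs_nonpos_iff.1 hlim)

end SobolevGreen

/-! ### The abstract evolution equation -/

section Evolution

variable {X : Type*} [NormedAddCommGroup X] [InnerProductSpace ℝ X] [CompleteSpace X] {T : ℝ}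
  {M A : X →L[ℝ] X}

/-- Cauchy–Schwarz for a semidefinite form, from the discriminant of t ↦ ⟨M(x + ty), x + ty⟩. -/
lemma inner_apply_le_sqrt_mul_sqrt (hM : ∀ x y, inner ℝ (M x) y = inner ℝ x (M y))
    (hM0 : ∀ x, 0 ≤ inner ℝ (M x) x) (x y : X) :
    inner ℝ (M x) y ≤ √(inner ℝ (M x) x) * √(inner ℝ (M y) y) := by
  rw [← Real.sqrt_mul (hM0 x)]
  refine Real.le_sqrt_of_sq_le ?_
  have h : ∀ t : ℝ, 0 ≤ inner ℝ (M y) y * (t * t) + 2 * inner ℝ (M x) y * t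
      + inner ℝ (M x) x := fun t => by
    have := hM0 (x + t • y)
    have h2 : inner ℝ (M y) x = inner ℝ (M x) y := by rw [hM, real_inner_comm]
    simp only [map_add, map_smul, inner_add_left, inner_add_right, real_inner_smul_left,
      real_inner_smul_right, h2] at this
    linarith
  have := discrim_le_zero h
  rw [discrim] at this
  nlinarith

lemma pointwise_constTime {Y : Type*} [NormedAddCommGroup Y] [InnerProductSpace ℝ Y]
    [CompleteSpace Y] (L : X →L[ℝ] Y) (x : X) :
    pointwise L (constTime T x) = constTime T (L x) := by
  refine Lp.ext ?_
  filter_upwards [coeFn_pointwise L (constTime T x), coeFn_constTime (T := T) x,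
    coeFn_constTime (T := T) (L x)] with t h1 h2 h3
  rw [h1, h2, h3]

lemma pointwise_const_add_volterra {Y : Type*} [NormedAddCommGroup Y] [InnerProductSpace ℝ Y]
    [CompleteSpace Y] (L : X →L[ℝ] Y) (x : X) (z : L2Time T X) :
    pointwise L (constTime T x + volterra z) = constTime T (L x) + volterra (pointwise L z) := by
  rw [map_add, pointwise_constTime, volterra_pointwise]

/-- Multiplication by `exp (-t)` turns a solution `v` of `M v' + A v = F` into a solution of an
equation with the operator `A + M` instead of `A`. -/
lemma ae_expMul_equation {v v' F : L2Time T X}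
    (h : ∀ᵐ t ∂volume.restrict (Ioo 0 T), M (v' t) + A (v t) = F t) :
    pointwise M (expMul (-1) (v' + (-1 : ℝ) • v)) + pointwise (A + M) (expMul (-1) v)
      = expMul (-1) F := by
  refine Lp.ext ?_
  filter_upwards [h, coeFn_expMul (-1) F, coeFn_expMul (-1) v,
    coeFn_expMul (-1) (v' + (-1 : ℝ) • v), Lp.coeFn_add v' ((-1 : ℝ) • v),
    Lp.coeFn_smul (-1 : ℝ) v, Lp.coeFn_add (pointwise M (expMul (-1) (v' + (-1 : ℝ) • v)))
      (pointwise (A + M) (expMul (-1) v)),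
    coeFn_pointwise M (expMul (-1) (v' + (-1 : ℝ) • v)),
    coeFn_pointwise (A + M) (expMul (-1) v)] with t h0 h1 h2 h3 h4 h5 h6 h7 h8
  rw [h6, Pi.add_apply, h7, h8, h1, h2, h3, h4, Pi.add_apply, h5, Pi.smul_apply, ← h0, map_smul,
    map_smul, map_add, map_smul, add_apply, ← smul_add]
  congr 1
  simp only [neg_smul, one_smul]
  abel

/-- With v = exp(t) u and u = x₀ + J y, the equation becomes M y + (A + M) J y = exp(-t) F - (A + M)
x₀. Its right side has initial value F₀ - (A + M) x₀ and derivative exp(-t)(F' - F), which is the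
form required by `exists_pointwise_add_volterra_eq`. -/
theorem evolution_exists (hT : 0 < T) (hM : ∀ x y, inner ℝ (M x) y = inner ℝ x (M y))
    (hM0 : ∀ x, 0 ≤ inner ℝ (M x) x) {c : ℝ} (hc : 0 < c)
    (hA : ∀ x, c * ‖x‖ ^ 2 ≤ inner ℝ ((A + M) x) x) {F₀ x₀ : X} {C : ℝ} (hC : 0 ≤ C)
    (hF₀ : ∀ x, inner ℝ (F₀ - A x₀) x ≤ C * √(inner ℝ (M x) x)) (F' : L2Time T X) :
    ∃ v' : L2Time T X, ∀ᵐ t ∂volume.restrict (Ioo 0 T),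
      M (v' t) + A ((constTime T x₀ + volterra v') t) = (constTime T F₀ + volterra F') t := by
  set F := constTime T F₀ + volterra F' with hF
  obtain ⟨hF1, hF2⟩ := (hasWeakTimeDeriv_and_hasInitialValue_iff hT).2 hF
  have hG := (hasWeakTimeDeriv_and_hasInitialValue_iff hT).1 ⟨hF1.expMul (-1), hF2.expMul (-1)⟩
  set g := expMul (-1) (F' + (-1 : ℝ) • F) with hg
  -- The exponential weight adds -M x₀ to the compatibility condition; Cauchy–Schwarz for M bounds
  -- it, whence the extra summand in the constant.
  obtain ⟨y, hy⟩ := exists_pointwise_add_volterra_eq hM hM0 hc hA (g₀ := F₀ - (A + M) x₀)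
    (C := C + √(inner ℝ (M x₀) x₀)) (by positivity) (fun x => by
      have h1 := inner_apply_le_sqrt_mul_sqrt hM hM0 (-x₀) x
      have h2 : F₀ - (A + M) x₀ = (F₀ - A x₀) + M (-x₀) := by
        rw [add_apply, map_neg]; abel
      rw [h2, inner_add_left, add_mul]
      refine add_le_add (hF₀ x) ?_
      simpa using h1) g
  set u := constTime T x₀ + volterra y with hu
  obtain ⟨hu1, hu2⟩ := (hasWeakTimeDeriv_and_hasInitialValue_iff hT).2 hu
  have hv := (hasWeakTimeDeriv_and_hasInitialValue_iff hT).1 ⟨hu1.expMul 1, hu2.expMul 1⟩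
  refine ⟨expMul 1 (y + (1 : ℝ) • u), ?_⟩
  rw [← hv]
  have heq : pointwise M y + pointwise (A + M) u = expMul (-1) F := by
    rw [hG, hu, map_add, pointwise_constTime, ← add_assoc, add_right_comm, hy]
    have : constTime T (F₀ - (A + M) x₀) + constTime T ((A + M) x₀) = constTime T F₀ := by
      rw [← map_add, sub_add_cancel]
    rw [add_right_comm, this]
  filter_upwards [coeFn_expMul 1 (y + (1 : ℝ) • u), coeFn_expMul 1 u, coeFn_expMul (-1) F,
    Lp.coeFn_add (pointwise M y) (pointwise (A + M) u), coeFn_pointwise M y,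
    coeFn_pointwise (A + M) u, Lp.coeFn_add y ((1 : ℝ) • u), Lp.coeFn_smul (1 : ℝ) u]
    with t h1 h2 h3 h4 h5 h6 h7 h8
  rw [heq, h3, Pi.add_apply, h5, h6, add_apply] at h4
  rw [h1, h2, h7, Pi.add_apply, h8, Pi.smul_apply, one_smul, map_smul, map_smul, ← smul_add,
    map_add]
  have h9 : M (y t) + M (u t) + A (u t) = Real.exp (-1 * t) • F t := by
    rw [h4]; abel
  rw [h9, smul_smul, ← Real.exp_add]
  simp

/-- The exponential weight is injective and turns both solutions into solutions of the coercive
equation with the same data, to which `volterra_eq_of_pointwise_add_volterra_eq` applies. -/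
theorem evolution_unique (hT : 0 < T) (hM : ∀ x y, inner ℝ (M x) y = inner ℝ x (M y))
    (hM0 : ∀ x, 0 ≤ inner ℝ (M x) x) {c : ℝ} (hc : 0 < c)
    (hA : ∀ x, c * ‖x‖ ^ 2 ≤ inner ℝ ((A + M) x) x) {x₀ : X} {F v v' w w' : L2Time T X}
    (hv : v = constTime T x₀ + volterra v') (hw : w = constTime T x₀ + volterra w')
    (hvF : ∀ᵐ t ∂volume.restrict (Ioo 0 T), M (v' t) + A (v t) = F t)
    (hwF : ∀ᵐ t ∂volume.restrict (Ioo 0 T), M (w' t) + A (w t) = F t) : v = w := by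
  have hexp : ∀ {z z' : L2Time T X}, z = constTime T x₀ + volterra z' →
      expMul (-1) z = constTime T x₀ + volterra (expMul (-1) (z' + (-1 : ℝ) • z)) := fun hz => by
    obtain ⟨h1, h2⟩ := (hasWeakTimeDeriv_and_hasInitialValue_iff hT).2 hz
    exact (hasWeakTimeDeriv_and_hasInitialValue_iff hT).1 ⟨h1.expMul (-1), h2.expMul (-1)⟩
  have h1 := ae_expMul_equation hvF
  have h2 := ae_expMul_equation hwF
  rw [hexp hv, map_add] at h1
  rw [hexp hw, map_add] at h2
  have h3 := volterra_eq_of_pointwise_add_volterra_eq hM hM0 hc hA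
    (y₁ := expMul (-1) (v' + (-1 : ℝ) • v)) (y₂ := expMul (-1) (w' + (-1 : ℝ) • w)) (add_left_cancel
    (a := pointwise (A + M) (constTime T x₀)) (by
      rw [add_left_comm, h1, add_left_comm, h2]))
  refine expMul_injective (-1) ?_
  rw [hexp hv, hexp hw, h3]

end Evolution

/-! ### The spaces of velocity fields -/

section Velocity

variable {Ω : Set E3} {K : ℕ} {Γ : Fin K → Set E3} {n : Fin K → E3}

/-- The divergence of a velocity gradient. -/
def divergenceMap : Grad E3 →L[ℝ] ℝ :=
  ∑ i, (EuclideanSpace.proj i : E3 →L[ℝ] ℝ) ∘L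
    (PiLp.proj 2 (fun _ : Fin 3 => E3) i : Grad E3 →L[ℝ] E3)

lemma divergenceMap_apply (G : Grad E3) : divergenceMap G = ∑ i, G i i := by
  simp [divergenceMap, sum_apply]

/-- `V` is a closed subspace of `H¹`. -/
lemma IsInletOutletDomain.exists_submodule_eq_V (hΩ : IsInletOutletDomain Ω Γ n) :
    ∃ X : Submodule ℝ (H1 Ω E3), (∀ v, v ∈ X ↔ v ∈ V Ω Γ) ∧ IsClosed (X : Set (H1 Ω E3)) := by
  obtain ⟨Tr, hTr⟩ := exists_traceL (F := E3) hΩ.isOpen hΩ.isBounded hΩ.lipschitz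
  let P : H1 Ω E3 →L[ℝ] Lp ℝ 2 (volume.restrict Ω) :=
    divergenceMap.compLpL 2 (volume.restrict Ω) ∘L gradL
  let Q : H1 Ω E3 →L[ℝ] Lp E3 2 ((surfaceMeasure Ω).restrict (wall Ω Γ)) :=
    LpToLpRestrictCLM E3 E3 ℝ (surfaceMeasure Ω) 2 (wall Ω Γ) ∘L Tr
  have hP : ∀ v, P v = 0 ↔ ∀ᵐ x ∂volume.restrict Ω, ∑ i, gradOf v x i i = 0 := fun v => by
    rw [Lp.eq_zero_iff_ae_eq_zero]
    refine eventually_congr ?_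
    filter_upwards [divergenceMap.coeFn_compLpL (p := 2) (gradOf v)] with x hx
    rw [← divergenceMap_apply, ← hx]
    rfl
  have hQ : ∀ v, Q v = 0 ↔ ∀ᵐ x ∂(surfaceMeasure Ω).restrict (wall Ω Γ), trace v x = 0 :=
    fun v => by
    rw [Lp.eq_zero_iff_ae_eq_zero]
    refine eventually_congr ?_
    filter_upwards [LpToLpRestrictCLM_coeFn (p := 2) ℝ (wall Ω Γ) (Tr v)] with x hx
    rw [← hTr, ← hx]
    rfl
  refine ⟨P.ker ⊓ Q.ker, fun v => ?_, P.isClosed_ker.inter Q.isClosed_ker⟩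
  exact and_congr (hP v) (hQ v)

/-- The normal component on `Γ k` of boundary values. -/
def normalPart (Γ : Fin K → Set E3) (n : Fin K → E3) (k : Fin K) :
    Lp E3 2 (surfaceMeasure Ω) →L[ℝ] Lp ℝ 2 ((surfaceMeasure Ω).restrict (Γ k)) :=
  (innerSL ℝ (n k)).compLpL 2 ((surfaceMeasure Ω).restrict (Γ k)) ∘L
    LpToLpRestrictCLM E3 E3 ℝ (surfaceMeasure Ω) 2 (Γ k)

lemma coeFn_normalPart (k : Fin K) (g : Lp E3 2 (surfaceMeasure Ω)) :
    ∀ᵐ x ∂(surfaceMeasure Ω).restrict (Γ k), normalPart Γ n k g x = inner ℝ (g x) (n k) := by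
  filter_upwards [(innerSL ℝ (n k)).coeFn_compLpL (p := 2)
    (LpToLpRestrictCLM E3 E3 ℝ (surfaceMeasure Ω) 2 (Γ k) g),
    LpToLpRestrictCLM_coeFn (p := 2) ℝ (Γ k) g] with x h1 h2
  have : normalPart Γ n k g x = innerSL ℝ (n k)
      (LpToLpRestrictCLM E3 E3 ℝ (surfaceMeasure Ω) 2 (Γ k) g x) := h1
  rw [this, h2, innerSL_apply_apply, real_inner_comm]

lemma fluxInner_eq_inner (k : Fin K) (u w : H1 Ω E3) :
    fluxInner Γ n k u w
      = inner ℝ (normalPart Γ n k (trace u)) (normalPart Γ n k (trace w)) := by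
  rw [L2.inner_def]
  refine integral_congr_ae ?_
  filter_upwards [coeFn_normalPart (n := n) k (trace u), coeFn_normalPart (n := n) k (trace w)]
    with x h1 h2
  rw [h1, h2]
  simp [mul_comm]

lemma flux_eq_inner [IsFiniteMeasure (surfaceMeasure Ω)] (k : Fin K) (w : H1 Ω E3) :
    flux Γ n k w = inner ℝ (Lp.const 2 ((surfaceMeasure Ω).restrict (Γ k)) (1 : ℝ))
      (normalPart Γ n k (trace w)) := by
  rw [L2.inner_def]
  refine integral_congr_ae ?_
  filter_upwards [coeFn_normalPart (n := n) k (trace w),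
    Lp.coeFn_const 2 ((surfaceMeasure Ω).restrict (Γ k)) (1 : ℝ)] with x h1 h2
  rw [h1, h2]
  simp

/-- A vector without tangential part is determined by its normal part. -/
lemma inner_eq_of_tangential_eq_zero {m a b : E3}
    (h : ∀ i, inner ℝ a (EuclideanSpace.single i 1 - m i • m) = 0) :
    inner ℝ a b = inner ℝ a m * inner ℝ b m := by
  have ha : a = inner ℝ a m • m := by
    ext i
    have := h i
    rw [inner_sub_right, real_inner_smul_right, EuclideanSpace.inner_single_right] at this
    simp only [PiLp.smul_apply, smul_eq_mul]
    simp at this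
    linarith
  conv_lhs => rw [ha]
  rw [real_inner_smul_left, real_inner_comm b m]

/-- For `v ∈ V_{H²}` the Dirichlet form `w ↦ (∇v, ∇w)` is bounded by `w` in `L²` and the normal
components of `w` on the inlets and outlets. -/
theorem IsInletOutletDomain.exists_inner_gradOf_eq (hΩ : IsInletOutletDomain Ω Γ n) {v : H1 Ω E3}
    (hv : v ∈ VH2 Ω Γ n) :
    ∃ (d : L2 Ω E3) (p : ∀ k, Lp ℝ 2 ((surfaceMeasure Ω).restrict (Γ k))), ∀ w ∈ V Ω Γ,
      inner ℝ (gradOf v) (gradOf w)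
        = inner ℝ d (fieldOf w) + ∑ k, inner ℝ (p k) (normalPart Γ n k (trace w)) := by
  obtain ⟨-, D, hD, htan⟩ := hv
  -- Green's formula with D = ∇v gives d = -Δv and p_k = (∇v·n_k)·n_k.
  refine ⟨-divMap.compLpL 2 (volume.restrict Ω) (gradOf D),
    fun k => normalPart Γ n k ((dirMap (n k)).compLpL 2 (surfaceMeasure Ω) (trace D)),
    fun w hw => ?_⟩
  have hgreen := hΩ.green D w hw.2
  have e1 : inner ℝ (divMap.compLpL 2 (volume.restrict Ω) (gradOf D)) (fieldOf w)
      = ∫ x in Ω, inner ℝ (divMap (gradOf D x)) (fieldOf w x) := by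
    rw [L2.inner_def]
    refine integral_congr_ae ?_
    filter_upwards [divMap.coeFn_compLpL (p := 2) (gradOf D)] with x hx
    rw [hx]
  have e2 : inner ℝ (gradOf v) (gradOf w) = ∫ x in Ω, inner ℝ (fieldOf D x) (gradOf w x) := by
    rw [← hD, L2.inner_def]
  have e3 : ∀ k, inner ℝ (normalPart Γ n k ((dirMap (n k)).compLpL 2 (surfaceMeasure Ω) (trace D)))
      (normalPart Γ n k (trace w))
      = ∫ y in Γ k, inner ℝ (dirMap (n k) (trace D y)) (trace w y) ∂surfaceMeasure Ω := fun k => by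
    rw [L2.inner_def]
    refine integral_congr_ae ?_
    have hnn : inner ℝ (n k) (n k) = (1 : ℝ) := by
      rw [real_inner_self_eq_norm_sq, hΩ.unit k, one_pow]
    -- The null set in the definition of V_{H²} depends on τ; the tangential projections of the
    -- three basis vectors suffice to detect the tangential part.
    have ht : ∀ᵐ x ∂(surfaceMeasure Ω).restrict (Γ k), ∀ i : Fin 3,
        inner ℝ (∑ i, n k i • trace D x i) (EuclideanSpace.single i 1 - n k i • n k) = 0 := by
      refine ae_all_iff.2 fun i => htan k _ ?_
      rw [inner_sub_left, real_inner_smul_left, hnn, EuclideanSpace.inner_single_left]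
      simp
    filter_upwards [ht, coeFn_normalPart (n := n) k (trace w),
      coeFn_normalPart (n := n) k ((dirMap (n k)).compLpL 2 (surfaceMeasure Ω) (trace D)),
      ae_restrict_of_ae ((dirMap (n k)).coeFn_compLpL (p := 2) (trace D))] with x h1 h2 h3 h4
    rw [h2, h3, h4, dirMap_apply, inner_eq_of_tangential_eq_zero (b := trace w x) h1]
    simp [mul_comm]
  rw [inner_neg_left, e1, e2]
  simp only [e3]
  linarith

end Velocity

/-! ### The operators of the weak formulation -/

section Operators

variable {K : ℕ} {X H H' : Type*} [NormedAddCommGroup X] [InnerProductSpace ℝ X] [CompleteSpace X]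
  [NormedAddCommGroup H] [InnerProductSpace ℝ H] [CompleteSpace H]
  [NormedAddCommGroup H'] [InnerProductSpace ℝ H'] [CompleteSpace H']
  {G : Fin K → Type*} [∀ k, NormedAddCommGroup (G k)] [∀ k, InnerProductSpace ℝ (G k)]
  [∀ k, CompleteSpace (G k)] (P : X →L[ℝ] H) (Q : X →L[ℝ] H') (N : ∀ k, X →L[ℝ] G k)

/-- The operator of the form `b (P u, P w) + ∑ k, a k (N k u, N k w)`. -/
def formOp (b : ℝ) (a : Fin K → ℝ) : X →L[ℝ] X :=
  b • (ContinuousLinearMap.adjoint P ∘L P)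
    + ∑ k, a k • (ContinuousLinearMap.adjoint (N k) ∘L N k)

lemma inner_formOp (b : ℝ) (a : Fin K → ℝ) (u w : X) :
    inner ℝ (formOp P N b a u) w
      = b * inner ℝ (P u) (P w) + ∑ k, a k * inner ℝ (N k u) (N k w) := by
  simp only [formOp, add_apply, sum_apply, smul_apply, sum_inner, real_inner_smul_left,
    inner_add_left, ContinuousLinearMap.comp_apply, ContinuousLinearMap.adjoint_inner_left]

lemma inner_formOp_symm (b : ℝ) (a : Fin K → ℝ) (u w : X) :
    inner ℝ (formOp P N b a u) w = inner ℝ u (formOp P N b a w) := by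
  rw [real_inner_comm (formOp P N b a w) u, inner_formOp, inner_formOp, real_inner_comm (P w)]
  congr 1
  exact Finset.sum_congr rfl fun k _ => by rw [real_inner_comm]

lemma inner_formOp_self (b : ℝ) (a : Fin K → ℝ) (w : X) :
    inner ℝ (formOp P N b a w) w = b * ‖P w‖ ^ 2 + ∑ k, a k * ‖N k w‖ ^ 2 := by
  simp only [inner_formOp, real_inner_self_eq_norm_sq]

lemma le_inner_formOp_self (b : ℝ) {a : Fin K → ℝ} (ha : ∀ k, 0 < a k) (w : X) :
    b * ‖P w‖ ^ 2 ≤ inner ℝ (formOp P N b a w) w := by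
  rw [inner_formOp_self]
  exact le_add_of_nonneg_right (Finset.sum_nonneg fun k _ => mul_nonneg (ha k).le (sq_nonneg _))

/-- M supplies the L² part of the H¹ norm and A the gradient part; the boundary terms are
nonnegative and can be dropped. -/
lemma le_inner_formOp_add_formOp (hPQ : ∀ w, ‖w‖ ^ 2 = ‖P w‖ ^ 2 + ‖Q w‖ ^ 2) {ν : ℝ}
    {a b : Fin K → ℝ} (ha : ∀ k, 0 < a k) (hb : ∀ k, 0 < b k) (w : X) :
    min 1 ν * ‖w‖ ^ 2 ≤ inner ℝ ((formOp Q N ν b + formOp P N 1 a) w) w := by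
  rw [add_apply, inner_add_left, hPQ]
  have h1 := le_inner_formOp_self P N 1 ha w
  have h2 := le_inner_formOp_self Q N ν hb w
  have h3 : min 1 ν * ‖P w‖ ^ 2 ≤ 1 * ‖P w‖ ^ 2 :=
    mul_le_mul_of_nonneg_right (min_le_left _ _) (sq_nonneg _)
  have h4 : min 1 ν * ‖Q w‖ ^ 2 ≤ ν * ‖Q w‖ ^ 2 :=
    mul_le_mul_of_nonneg_right (min_le_right _ _) (sq_nonneg _)
  linarith

/-- Functionals that factor through `P` and the `N k` are bounded by the energy. -/
lemma exists_le_mul_sqrt_inner_formOp {a : Fin K → ℝ} (ha : ∀ k, 0 < a k) (d : H)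
    (p : ∀ k, G k) : ∃ C : ℝ, 0 ≤ C ∧ ∀ w : X,
      inner ℝ d (P w) + ∑ k, inner ℝ (p k) (N k w) ≤ C * √(inner ℝ (formOp P N 1 a w) w) := by
  refine ⟨‖d‖ + ∑ k, ‖p k‖ / √(a k), by positivity, fun w => ?_⟩
  have hk0 : ∀ k, 0 ≤ a k * ‖N k w‖ ^ 2 := fun k => mul_nonneg (ha k).le (sq_nonneg _)
  rw [add_mul, Finset.sum_mul]
  refine add_le_add ?_ (Finset.sum_le_sum fun k _ => ?_)
  · refine (real_inner_le_norm _ _).trans (mul_le_mul_of_nonneg_left ?_ (norm_nonneg _))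
    refine Real.le_sqrt_of_sq_le ?_
    simpa using le_inner_formOp_self P N 1 ha w
  · refine (real_inner_le_norm _ _).trans ?_
    rw [div_mul_eq_mul_div, mul_div_assoc]
    refine mul_le_mul_of_nonneg_left ?_ (norm_nonneg _)
    rw [le_div_iff₀ (Real.sqrt_pos.2 (ha k))]
    refine Real.le_sqrt_of_sq_le ?_
    rw [mul_pow, Real.sq_sqrt (ha k).le, inner_formOp_self]
    have := Finset.single_le_sum (fun k _ => hk0 k) (Finset.mem_univ k)
    linarith [sq_nonneg ‖P w‖]

/-- The representative of the functional `w ↦ (f, P w) - ∑ k, s k (e k, N k w)`. -/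
def force (f : H) (s : Fin K → ℝ) (e : ∀ k, G k) : X :=
  ContinuousLinearMap.adjoint P f - ∑ k, s k • ContinuousLinearMap.adjoint (N k) (e k)

lemma inner_force (f : H) (s : Fin K → ℝ) (e : ∀ k, G k) (w : X) :
    inner ℝ (force P N f s e) w = inner ℝ f (P w) - ∑ k, s k * inner ℝ (e k) (N k w) := by
  simp only [force, inner_sub_left, sum_inner, real_inner_smul_left,
    ContinuousLinearMap.adjoint_inner_left]

/-- The operator form of a variational equation. -/
lemma formOp_add_formOp_eq_force_iff {ν : ℝ} {a b s : Fin K → ℝ} {e : ∀ k, G k} {u u' : X}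
    {f : H} : formOp P N 1 a u' + formOp Q N ν b u = force P N f s e ↔
      ∀ w : X, inner ℝ (P u') (P w) + ν * inner ℝ (Q u) (Q w)
          + ∑ k, a k * inner ℝ (N k u') (N k w) + ∑ k, b k * inner ℝ (N k u) (N k w)
        = inner ℝ f (P w) - ∑ k, s k * inner ℝ (e k) (N k w) := by
  have hl : ∀ w : X, inner ℝ (formOp P N 1 a u' + formOp Q N ν b u) w
      = inner ℝ (P u') (P w) + ν * inner ℝ (Q u) (Q w)
          + ∑ k, a k * inner ℝ (N k u') (N k w) + ∑ k, b k * inner ℝ (N k u) (N k w) :=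
    fun w => by rw [inner_add_left, inner_formOp, inner_formOp]; ring
  constructor
  · intro h w
    rw [← hl, ← inner_force, h]
  · intro h
    refine ext_inner_right ℝ fun w => ?_
    rw [hl, inner_force, h]

variable {T : ℝ}

lemma coeFn_sum_time {ι : Type*} (s : Finset ι) (z : ι → L2Time T X) :
    ∀ᵐ t ∂volume.restrict (Ioo 0 T), (∑ i ∈ s, z i) t = ∑ i ∈ s, z i t := by
  classical
  induction s using Finset.induction_on with
  | empty =>
    simp only [Finset.sum_empty]
    exact Lp.coeFn_zero X 2 (volume.restrict (Ioo (0 : ℝ) T))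
  | insert i s hi ih =>
    simp only [Finset.sum_insert hi]
    filter_upwards [ih, Lp.coeFn_add (z i) (∑ i ∈ s, z i)] with t h1 h2
    rw [h2, Pi.add_apply, h1]

/-- Right-hand sides built from `H¹` functions of time are `H¹` functions of time. -/
lemma exists_force_eq_const_add_volterra {F : Type*} [NormedAddCommGroup F] [InnerProductSpace ℝ F]
    [CompleteSpace F] (R : F →L[ℝ] H) (f₀ : F) (f' : L2Time T F) (s₀ : Fin K → ℝ)
    (s' : Fin K → L2Time T ℝ) (e : ∀ k, G k) :
    ∃ F' : L2Time T X, ∀ᵐ t ∂volume.restrict (Ioo 0 T),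
      (constTime T (force P N (R f₀) s₀ e) + volterra F') t
        = force P N (R ((constTime T f₀ + volterra f') t))
          (fun k => (constTime T (s₀ k) + volterra (s' k)) t) e := by
  -- The force is linear in (f, s), through operators constant in time, and such operators commute
  -- with constants and primitives.
  let L : F →L[ℝ] X := ContinuousLinearMap.adjoint P ∘L R
  let l : ∀ k, ℝ →L[ℝ] X := fun k =>
    ContinuousLinearMap.toSpanSingleton ℝ (-ContinuousLinearMap.adjoint (N k) (e k))
  have hforce : ∀ f s, force P N (R f) s e = L f + ∑ k, l k (s k) := fun f s => by
    simp [force, L, l, ContinuousLinearMap.toSpanSingleton_apply, sub_eq_add_neg,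
      Finset.sum_neg_distrib]
  have hcomb : constTime T (force P N (R f₀) s₀ e)
      + volterra (pointwise L f' + ∑ k, pointwise (l k) (s' k))
      = pointwise L (constTime T f₀ + volterra f')
        + ∑ k, pointwise (l k) (constTime T (s₀ k) + volterra (s' k)) := by
    simp only [pointwise_const_add_volterra]
    simp only [hforce, map_add, map_sum, Finset.sum_add_distrib]
    abel
  refine ⟨pointwise L f' + ∑ k, pointwise (l k) (s' k), ?_⟩
  rw [hcomb]
  have hsum : ∀ᵐ t ∂volume.restrict (Ioo 0 T), ∀ k,
      pointwise (l k) (constTime T (s₀ k) + volterra (s' k)) t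
        = l k ((constTime T (s₀ k) + volterra (s' k)) t) :=
    ae_all_iff.2 fun k => coeFn_pointwise _ _
  filter_upwards [hsum, coeFn_pointwise L (constTime T f₀ + volterra f'),
    Lp.coeFn_add (pointwise L (constTime T f₀ + volterra f'))
      (∑ k, pointwise (l k) (constTime T (s₀ k) + volterra (s' k))),
    coeFn_sum_time Finset.univ
      (fun k => pointwise (l k) (constTime T (s₀ k) + volterra (s' k)))] with t h1 h2 h3 h4
  rw [h3, Pi.add_apply, h2, h4, hforce]
  simp only [h1]

/-- Existence and uniqueness for a variational evolution equation. -/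
theorem variational_evolution (hT : 0 < T) (hPQ : ∀ w, ‖w‖ ^ 2 = ‖P w‖ ^ 2 + ‖Q w‖ ^ 2) {ν : ℝ}
    (hν : 0 < ν) {γ lam : Fin K → ℝ} (hγ : ∀ k, 0 < γ k) (hlam : ∀ k, 0 < lam k) {x₀ : X} {d : H}
    {p : ∀ k, G k} (hx₀ : ∀ w, inner ℝ (Q x₀) (Q w)
      = inner ℝ d (P w) + ∑ k, inner ℝ (p k) (N k w))
    {F : Type*} [NormedAddCommGroup F] [InnerProductSpace ℝ F]
    [CompleteSpace F] (R : F →L[ℝ] H) {f f' : L2Time T F} {f₀ : F}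
    (hf : f = constTime T f₀ + volterra f') {s s' : Fin K → L2Time T ℝ} {s₀ : Fin K → ℝ}
    (hs : ∀ k, s k = constTime T (s₀ k) + volterra (s' k)) (e : ∀ k, G k) :
    ∃ u : L2Time T X, ∀ v : L2Time T X,
      (∃ v' : L2Time T X, v = constTime T x₀ + volterra v' ∧
        ∀ᵐ t ∂volume.restrict (Ioo 0 T), ∀ w : X,
          inner ℝ (P (v' t)) (P w) + ν * inner ℝ (Q (v t)) (Q w)
              + ∑ k, γ k * inner ℝ (N k (v' t)) (N k w)
              + ∑ k, lam k * inner ℝ (N k (v t)) (N k w)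
            = inner ℝ (R (f t)) (P w) - ∑ k, s k t * inner ℝ (e k) (N k w)) ↔ v = u := by
  have hsymm := inner_formOp_symm P N 1 γ
  have hpos : ∀ x, 0 ≤ inner ℝ (formOp P N 1 γ x) x := fun x =>
    le_trans (by positivity) (le_inner_formOp_self P N 1 hγ x)
  have hcoer := le_inner_formOp_add_formOp P Q N hPQ (ν := ν) hγ hlam
  have hc : 0 < min 1 ν := lt_min one_pos hν
  -- Compatibility at t = 0: after `hx₀` replaces the Dirichlet term, F₀ - A x₀ pairs with w only
  -- through P w and the N_k w, which the M-energy controls. The coefficients are collected here.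
  obtain ⟨C, hC, hbound⟩ := exists_le_mul_sqrt_inner_formOp P N hγ (R f₀ - ν • d)
    (fun k => -(s₀ k • e k) - ν • p k - lam k • N k x₀)
  have hF₀ : ∀ w : X, inner ℝ (force P N (R f₀) s₀ e - formOp Q N ν lam x₀) w
      ≤ C * √(inner ℝ (formOp P N 1 γ w) w) := fun w => by
    refine le_trans (le_of_eq ?_) (hbound w)
    rw [inner_sub_left, inner_force, inner_formOp, hx₀]
    simp only [inner_sub_left, inner_neg_left, real_inner_smul_left, Finset.sum_sub_distrib,
      Finset.sum_neg_distrib, ← Finset.mul_sum]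
    ring
  obtain ⟨F', hF'⟩ := exists_force_eq_const_add_volterra P N R f₀ f' s₀ s' e
  rw [← hf] at hF'
  simp only [← hs] at hF'
  obtain ⟨u', hu'⟩ := evolution_exists hT hsymm hpos hc hcoer hC hF₀ F'
  have heq : ∀ {v v' : L2Time T X}, (∀ᵐ t ∂volume.restrict (Ioo 0 T), ∀ w : X,
          inner ℝ (P (v' t)) (P w) + ν * inner ℝ (Q (v t)) (Q w)
              + ∑ k, γ k * inner ℝ (N k (v' t)) (N k w)
              + ∑ k, lam k * inner ℝ (N k (v t)) (N k w)
            = inner ℝ (R (f t)) (P w) - ∑ k, s k t * inner ℝ (e k) (N k w)) ↔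
      ∀ᵐ t ∂volume.restrict (Ioo 0 T), formOp P N 1 γ (v' t) + formOp Q N ν lam (v t)
        = (constTime T (force P N (R f₀) s₀ e) + volterra F') t := fun {v v'} => by
    refine eventually_congr ?_
    filter_upwards [hF'] with t ht
    rw [ht, formOp_add_formOp_eq_force_iff]
  refine ⟨constTime T x₀ + volterra u', fun v => ⟨?_, ?_⟩⟩
  · rintro ⟨v', hv, hv'⟩
    exact evolution_unique hT hsymm hpos hc hcoer hv rfl (heq.1 hv') hu'
  · rintro rfl
    exact ⟨u', rfl, heq.2 hu'⟩

/-- The same in a Hilbert space `Z` with a subset `W` that is identified with `X`. -/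
theorem variational_evolution_of_identification {Z : Type*} [NormedAddCommGroup Z]
    [InnerProductSpace ℝ Z] [CompleteSpace Z] {W : Set Z} (ι : X →L[ℝ] Z) (π : Z →L[ℝ] X)
    (hι : ∀ x, ‖ι x‖ = ‖x‖) (hιW : ∀ x, ι x ∈ W) (hπ : ∀ z ∈ W, ι (π z) = z)
    (P : Z →L[ℝ] H) (Q : Z →L[ℝ] H') (N : ∀ k, Z →L[ℝ] G k) (hT : 0 < T)
    (hPQ : ∀ w, ‖w‖ ^ 2 = ‖P w‖ ^ 2 + ‖Q w‖ ^ 2) {ν : ℝ}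
    (hν : 0 < ν) {γ lam : Fin K → ℝ} (hγ : ∀ k, 0 < γ k) (hlam : ∀ k, 0 < lam k) {z₀ : Z}
    (hz₀W : z₀ ∈ W) {d : H} {p : ∀ k, G k} (hz₀ : ∀ w ∈ W, inner ℝ (Q z₀) (Q w)
      = inner ℝ d (P w) + ∑ k, inner ℝ (p k) (N k w))
    {f f' : L2Time T Z} (hf : HasWeakTimeDeriv f f') {s s' : Fin K → L2Time T ℝ}
    (hs : ∀ k, HasWeakTimeDeriv (s k) (s' k)) (e : ∀ k, G k) :
    ∃! v : L2Time T Z, ∃ v' : L2Time T Z, IsH1TimeWith W v v' ∧ HasInitialValue v z₀ ∧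
      ∀ᵐ t ∂volume.restrict (Ioo 0 T), ∀ w ∈ W,
        inner ℝ (P (v' t)) (P w) + ν * inner ℝ (Q (v t)) (Q w)
            + ∑ k, γ k * inner ℝ (N k (v' t)) (N k w)
            + ∑ k, lam k * inner ℝ (N k (v t)) (N k w)
          = inner ℝ (P (f t)) (P w) - ∑ k, s k t * inner ℝ (e k) (N k w) := by
  obtain ⟨f₀, hf₀⟩ := hf.exists_eq_const_add_volterra hT
  choose s₀ hs₀ using fun k => (hs k).exists_eq_const_add_volterra hT
  have hx₀ := hπ z₀ hz₀W
  obtain ⟨u, hu⟩ := variational_evolution (P ∘L ι) (Q ∘L ι) (fun k => N k ∘L ι) hT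
    (fun w => by rw [← hι, hPQ]; rfl) hν hγ hlam (x₀ := π z₀)
    (fun w => by
      have := hz₀ (ι w) (hιW w)
      rw [← hx₀] at this
      exact this) P hf₀ hs₀ e
  simp only [ContinuousLinearMap.comp_apply] at hu
  refine ⟨pointwise ι u, ?_, ?_⟩
  · obtain ⟨u', hu1, hu2⟩ := (hu u).2 rfl
    have hv : pointwise ι u = constTime T z₀ + volterra (pointwise ι u') := by
      rw [hu1, pointwise_const_add_volterra, hx₀]
    obtain ⟨h1, h2⟩ := (hasWeakTimeDeriv_and_hasInitialValue_iff hT).2 hv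
    refine ⟨pointwise ι u', ⟨h1, ?_⟩, h2, ?_⟩
    · filter_upwards [coeFn_pointwise ι u', coeFn_pointwise ι u] with t h3 h4
      rw [h3, h4]
      exact ⟨hιW _, hιW _⟩
    · filter_upwards [coeFn_pointwise ι u', coeFn_pointwise ι u, hu2] with t h3 h4 h5 w hw
      have h6 := h5 (π w)
      rw [hπ w hw] at h6
      rw [h3, h4]
      exact h6
  · rintro v ⟨v', ⟨h1, h2⟩, h3, h4⟩
    have hv := (hasWeakTimeDeriv_and_hasInitialValue_iff hT).1 ⟨h1, h3⟩
    -- Any competitor takes values in W almost everywhere, so its image under π solves the problem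
    -- on X and equals u; applying ι recovers it.
    have hvu : pointwise π v = u := by
      refine (hu _).1 ⟨pointwise π v', ?_, ?_⟩
      · rw [hv, pointwise_const_add_volterra]
      · filter_upwards [h2, h4, coeFn_pointwise π v, coeFn_pointwise π v'] with t k1 k2 k3 k4 w
        rw [k3, k4, hπ _ k1.1, hπ _ k1.2]
        exact k2 (ι w) (hιW w)
    rw [← hvu]
    refine Lp.ext ?_
    filter_upwards [h2, coeFn_pointwise ι (pointwise π v), coeFn_pointwise π v] with t k1 k2 k3
    rw [k2, k3, hπ _ k1.1]

/-- The same for a closed subspace of a Hilbert space. -/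
theorem variational_evolution_submodule {Z : Type*} [NormedAddCommGroup Z]
    [InnerProductSpace ℝ Z] [CompleteSpace Z] {W : Set Z} {Y : Submodule ℝ Z}
    (hYW : ∀ z, z ∈ Y ↔ z ∈ W) (hY : IsClosed (Y : Set Z))
    (P : Z →L[ℝ] H) (Q : Z →L[ℝ] H') (N : ∀ k, Z →L[ℝ] G k) (hT : 0 < T)
    (hPQ : ∀ w, ‖w‖ ^ 2 = ‖P w‖ ^ 2 + ‖Q w‖ ^ 2) {ν : ℝ}
    (hν : 0 < ν) {γ lam : Fin K → ℝ} (hγ : ∀ k, 0 < γ k) (hlam : ∀ k, 0 < lam k) {z₀ : Z}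
    (hz₀W : z₀ ∈ W) {d : H} {p : ∀ k, G k} (hz₀ : ∀ w ∈ W, inner ℝ (Q z₀) (Q w)
      = inner ℝ d (P w) + ∑ k, inner ℝ (p k) (N k w))
    {f f' : L2Time T Z} (hf : HasWeakTimeDeriv f f') {s s' : Fin K → L2Time T ℝ}
    (hs : ∀ k, HasWeakTimeDeriv (s k) (s' k)) (e : ∀ k, G k) :
    ∃! v : L2Time T Z, ∃ v' : L2Time T Z, IsH1TimeWith W v v' ∧ HasInitialValue v z₀ ∧
      ∀ᵐ t ∂volume.restrict (Ioo 0 T), ∀ w ∈ W,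
        inner ℝ (P (v' t)) (P w) + ν * inner ℝ (Q (v t)) (Q w)
            + ∑ k, γ k * inner ℝ (N k (v' t)) (N k w)
            + ∑ k, lam k * inner ℝ (N k (v t)) (N k w)
          = inner ℝ (P (f t)) (P w) - ∑ k, s k t * inner ℝ (e k) (N k w) := by
  have hcomp : CompleteSpace Y := hY.completeSpace_coe
  exact variational_evolution_of_identification (X := Y) Y.subtypeL Y.orthogonalProjectionOnto
    (fun _ => rfl) (fun y => (hYW _).1 y.2)
    (fun z hz => congrArg Subtype.val
      (Y.orthogonalProjectionOnto_mem_subspace_eq_self ⟨z, (hYW z).2 hz⟩))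
    P Q N hT hPQ hν hγ hlam hz₀W hz₀ hf hs e

end Operators

/-! ### Existence and uniqueness of weak solutions -/

section Main

variable {Ω : Set E3} {K : ℕ} {Γ : Fin K → Set E3} {n : Fin K → E3} {T : ℝ}

theorem existsUnique_isWeakSolution (hΩ : IsInletOutletDomain Ω Γ n) {ν : ℝ} (hν : 0 < ν)
    {γ lam : Fin K → ℝ} (hγ : ∀ k, 0 < γ k) (hlam : ∀ k, 0 < lam k) (hT : 0 < T)
    {v₀ : H1 Ω E3} (hv₀ : v₀ ∈ VH2 Ω Γ n) {S : Fin K → L2Time T ℝ}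
    (hS : ∀ k, MemH1Time univ (S k)) {f : L2Time T (H1 Ω E3)} (hf : MemH1Time (V Ω Γ) f) :
    ∃! v : L2Time T (H1 Ω E3), IsWeakSolution Γ n ν γ lam S f v₀ v := by
  have hfin := hΩ.isFiniteMeasure
  obtain ⟨Y, hY, hYc⟩ := hΩ.exists_submodule_eq_V
  obtain ⟨Tr, hTr⟩ := exists_traceL (F := E3) hΩ.isOpen hΩ.isBounded hΩ.lipschitz
  obtain ⟨f', hf', -⟩ := hf
  choose S' hS' using hS
  obtain ⟨d, p, hdp⟩ := hΩ.exists_inner_gradOf_eq hv₀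
  have hPQ : ∀ w : H1 Ω E3, ‖w‖ ^ 2 = ‖fieldL w‖ ^ 2 + ‖gradL w‖ ^ 2 := fun w => by
    have h := inner_H1 w w
    rw [real_inner_self_eq_norm_sq, real_inner_self_eq_norm_sq, real_inner_self_eq_norm_sq] at h
    exact h
  -- P is the embedding into L², Q the gradient, N_k the normal trace on Γ_k, and e_k = 1, so that
  -- the pairing with e_k is the flux.
  have key := variational_evolution_submodule (Z := H1 Ω E3)
    (G := fun k => Lp ℝ 2 ((surfaceMeasure Ω).restrict (Γ k))) hY hYc fieldL gradL
    (fun k => normalPart Γ n k ∘L Tr) hT hPQ hν hγ hlam hv₀.1 (d := d) (p := p)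
    (fun w hw => by
      simp only [ContinuousLinearMap.comp_apply, hTr]
      exact hdp w hw)
    hf' (fun k => (hS' k).1) (fun k => Lp.const 2 ((surfaceMeasure Ω).restrict (Γ k)) (1 : ℝ))
  simp only [ContinuousLinearMap.comp_apply, hTr, ← fluxInner_eq_inner, ← flux_eq_inner] at key
  exact key

end Main

end OpenStokes

end

theorem theorem1 (Ω : Set OpenStokes.E3) (K : ℕ) (Γ : Fin K → Set OpenStokes.E3)
    (n : Fin K → OpenStokes.E3) (hΩ : OpenStokes.IsInletOutletDomain Ω Γ n)
    (ν : ℝ) (hν : 0 < ν)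
    (γ lam : Fin K → ℝ) (hγ : ∀ k, 0 < γ k) (hlam : ∀ k, 0 < lam k)
    (T : ℝ) (hT : 0 < T)
    (v₀ : OpenStokes.H1 Ω OpenStokes.E3) (hv₀ : v₀ ∈ OpenStokes.VH2 Ω Γ n)
    (S : Fin K → OpenStokes.L2Time T ℝ) (hS : ∀ k, OpenStokes.MemH1Time Set.univ (S k))
    (f : OpenStokes.L2Time T (OpenStokes.H1 Ω OpenStokes.E3))
    (hf : OpenStokes.MemH1Time (OpenStokes.V Ω Γ) f) :
    ∃! v : OpenStokes.L2Time T (OpenStokes.H1 Ω OpenStokes.E3),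
      OpenStokes.IsWeakSolution Γ n ν γ lam S f v₀ v :=
  OpenStokes.existsUnique_isWeakSolution hΩ hν hγ hlam hT hv₀ hS hf
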